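/- Let $\mathfrak g=\widehat{\mathfrak{sl}}_2=(\mathfrak{sl}_2\otimes\mathbb C[t,t^{-1}])\oplus\mathbb Cc\oplus\mathbb Cd$ be the affine Lie algebra with $[a\otimes t^m,b\otimes t^n]=[a,b]\otimes t^{m+n}+\delta_{m,-n}\,m\,(a,b)\,c$, $[d,a\otimes t^m]=m\,a\otimes t^m$, $c$ central, where $(\ ,\ )$ is the Killing form of $\mathfrak{sl}_2$. Let $e,f,h$ be the standard basis of $\mathfrak{sl}_2$, put $e_n=e\otimes t^n$, $f_n=f\otimes t^n$, $h_n=h\otimes t^n$, and let $\mathfrak h=\mathbb Ch_0\oplus\mathbb Cc\oplus\mathbb Cd$ be the Cartan subalgebra. Let $\beta,\delta\in\mathfrak h^*$ be given by $\beta(h_0)=2$, $\beta(c)=\beta(d)=0$, $\delta(h_0)=\delta(c)=0$, $\delta(d)=1$; let $Q=\mathbb Z\beta+\mathbb Z\delta$. The real roots are $\pm\beta+n\delta$ $(n\in\mathbb Z)$, with root vectors $e_n$ (for $\beta+n\delta$) and $f_n$ (for $-\beta+n\delta$). Put $U=U(\mathfrak g)$. For $\lambda\in\mathfrak h^*$ let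 $M(\lambda)=U\otimes_{U(\mathfrak g_+\oplus\mathfrak h)}\mathbb C_\lambda$ be the imaginary Verma module, where $\mathfrak g_+$ is spanned by all $e_n$ $(n\in\mathbb Z)$ and all $h_m$ $(m>0)$, $\mathfrak g_+$ acts on $\mathbb C_\lambda=\mathbb C$ by zero and $\mathfrak h$ by $\lambda$. Assume $\lambda(c)=0$, put $J=\lambda(h_0)$, and let $M'(\lambda)=M(\lambda)/\mathfrak M$, where $\mathfrak M$ is the submodule generated by the weight spaces $M(\lambda)_{\lambda-k\delta}$, $k>0$. For $i\in\mathbb Z$ let $\mathcal D_iU$ be the Ore localization of $U$ at $\{f_i^n\mid n\ge0\}$ and $\mathcal D_iV=\mathcal D_iU\otimes_UV$ for a $U$-module $V$. For $z\in\mathbb C$ let $\Theta_z(u)=\sum_{j\ge0}\binom zj(\operatorname{ad}f_i)^j(u)\,f_i^{-j}$ on $\mathcal D_iU$, and let $\mathcal D_i^zV$ be the twisted localization: the space of symbols $f_i^zv$, $v\in\mathcal D_iV$, with $u\cdot(f_i^zv)=f_i^z\,(\Theta_{-z}(u)v)$ (so $f_i^zv$ has weight $\mu+z(-\beta+i\delta)$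 if $v$ has weight $\mu$). Isomorphism and irreducibility refer to $U$-modules. A weight module $V=\bigoplus_\mu V_\mu$ is dense if $\{\mu\mid V_\mu\ne0\}$ is a full coset of $Q$ in $\mathfrak h^*$; it is torsion free if all $e_n$ and $f_n$ act injectively. $\mathcal W(\alpha)$ is the category of weight modules on which the root vector of the real root $\alpha$ acts locally nilpotently and the root vectors of all other real roots act injectively. (i) Let $i\in\mathbb Z$. If $z\in\mathbb Z$, then $\mathcal D_i^zM'(\lambda)\simeq\mathcal D_iM'(\lambda)$. The module $\mathcal D_iM'(\lambda)/M'(\lambda)$ is irreducible if and only if $J\notin\mathbb Z$; in that case it is a dense module in $\mathcal W(-\beta+i\delta)$ all of whose weight multiplicities are infinite. (ii) Let $i\in\mathbb Z$ and $z\in\mathbb C\setminus\mathbb Z$. If $J\neq0$ (equivalently, if $M'(\lambda)$ is irreducible), then $\mathcal D_i^zM'(\lambda)$ is irreducible if and only if $z-J\notin\mathbb Z$. Whenever $z-J\notin\mathbb Z$, $\mathcal D_i^zM'(\lambda)$ is a dense torsion free module all of whose weight multiplicities are infinite. (iii) For $i_1,i_2\in\mathbb Z$ and $z_1,z_2\in\mathbb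 C$, $\mathcal D_{i_1}^{z_1}M'(\lambda)\simeq\mathcal D_{i_2}^{z_2}M'(\lambda)$ if and only if $z_1-z_2\in\mathbb Z$ and $i_1=i_2$. -/

import Mathlib

namespace AffineSl2

open LieAlgebra
open scoped TensorProduct

/-- `sl₂(ℂ)`. -/
abbrev Sl2 : Type := SpecialLinear.sl (Fin 2) ℂ

/-- The loop algebra `sl₂ ⊗ ℂ[t, t⁻¹]`. -/
def Loop : Type := loopAlgebra ℂ ℤ Sl2

namespace Loop

noncomputable instance : LieRing Loop := inferInstanceAs (LieRing (loopAlgebra ℂ ℤ Sl2))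

noncomputable instance : LieAlgebra ℂ Loop :=
  inferInstanceAs (LieAlgebra ℂ (loopAlgebra ℂ ℤ Sl2))

/-- The finitely supported function `m ↦ aₘ` of a loop `∑ₘ aₘ ⊗ t^m`. -/
noncomputable def coeff : Loop ≃ₗ[ℂ] (ℤ →₀ Sl2) := LoopAlgebra.toFinsupp ℂ ℤ Sl2

end Loop

/-- The loop `a ⊗ t^m`. -/
noncomputable def monomial (m : ℤ) (a : Sl2) : Loop :=
  (AddMonoidAlgebra.single m (1 : ℂ) ⊗ₜ[ℂ] a : loopAlgebra ℂ ℤ Sl2)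

theorem coeff_monomial (m : ℤ) (a : Sl2) : Loop.coeff (monomial m a) = Finsupp.single m a :=
  LoopAlgebra.toFinsupp_single_tmul ℂ ℤ Sl2 m a

theorem coeff_symm_single (m : ℤ) (a : Sl2) :
    Loop.coeff.symm (Finsupp.single m a) = monomial m a :=
  LoopAlgebra.toFinsupp_symm_single ℂ ℤ Sl2 m a

theorem monomial_lie (m n : ℤ) (a b : Sl2) :
    ⁅monomial m a, monomial n b⁆ = monomial (m + n) ⁅a, b⁆ := by
  have h : ⁅monomial m a, monomial n b⁆ =
    ((AddMonoidAlgebra.single m (1 : ℂ) * AddMonoidAlgebra.single n (1 : ℂ)) ⊗ₜ[ℂ] ⁅a, b⁆ :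
      loopAlgebra ℂ ℤ Sl2) := rfl
  rw [h, AddMonoidAlgebra.single_mul_single, mul_one]
  rfl

theorem loop_induction {P : Loop → Prop} (x : Loop) (zero : P 0)
    (add : ∀ x y, P x → P y → P (x + y))
    (tmul : ∀ (m : ℤ) (a : Sl2), P (monomial m a)) : P x := by
  obtain ⟨f, rfl⟩ := Loop.coeff.symm.surjective x
  induction f using Finsupp.induction_linear with
  | zero => simpa using zero
  | add f g hf hg => rw [map_add]; exact add _ _ hf hg
  | single m a => rw [coeff_symm_single]; exact tmul m a

/-- The derivation `a ⊗ t^m ↦ m a ⊗ t^m` of the loop algebra, as a linear map. -/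
noncomputable def degree : Loop →ₗ[ℂ] Loop :=
  Loop.coeff.symm.toLinearMap ∘ₗ
    Finsupp.lsum ℂ (fun m : ℤ => (m : ℂ) • Finsupp.lsingle m) ∘ₗ Loop.coeff.toLinearMap

/-- The 2-cocycle `(a ⊗ t^m, b ⊗ t^n) ↦ δ_{m,-n} m (a, b)`, where `( , )` is the Killing form. -/
noncomputable def cocycle : Loop →ₗ[ℂ] Loop →ₗ[ℂ] ℂ :=
  (Finsupp.lsum ℂ fun m : ℤ => (m : ℂ) •
    ((killingForm ℂ Sl2).compl₂ (Finsupp.lapply (-m) ∘ₗ Loop.coeff.toLinearMap))) ∘ₗ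
      Loop.coeff.toLinearMap

theorem degree_monomial (m : ℤ) (a : Sl2) :
    degree (monomial m a) = (m : ℂ) • monomial m a := by
  simp only [degree, LinearMap.comp_apply, LinearEquiv.coe_coe, coeff_monomial,
    Finsupp.lsum_single, LinearMap.smul_apply, Finsupp.lsingle_apply, map_smul, coeff_symm_single]

theorem cocycle_monomial (m n : ℤ) (a b : Sl2) :
    cocycle (monomial m a) (monomial n b) =
      if m = -n then (m : ℂ) * killingForm ℂ Sl2 a b else 0 := by
  simp only [cocycle, LinearMap.comp_apply, LinearEquiv.coe_coe, coeff_monomial,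
    Finsupp.lsum_single, LinearMap.smul_apply, LinearMap.compl₂_apply, Finsupp.lapply_apply,
    smul_eq_mul]
  split_ifs with h
  · subst h; simp
  · rw [Finsupp.single_eq_of_ne (by omega)]; simp

theorem degree_lie (x y : Loop) : degree ⁅x, y⁆ = ⁅degree x, y⁆ + ⁅x, degree y⁆ := by
  induction x using loop_induction with
  | zero => simp
  | add x x' hx hx' => simp only [add_lie, map_add, hx, hx']; abel
  | tmul m a =>
    induction y using loop_induction with
    | zero => simp
    | add x x' hx hx' => simp only [lie_add, map_add, hx, hx']; abel
    | tmul n b =>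
      simp only [degree_monomial, smul_lie, lie_smul, monomial_lie, ← add_smul]
      push_cast
      rfl

theorem cocycle_skew (x y : Loop) : cocycle x y = -cocycle y x := by
  induction x using loop_induction with
  | zero => simp
  | add x x' hx hx' => simp only [map_add, LinearMap.add_apply, hx, hx']; abel
  | tmul m a =>
    induction y using loop_induction with
    | zero => simp
    | add x x' hx hx' => simp only [map_add, LinearMap.add_apply, hx, hx']; abel
    | tmul n b =>
      rw [cocycle_monomial, cocycle_monomial, LieModule.traceForm_comm ℂ Sl2 Sl2 b a]
      by_cases h : m = -n
      · subst h; simp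
      · rw [if_neg h, if_neg (by omega), neg_zero]

theorem cocycle_degree (x y : Loop) : cocycle (degree x) y + cocycle x (degree y) = 0 := by
  induction x using loop_induction with
  | zero => simp
  | add x x' hx hx' =>
    simp only [map_add, LinearMap.add_apply]
    linear_combination hx + hx'
  | tmul m a =>
    induction y using loop_induction with
    | zero => simp
    | add x x' hx hx' =>
      simp only [map_add]
      linear_combination hx + hx'
    | tmul n b =>
      simp only [degree_monomial, map_smul, LinearMap.smul_apply, cocycle_monomial]
      split_ifs with h
      · subst h; push_cast; simp
      · simp

theorem cocycle_lie (x y z : Loop) :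
    cocycle x ⁅y, z⁆ = cocycle ⁅x, y⁆ z + cocycle y ⁅x, z⁆ := by
  induction x using loop_induction with
  | zero => simp
  | add x x' hx hx' =>
    simp only [map_add, LinearMap.add_apply, add_lie]
    linear_combination hx + hx'
  | tmul m a =>
    induction y using loop_induction with
    | zero => simp
    | add x x' hx hx' =>
      simp only [map_add, LinearMap.add_apply, add_lie, lie_add]
      linear_combination hx + hx'
    | tmul n b =>
      induction z using loop_induction with
      | zero => simp
      | add x x' hx hx' =>
        simp only [map_add, lie_add]
        linear_combination hx + hx'
      | tmul k c =>
        simp only [monomial_lie, cocycle_monomial]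
        have h1 : killingForm ℂ Sl2 ⁅a, b⁆ c = killingForm ℂ Sl2 a ⁅b, c⁆ :=
          LieModule.traceForm_apply_lie_apply ℂ Sl2 Sl2 a b c
        have h2 : killingForm ℂ Sl2 b ⁅a, c⁆ = -killingForm ℂ Sl2 a ⁅b, c⁆ := by
          rw [← h1, ← lie_skew a b, map_neg, LinearMap.neg_apply, neg_neg]
          exact (LieModule.traceForm_apply_lie_apply ℂ Sl2 Sl2 b a c).symm
        by_cases h : m + n + k = 0
        · obtain rfl : m = -(n + k) := by omega
          rw [if_pos rfl, if_pos (by ring), if_pos (by ring), h1, h2]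
          push_cast; ring
        · rw [if_neg (by omega), if_neg (by omega), if_neg (by omega), add_zero]

theorem cocycle_self (x : Loop) : cocycle x x = 0 :=
  self_eq_neg.mp (cocycle_skew x x)

end AffineSl2

section

open AffineSl2

/-- The affine Lie algebra `(sl₂ ⊗ ℂ[t, t⁻¹]) ⊕ ℂ c ⊕ ℂ d`: an element is a triple of a loop, the
coefficient of `c`, and the coefficient of `d`. -/
@[ext]
structure AffineSl2 : Type where
  loop : Loop
  cCoeff : ℂ
  dCoeff : ℂ

end

namespace AffineSl2

open LieAlgebra

def toProd : AffineSl2 ≃ Loop × ℂ × ℂ where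
  toFun x := (x.loop, x.cCoeff, x.dCoeff)
  invFun p := ⟨p.1, p.2.1, p.2.2⟩

noncomputable instance : AddCommGroup AffineSl2 := toProd.addCommGroup

noncomputable instance : Module ℂ AffineSl2 := toProd.module ℂ

@[simp] theorem zero_loop : (0 : AffineSl2).loop = 0 := rfl
@[simp] theorem zero_cCoeff : (0 : AffineSl2).cCoeff = 0 := rfl
@[simp] theorem zero_dCoeff : (0 : AffineSl2).dCoeff = 0 := rfl
@[simp] theorem add_loop (x y : AffineSl2) : (x + y).loop = x.loop + y.loop := rfl
@[simp] theorem add_cCoeff (x y : AffineSl2) : (x + y).cCoeff = x.cCoeff + y.cCoeff := rfl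
@[simp] theorem add_dCoeff (x y : AffineSl2) : (x + y).dCoeff = x.dCoeff + y.dCoeff := rfl
@[simp] theorem smul_loop (r : ℂ) (x : AffineSl2) : (r • x).loop = r • x.loop := rfl
@[simp] theorem smul_cCoeff (r : ℂ) (x : AffineSl2) : (r • x).cCoeff = r * x.cCoeff := rfl
@[simp] theorem smul_dCoeff (r : ℂ) (x : AffineSl2) : (r • x).dCoeff = r * x.dCoeff := rfl

/-- `[a ⊗ t^m, b ⊗ t^n] = [a, b] ⊗ t^{m+n} + δ_{m,-n} m (a, b) c`, `[d, a ⊗ t^m] = m a ⊗ t^m`, and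
`c` is central. -/
noncomputable instance : Bracket AffineSl2 AffineSl2 where
  bracket x y :=
    ⟨⁅x.loop, y.loop⁆ + x.dCoeff • degree y.loop - y.dCoeff • degree x.loop,
      cocycle x.loop y.loop, 0⟩

@[simp] theorem lie_loop (x y : AffineSl2) : ⁅x, y⁆.loop =
    ⁅x.loop, y.loop⁆ + x.dCoeff • degree y.loop - y.dCoeff • degree x.loop := rfl
@[simp] theorem lie_cCoeff (x y : AffineSl2) : ⁅x, y⁆.cCoeff = cocycle x.loop y.loop := rfl
@[simp] theorem lie_dCoeff (x y : AffineSl2) : ⁅x, y⁆.dCoeff = 0 := rfl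

noncomputable instance : LieRing AffineSl2 where
  add_lie x y z := by
    ext1
    · simp only [lie_loop, add_loop, add_dCoeff, add_lie, add_smul, map_add, smul_add]; abel
    · simp
    · simp
  lie_add x y z := by
    ext1
    · simp only [lie_loop, add_loop, add_dCoeff, lie_add, add_smul, map_add, smul_add]; abel
    · simp
    · simp
  lie_self x := by
    ext1
    · simp
    · simp [cocycle_self]
    · simp
  leibniz_lie x y z := by
    ext1
    · simp only [lie_loop, add_loop, lie_dCoeff, map_add, map_sub, map_smul, zero_smul, add_zero,
        sub_zero, lie_add, lie_sub, add_lie, sub_lie, lie_smul, smul_lie, degree_lie,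
        smul_add, smul_sub, leibniz_lie x.loop y.loop z.loop, smul_comm y.dCoeff x.dCoeff,
        smul_comm z.dCoeff x.dCoeff, smul_comm z.dCoeff y.dCoeff]
      rw [← lie_skew y.loop (degree x.loop), smul_neg]
      abel
    · have h1 := cocycle_degree x.loop y.loop
      have h2 := cocycle_degree x.loop z.loop
      have h3 := cocycle_degree y.loop z.loop
      simp only [lie_loop, lie_cCoeff, add_cCoeff, map_add, map_sub, map_smul,
        LinearMap.add_apply, LinearMap.sub_apply, LinearMap.smul_apply, smul_eq_mul]
      linear_combination cocycle_lie x.loop y.loop z.loop + y.dCoeff * h2 - z.dCoeff * h1 -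
        x.dCoeff * h3 + z.dCoeff * cocycle_skew y.loop (degree x.loop)
    · simp

noncomputable instance : LieAlgebra ℂ AffineSl2 where
  lie_smul r x y := by
    ext1
    · simp only [lie_loop, smul_loop, smul_dCoeff, lie_smul, map_smul, smul_add, smul_sub,
        mul_smul, smul_comm r x.dCoeff]
    · simp
    · simp


/-! ### Localization at an ad-nilpotent element and generalized conjugations -/

section Conjugation

variable {A : Type*} [Ring A] [Algebra ℂ A]

/-- `ad g : u ↦ g u - u g`. -/
noncomputable def adMap (g : A) : A →ₗ[ℂ] A := LinearMap.mulLeft ℂ g - LinearMap.mulRight ℂ g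

theorem adMap_apply (g u : A) : adMap g u = g * u - u * g := rfl

def IsLocallyAdNilpotent (g : A) : Prop := ∀ u : A, ∃ n : ℕ, (adMap g ^ n) u = 0

theorem adMap_pow_eq_zero {g u : A} {n m : ℕ} (h : (adMap g ^ n) u = 0) (hnm : n ≤ m) :
    (adMap g ^ m) u = 0 := by
  obtain ⟨k, rfl⟩ := Nat.exists_eq_add_of_le' hnm
  rw [pow_add, Module.End.mul_apply, h, map_zero]

theorem adMap_pow_mul_eq_zero (g : A) (s : ℕ) : ∀ (u v : A) (a b : ℕ), a + b ≤ s →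
    (adMap g ^ a) u = 0 → (adMap g ^ b) v = 0 → (adMap g ^ s) (u * v) = 0 := by
  induction s with
  | zero =>
    intro u v a b hab hu hv
    obtain rfl : a = 0 := by omega
    have : u = 0 := by simpa using hu
    simp [this]
  | succ s ih =>
    intro u v a b hab hu hv
    have h : adMap g (u * v) = adMap g u * v + u * adMap g v := by
      simp only [adMap_apply]; noncomm_ring
    rw [pow_succ, Module.End.mul_apply, h, map_add]
    rcases a with _ | a
    · have : u = 0 := by simpa using hu
      simp [this]
    rcases b with _ | b
    · have : v = 0 := by simpa using hv
      simp [this]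
    rw [ih (adMap g u) v a (b + 1) (by omega) (by rwa [pow_succ, Module.End.mul_apply] at hu) hv,
      ih u (adMap g v) (a + 1) b (by omega) hu (by rwa [pow_succ, Module.End.mul_apply] at hv),
      add_zero]

theorem pow_mul_eq_sum (g u : A) (m : ℕ) :
    g ^ m * u = ∑ j ∈ Finset.range (m + 1), (m.choose j : ℂ) • ((adMap g ^ j) u * g ^ (m - j)) := by
  have hc : Commute (adMap g) (LinearMap.mulRight ℂ g) :=
    (LinearMap.commute_mulLeft_right (R := ℂ) g g).sub_left (Commute.refl _)
  have h := hc.add_pow m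
  rw [show adMap g + LinearMap.mulRight ℂ g = LinearMap.mulLeft ℂ g by simp [adMap]] at h
  have h2 := congrArg (fun T : A →ₗ[ℂ] A => T u) h
  simp only [LinearMap.pow_mulLeft, LinearMap.mulLeft_apply] at h2
  rw [h2, LinearMap.sum_apply]
  refine Finset.sum_congr rfl fun j _ => ?_
  rw [(hc.pow_pow j (m - j)).eq, ← Nat.cast_comm, LinearMap.pow_mulRight, ← nsmul_eq_mul,
    LinearMap.smul_apply, Nat.cast_smul_eq_nsmul, Module.End.mul_apply, LinearMap.mulRight_apply]

/-- If `ad g` is locally nilpotent then `{gⁿ}` satisfies Ore's localizability conditions. -/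
theorem nonempty_oreSet_powers {g : A} (hg : IsLocallyAdNilpotent g) :
    Nonempty (OreLocalization.OreSet (Submonoid.powers g)) := by
  rw [OreLocalization.nonempty_oreSet_iff]
  constructor
  · rintro r₁ r₂ ⟨_, n, rfl⟩ h
    obtain ⟨N, hN⟩ := hg (r₁ - r₂)
    have h0 : ∀ j, (adMap g ^ j) (r₁ - r₂) * g ^ n = 0 := by
      intro j
      induction j with
      | zero => simpa [sub_mul, sub_eq_zero] using h
      | succ j ih =>
        rw [pow_succ', Module.End.mul_apply, adMap_apply, sub_mul, mul_assoc, ih, mul_assoc,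
          (Commute.self_pow g n).eq, ← mul_assoc, ih]
        simp
    refine ⟨⟨g ^ (n + N), n + N, rfl⟩, sub_eq_zero.mp ?_⟩
    change g ^ (n + N) * r₁ - g ^ (n + N) * r₂ = 0
    rw [← mul_sub, pow_mul_eq_sum]
    refine Finset.sum_eq_zero fun j _ => ?_
    rcases le_total N j with hj | hj
    · rw [adMap_pow_eq_zero hN hj, zero_mul, smul_zero]
    · rw [Nat.add_sub_assoc hj, pow_add, ← mul_assoc, h0, zero_mul, smul_zero]
  · rintro r ⟨_, n, rfl⟩
    obtain ⟨N, hN⟩ := hg r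
    refine ⟨∑ j ∈ Finset.range (n + N + 1),
      ((n + N).choose j : ℂ) • ((adMap g ^ j) r * g ^ (N - j)), ⟨g ^ (n + N), n + N, rfl⟩, ?_⟩
    change g ^ (n + N) * r = _ * g ^ n
    rw [pow_mul_eq_sum, Finset.sum_mul]
    refine Finset.sum_congr rfl fun j _ => ?_
    rcases le_total N j with hj | hj
    · rw [adMap_pow_eq_zero hN hj]; simp
    · rw [smul_mul_assoc, mul_assoc, ← pow_add, show n + N - j = N - j + n by omega]

/-- `Θ_z(u) = ∑_{j ≥ 0} (z choose j) (ad g)^j(u) g^{-j}` for a unit `g`. -/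
noncomputable def thetaFun (g : Aˣ) (z : ℂ) (u : A) : A :=
  ∑ᶠ j : ℕ, Ring.choose z j • ((adMap (g : A) ^ j) u * (↑g⁻¹ : A) ^ j)

theorem thetaFun_eq_sum {g : Aˣ} {u : A} {N M : ℕ} (hN : (adMap (g : A) ^ N) u = 0) (hM : N ≤ M)
    (z : ℂ) : thetaFun g z u =
      ∑ j ∈ Finset.range M, Ring.choose z j • ((adMap (g : A) ^ j) u * (↑g⁻¹ : A) ^ j) := by
  refine finsum_eq_sum_of_support_subset _ fun j hj => ?_
  simp only [Finset.coe_range, Set.mem_Iio]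
  by_contra hlt
  exact hj (by simp only [adMap_pow_eq_zero hN (hM.trans (not_lt.mp hlt)), zero_mul, smul_zero])

theorem thetaFun_natCast (g : Aˣ) (hg : IsLocallyAdNilpotent (g : A)) (n : ℕ) (u : A) :
    thetaFun g n u = (g : A) ^ n * u * (↑g⁻¹ : A) ^ n := by
  obtain ⟨N, hN⟩ := hg u
  rw [thetaFun_eq_sum hN (le_max_left N (n + 1)), pow_mul_eq_sum, Finset.sum_mul]
  symm
  refine Finset.sum_subset_zero_on_sdiff (by simp) ?_ ?_
  · intro j hj
    have : n.choose j = 0 := Nat.choose_eq_zero_of_lt (by simp at hj; omega)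
    rw [Ring.choose_natCast, this]; simp
  · intro j hj
    have hj : j ≤ n := by simpa [Nat.lt_succ_iff] using hj
    rw [Ring.choose_natCast, smul_mul_assoc, mul_assoc]
    congr 2
    conv_lhs => rw [← Nat.sub_add_cancel hj, Nat.add_sub_cancel, pow_add]
    simp only [← Units.val_pow_eq_pow_val, ← Units.val_mul]
    rw [← mul_assoc, inv_pow, mul_inv_cancel, one_mul]

theorem exists_polynomial_choose (j : ℕ) :
    ∃ p : Polynomial ℂ, ∀ z : ℂ, p.eval z = Ring.choose z j := by
  refine ⟨Polynomial.C ((j.factorial : ℂ)⁻¹) *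
    (descPochhammer ℤ j).map (algebraMap ℤ ℂ), fun z => ?_⟩
  rw [Ring.choose_eq_smul, ← Polynomial.aeval_eq_smeval, Polynomial.eval_mul, Polynomial.eval_C,
    Polynomial.eval_map, Polynomial.aeval_def, smul_eq_mul]

theorem thetaFun_mul (g : Aˣ) (hg : IsLocallyAdNilpotent (g : A)) (z : ℂ) (u v : A) :
    thetaFun g z (u * v) = thetaFun g z u * thetaFun g z v := by
  obtain ⟨a, ha⟩ := hg u
  obtain ⟨b, hb⟩ := hg v
  have hab := adMap_pow_mul_eq_zero (g : A) (a + b) u v a b le_rfl ha hb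
  choose p hp using exists_polynomial_choose
  rw [← sub_eq_zero, ← Module.forall_dual_apply_eq_zero_iff ℂ]
  intro φ
  let P : Polynomial ℂ :=
    (∑ j ∈ Finset.range (a + b), p j *
        Polynomial.C (φ ((adMap (g : A) ^ j) (u * v) * (↑g⁻¹ : A) ^ j))) -
      ∑ j ∈ Finset.range a, ∑ k ∈ Finset.range b, p j * p k *
        Polynomial.C (φ (((adMap (g : A) ^ j) u * (↑g⁻¹ : A) ^ j) *
          ((adMap (g : A) ^ k) v * (↑g⁻¹ : A) ^ k)))
  have hP : ∀ w : ℂ, φ (thetaFun g w (u * v) - thetaFun g w u * thetaFun g w v) = P.eval w := by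
    intro w
    rw [thetaFun_eq_sum hab le_rfl, thetaFun_eq_sum ha le_rfl, thetaFun_eq_sum hb le_rfl,
      Finset.sum_mul_sum]
    simp only [map_sub, map_sum, P, Polynomial.eval_sub, Polynomial.eval_finsetSum,
      Polynomial.eval_mul, Polynomial.eval_C, hp, smul_mul_smul_comm, map_smul, smul_eq_mul]
  have hP0 : P = 0 := by
    refine Polynomial.eq_zero_of_infinite_isRoot P (Set.Infinite.mono ?_
      (Set.infinite_range_of_injective (Nat.cast_injective (R := ℂ))))
    rintro _ ⟨n, rfl⟩
    change P.eval (n : ℂ) = 0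
    rw [← hP, thetaFun_natCast g hg, thetaFun_natCast g hg, thetaFun_natCast g hg]
    have h1 : (↑g⁻¹ : A) ^ n * (g : A) ^ n = 1 := by
      rw [← Units.val_pow_eq_pow_val, ← Units.val_pow_eq_pow_val, ← Units.val_mul, inv_pow,
        inv_mul_cancel, Units.val_one]
    have h2 : (g : A) ^ n * u * (↑g⁻¹ : A) ^ n * ((g : A) ^ n * v * (↑g⁻¹ : A) ^ n) =
        (g : A) ^ n * u * ((↑g⁻¹ : A) ^ n * (g : A) ^ n) * v * (↑g⁻¹ : A) ^ n := by
      noncomm_ring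
    rw [h2, h1, mul_one, mul_assoc ((g : A) ^ n) u v, sub_self, map_zero]
  rw [hP, hP0, Polynomial.eval_zero]

/-- The generalized conjugation `Θ_z : A → A` as a ring homomorphism. -/
noncomputable def theta (g : Aˣ) (hg : IsLocallyAdNilpotent (g : A)) (z : ℂ) : A →+* A where
  toFun := thetaFun g z
  map_one' := by
    have h : (adMap (g : A) ^ 1) (1 : A) = 0 := by simp [adMap_apply]
    rw [thetaFun_eq_sum h le_rfl]
    simp
  map_mul' := thetaFun_mul g hg z
  map_zero' := by simp [thetaFun]
  map_add' u v := by
    obtain ⟨a, ha⟩ := hg u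
    obtain ⟨b, hb⟩ := hg v
    have hab : (adMap (g : A) ^ (a + b)) (u + v) = 0 := by
      rw [map_add, adMap_pow_eq_zero ha (by omega), adMap_pow_eq_zero hb (by omega), add_zero]
    rw [thetaFun_eq_sum hab le_rfl, thetaFun_eq_sum ha (Nat.le_add_right a b),
      thetaFun_eq_sum hb (Nat.le_add_left b a), ← Finset.sum_add_distrib]
    simp only [map_add, add_mul, smul_add]

end Conjugation

/-! ### Generators, Cartan subalgebra and weights -/

/-- The element `e` of the standard basis `e`, `f`, `h` of `sl₂`. -/
noncomputable def e : Sl2 := SpecialLinear.single 0 1 (by decide) (1 : ℂ)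

/-- The element `f` of the standard basis of `sl₂`. -/
noncomputable def f : Sl2 := SpecialLinear.single 1 0 (by decide) (1 : ℂ)

/-- The element `h` of the standard basis of `sl₂`. -/
noncomputable def h : Sl2 := SpecialLinear.singleSubSingle 0 1 (1 : ℂ)

/-- `eₙ = e ⊗ tⁿ`. -/
noncomputable def eₙ (n : ℤ) : AffineSl2 := ⟨monomial n e, 0, 0⟩

/-- `fₙ = f ⊗ tⁿ`. -/
noncomputable def fₙ (n : ℤ) : AffineSl2 := ⟨monomial n f, 0, 0⟩

/-- `hₙ = h ⊗ tⁿ`. -/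
noncomputable def hₙ (n : ℤ) : AffineSl2 := ⟨monomial n h, 0, 0⟩

/-- The central element. -/
noncomputable def c : AffineSl2 := ⟨0, 1, 0⟩

/-- The degree derivation. -/
noncomputable def d : AffineSl2 := ⟨0, 0, 1⟩

/-- The Cartan subalgebra `𝔥 = ℂ h₀ ⊕ ℂ c ⊕ ℂ d`. -/
noncomputable def cartan : Submodule ℂ AffineSl2 := Submodule.span ℂ {hₙ 0, c, d}

/-- `h₀` as an element of `𝔥`. -/
noncomputable def cartanH : cartan := ⟨hₙ 0, Submodule.subset_span (by simp)⟩

/-- `c` as an element of `𝔥`. -/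
noncomputable def cartanC : cartan := ⟨c, Submodule.subset_span (by simp)⟩

/-- `d` as an element of `𝔥`. -/
noncomputable def cartanD : cartan := ⟨d, Submodule.subset_span (by simp)⟩

/-- The root `β ∈ 𝔥*` of `e`: the difference of the two diagonal entries of the degree zero part,
so that `β(h₀) = 2`, `β(c) = β(d) = 0`. -/
noncomputable def β : Module.Dual ℂ cartan where
  toFun H := (Loop.coeff H.1.loop 0).1 0 0 - (Loop.coeff H.1.loop 0).1 1 1
  map_add' x y := by simp; ring
  map_smul' r x := by simp; ring

/-- `δ ∈ 𝔥*` with `δ(h₀) = δ(c) = 0`, `δ(d) = 1`. -/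
noncomputable def δ : Module.Dual ℂ cartan where
  toFun H := H.1.dCoeff
  map_add' x y := by simp
  map_smul' r x := by simp

theorem β_cartanH : β cartanH = 2 := by
  norm_num [β, cartanH, hₙ, coeff_monomial, h]

theorem β_cartanC : β cartanC = 0 := by
  simp [β, cartanC, c]

theorem β_cartanD : β cartanD = 0 := by
  simp [β, cartanD, d]

/-- The root lattice `Q = ℤ β + ℤ δ`. -/
noncomputable def rootLattice : AddSubgroup (Module.Dual ℂ cartan) := AddSubgroup.closure {β, δ}

/-- The universal enveloping algebra. -/
abbrev U : Type := UniversalEnvelopingAlgebra ℂ AffineSl2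

/-- The canonical map from the affine Lie algebra to `U`. -/
noncomputable def ι : AffineSl2 →ₗ[ℂ] U :=
  letI : LieRing U := LieRing.ofAssociativeRing
  (UniversalEnvelopingAlgebra.ι ℂ : AffineSl2 →ₗ⁅ℂ⁆ U).toLinearMap

section

attribute [local instance 100] LieRing.ofAssociativeRing

theorem ι_lie (x y : AffineSl2) : ι ⁅x, y⁆ = ι x * ι y - ι y * ι x :=
  LieHom.map_lie (UniversalEnvelopingAlgebra.ι ℂ : AffineSl2 →ₗ⁅ℂ⁆ U) x y

/-- A subalgebra of `U` that contains the image of the Lie algebra is everything. -/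
theorem mem_of_ι_mem (T : Subalgebra ℂ U) (hT : ∀ x : AffineSl2, ι x ∈ T) (u : U) : u ∈ T := by
  let g : AffineSl2 →ₗ⁅ℂ⁆ T :=
    { toFun := fun x => ⟨ι x, hT x⟩
      map_add' := fun x y => Subtype.ext (map_add ι x y)
      map_smul' := fun r x => Subtype.ext (map_smul ι r x)
      map_lie' := fun {x y} => Subtype.ext (ι_lie x y) }
  have hid : T.val.comp (UniversalEnvelopingAlgebra.lift ℂ g) = AlgHom.id ℂ U := by
    apply UniversalEnvelopingAlgebra.hom_ext
    ext x
    simp [g, ι]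
  have hu := congrArg (fun F : U →ₐ[ℂ] U => F u) hid
  have hmem : T.val (UniversalEnvelopingAlgebra.lift ℂ g u) ∈ T := Subtype.property _
  rwa [show T.val (UniversalEnvelopingAlgebra.lift ℂ g u) = u from hu] at hmem

end

section Weight

variable (V : Type*) [AddCommGroup V] [Module U V]

variable {V} in
/-- `v` satisfies `H v = μ(H) v` for all `H ∈ 𝔥`. -/
def HasWeight (μ : Module.Dual ℂ cartan) (v : V) : Prop :=
  ∀ H : cartan, ι (H : AffineSl2) • v = algebraMap ℂ U (μ H) • v

/-- The weight space `V_μ`, as a complex subspace of `V`. -/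
def weightSpace (μ : Module.Dual ℂ cartan) : Submodule ℂ (RestrictScalars ℂ U V) where
  carrier := {v | HasWeight μ (RestrictScalars.addEquiv ℂ U V v)}
  add_mem' hv hw H := by rw [map_add, smul_add, smul_add, hv H, hw H]
  zero_mem' H := by rw [map_zero, smul_zero, smul_zero]
  smul_mem' r v hv H := by
    rw [RestrictScalars.addEquiv_map_smul, ← mul_smul, ← Algebra.commutes, mul_smul, hv H,
      ← mul_smul, ← mul_smul, Algebra.commutes]

/-- `V` is the direct sum of its weight spaces. -/
def IsWeightModule : Prop :=
  letI := Classical.decEq (Module.Dual ℂ cartan)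
  DirectSum.IsInternal (weightSpace V)

/-- The set of weights of `V`. -/
def support : Set (Module.Dual ℂ cartan) := {μ | weightSpace V μ ≠ ⊥}

/-- A weight module whose support is a full coset of the root lattice. -/
def IsDense : Prop :=
  IsWeightModule V ∧ ∃ μ : Module.Dual ℂ cartan, support V = {ν | ν - μ ∈ rootLattice}

/-- Every nonzero weight space of `V` is infinite dimensional. -/
def HasInfiniteMultiplicities : Prop :=
  ∀ μ ∈ support V, ¬ Module.Finite ℂ (weightSpace V μ)

/-- `x` acts injectively on `V`. -/
def ActsInjectively (x : AffineSl2) : Prop := Function.Injective fun v : V => ι x • v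

/-- `x` acts locally nilpotently on `V`. -/
def ActsLocallyNilpotently (x : AffineSl2) : Prop := ∀ v : V, ∃ n : ℕ, ι x ^ n • v = 0

/-- All real root elements act injectively. -/
def IsTorsionFree : Prop := ∀ n : ℤ, ActsInjectively V (eₙ n) ∧ ActsInjectively V (fₙ n)

/-- The class `𝒲(A)` of weight modules on which the element of a real root `γ` acts locally
nilpotently if `γ ∈ A` and injectively if `γ ∉ A`. The real roots are `β + nδ` and `-β + nδ`, with
root elements `eₙ` and `fₙ`. -/
def MemW (A : Set (Module.Dual ℂ cartan)) : Prop :=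
  IsWeightModule V ∧ ∀ n : ℤ,
    (β + n • δ ∈ A → ActsLocallyNilpotently V (eₙ n)) ∧
    (β + n • δ ∉ A → ActsInjectively V (eₙ n)) ∧
    (-β + n • δ ∈ A → ActsLocallyNilpotently V (fₙ n)) ∧
    (-β + n • δ ∉ A → ActsInjectively V (fₙ n))

end Weight

/-! ### Imaginary Verma modules -/

/-- `𝔤₊`, the sum of the root spaces of `β + nδ`, `n ∈ ℤ`, and of `mδ`, `m > 0`. -/
noncomputable def gPlus : Submodule ℂ AffineSl2 :=
  Submodule.span ℂ (Set.range eₙ ∪ {x | ∃ m : ℤ, 0 < m ∧ x = hₙ m})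

/-- The left ideal of `U` generated by `𝔤₊` and the `H - λ(H)`, `H ∈ 𝔥`. -/
noncomputable def vermaIdeal (lam : Module.Dual ℂ cartan) : Submodule U U :=
  Submodule.span U ({u | ∃ a ∈ gPlus, u = ι a} ∪
    {u | ∃ H : cartan, u = ι (H : AffineSl2) - algebraMap ℂ U (lam H)})

/-- The imaginary Verma module `M(λ) = U ⊗_{U(𝔤₊ ⊕ 𝔥)} ℂ_λ`. The tensor product with the
one-dimensional module `ℂ_λ` is the quotient of `U` by the left ideal generated by the annihilator
of `ℂ_λ` in `U(𝔤₊ ⊕ 𝔥)`; `1 ⊗ 1` is the class of `1`. -/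
abbrev ImaginaryVerma (lam : Module.Dual ℂ cartan) : Type := U ⧸ vermaIdeal lam

/-- The submodule `𝔐` of `M(λ)` generated by the weight spaces `M(λ)_{λ - kδ}`, `k > 0`. -/
noncomputable def vermaSubmodule (lam : Module.Dual ℂ cartan) :
    Submodule U (ImaginaryVerma lam) :=
  Submodule.span U {v | ∃ k : ℕ, 0 < k ∧ HasWeight (lam - k • δ) v}

/-- The quotient `M'(λ) = M(λ) / 𝔐`. -/
abbrev VermaQuotient (lam : Module.Dual ℂ cartan) : Type := ImaginaryVerma lam ⧸ vermaSubmodule lam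

/-! ### Localization and twisted localization with respect to `fᵢ` -/

theorem f_sq : (f.1 * f.1 : Matrix (Fin 2) (Fin 2) ℂ) = 0 := by
  simp [f]

theorem lie_f_lie_f_lie_f (a : Sl2) : ⁅f, ⁅f, ⁅f, a⁆⁆⁆ = 0 := by
  apply Subtype.ext
  simp only [SpecialLinear.sl_bracket]
  have h1 : ∀ x : Matrix (Fin 2) (Fin 2) ℂ, f.1 * (f.1 * x) = 0 := fun x => by
    rw [← mul_assoc, f_sq, zero_mul]
  simp only [mul_sub, sub_mul, mul_assoc, h1, f_sq, mul_zero]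
  simp

theorem lie_f_pow_four (i : ℤ) (x : AffineSl2) : ⁅fₙ i, ⁅fₙ i, ⁅fₙ i, ⁅fₙ i, x⁆⁆⁆⁆ = 0 := by
  have key : ∀ l : Loop, ⁅monomial i f, ⁅monomial i f, ⁅monomial i f, l⁆⁆⁆ = 0 := by
    intro l
    induction l using loop_induction with
    | zero => simp
    | add x y hx hy => simp only [lie_add, hx, hy, add_zero]
    | tmul m a =>
      rw [monomial_lie, monomial_lie, monomial_lie, lie_f_lie_f_lie_f, ← coeff_symm_single]
      simp
  have h3 : ⁅fₙ i, ⁅fₙ i, ⁅fₙ i, x⁆⁆⁆.loop = 0 := by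
    have := key x.loop
    simp [fₙ, degree_monomial, this]
  ext1
  · rw [lie_loop, h3]; simp [fₙ]
  · rw [lie_cCoeff, h3]; simp
  · simp

theorem isLocallyAdNilpotent_f (i : ℤ) : IsLocallyAdNilpotent (ι (fₙ i)) := by
  let T : Subalgebra ℂ U :=
    { carrier := {u | ∃ n : ℕ, (adMap (ι (fₙ i)) ^ n) u = 0}
      mul_mem' := by
        rintro u v ⟨a, ha⟩ ⟨b, hb⟩
        exact ⟨a + b, adMap_pow_mul_eq_zero _ _ u v a b le_rfl ha hb⟩
      add_mem' := by
        rintro u v ⟨a, ha⟩ ⟨b, hb⟩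
        exact ⟨a + b, by rw [map_add, adMap_pow_eq_zero ha (by omega),
          adMap_pow_eq_zero hb (by omega), add_zero]⟩
      algebraMap_mem' := fun r => ⟨1, by
        rw [pow_one, adMap_apply, Algebra.commutes, sub_self]⟩ }
  have had : ∀ x : AffineSl2, adMap (ι (fₙ i)) (ι x) = ι ⁅fₙ i, x⁆ := by
    intro x
    rw [ι_lie, adMap_apply]
  have hι : ∀ x : AffineSl2, ι x ∈ T := by
    intro x
    refine ⟨4, ?_⟩
    simp only [pow_succ, pow_zero, one_mul, Module.End.mul_apply, had]
    rw [lie_f_pow_four, map_zero]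
  exact fun u => mem_of_ι_mem T hι u

/-- The multiplicative set `{fᵢⁿ | n ≥ 0}` of `U`. -/
noncomputable abbrev fPowers (i : ℤ) : Submonoid U := Submonoid.powers (ι (fₙ i))

noncomputable instance (i : ℤ) : OreLocalization.OreSet (fPowers i) :=
  Classical.choice (nonempty_oreSet_powers (isLocallyAdNilpotent_f i))

/-- The localization `𝒟ᵢ U` of `U` at the powers of `fᵢ`. -/
abbrev LocU (i : ℤ) : Type := OreLocalization (fPowers i) U

/-- The localization `𝒟ᵢ V = 𝒟ᵢ U ⊗_U V` of a `U`-module, realized as the module of fractions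
`fᵢ⁻ⁿ v`. It is a `𝒟ᵢ U`-module, and a `U`-module through `U → 𝒟ᵢ U`. -/
abbrev Loc (i : ℤ) (V : Type*) [AddCommGroup V] [Module U V] : Type _ :=
  OreLocalization (fPowers i) V

/-- The canonical map `V → 𝒟ᵢ V`. -/
noncomputable def toLoc (i : ℤ) (V : Type*) [AddCommGroup V] [Module U V] : V →ₗ[U] Loc i V where
  toFun v := OreLocalization.oreDiv v 1
  map_add' _ _ := OreLocalization.add_oreDiv.symm
  map_smul' u v := (OreLocalization.smul_oreDiv_one u v).symm

/-- `fᵢ` as a unit of `𝒟ᵢ U`. -/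
noncomputable def fUnit (i : ℤ) : (LocU i)ˣ :=
  OreLocalization.numeratorUnit ⟨ι (fₙ i), Submonoid.mem_powers _⟩

theorem fUnit_val (i : ℤ) : (fUnit i : LocU i) = OreLocalization.numeratorRingHom (ι (fₙ i)) := rfl

theorem isLocallyAdNilpotent_fUnit (i : ℤ) : IsLocallyAdNilpotent (fUnit i : LocU i) := by
  intro u
  induction u using OreLocalization.ind with | _ r s
  obtain ⟨n, hn⟩ := isLocallyAdNilpotent_f i r
  refine ⟨n, ?_⟩
  obtain ⟨_, k, rfl⟩ := s
  have h1 : ∀ x : U, OreLocalization.oreDiv x (⟨ι (fₙ i) ^ k, k, rfl⟩ : fPowers i) =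
      (↑(fUnit i ^ k)⁻¹ : LocU i) * OreLocalization.numeratorRingHom x := by
    intro x
    rw [Units.eq_inv_mul_iff_mul_eq, Units.val_pow_eq_pow_val, fUnit_val, ← map_pow]
    exact OreLocalization.mul_cancel (s := (⟨ι (fₙ i) ^ k, k, rfl⟩ : fPowers i)) (t := 1)
  have hc : Commute (fUnit i : LocU i) (↑(fUnit i ^ k)⁻¹ : LocU i) :=
    ((Commute.refl (fUnit i)).pow_right k).inv_right.units_val
  have h2 : ∀ (m : ℕ) (x : U), (adMap (fUnit i : LocU i) ^ m)
      ((↑(fUnit i ^ k)⁻¹ : LocU i) * OreLocalization.numeratorRingHom x) =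
      (↑(fUnit i ^ k)⁻¹ : LocU i) *
        OreLocalization.numeratorRingHom ((adMap (ι (fₙ i)) ^ m) x) := by
    intro m
    induction m with
    | zero => intro x; rfl
    | succ m ih =>
      intro x
      rw [pow_succ, Module.End.mul_apply, pow_succ, Module.End.mul_apply, ← ih]
      congr 1
      rw [adMap_apply, adMap_apply, map_sub, map_mul, map_mul, ← mul_assoc, hc.eq, fUnit_val,
        mul_sub, mul_assoc, mul_assoc]
  rw [h1, h2, hn, map_zero, mul_zero]

/-- The generalized conjugation `Θ_z(u) = ∑_{j ≥ 0} (z choose j) (ad fᵢ)^j(u) fᵢ^{-j}` of `𝒟ᵢ U`;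
for integers `z` it is `u ↦ fᵢ^z u fᵢ^{-z}`. -/
noncomputable def Θ (i : ℤ) (z : ℂ) : LocU i →+* LocU i :=
  theta (fUnit i) (isLocallyAdNilpotent_fUnit i) z

/-- The `𝒟ᵢ U`-module `N` twisted by a generalized conjugation. Its elements are the symbols
`v^z = fᵢ^z v`, `v ∈ N`, with `u (fᵢ^z v) = fᵢ^z (Θ_{-z}(u) v)`; so the weight of `v^z` is the
weight of `v` plus `z(-β + iδ)`. -/
def Twist (_i : ℤ) (_z : ℂ) (N : Type*) : Type _ := N

section Twist

variable (i : ℤ) (z : ℂ) (N : Type*) [AddCommGroup N] [Module (LocU i) N]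

instance : AddCommGroup (Twist i z N) := inferInstanceAs (AddCommGroup N)

noncomputable instance : Module (LocU i) (Twist i z N) := Module.compHom N (Θ i (-z))

noncomputable instance : Module U (Twist i z N) :=
  Module.compHom (Twist i z N) (OreLocalization.numeratorRingHom : U →+* LocU i)

end Twist

/-- The twisted localization `𝒟ᵢ^z V`. -/
abbrev TwistedLoc (i : ℤ) (z : ℂ) (V : Type*) [AddCommGroup V] [Module U V] : Type _ :=
  Twist i z (Loc i V)

/-- `𝒟ᵢ V / V`. -/
abbrev LocQuotient (i : ℤ) (V : Type*) [AddCommGroup V] [Module U V] : Type _ :=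
  Loc i V ⧸ LinearMap.range (toLoc i V)

/-- The complex number `z` is an integer. -/
def IsInteger (z : ℂ) : Prop := ∃ n : ℤ, z = n

end AffineSl2

/-! All the modules are realized in one space, the span of monomials ∏ xₙ ^ aₙ with complex
exponents. There fₙ is multiplication by xₙ, hₘ is J δ_{m,0} - 2 ∑ xₙ₊ₘ ∂ₙ, eₘ is J ∂₋ₘ - ∑ xₙ₊ₖ₊ₘ
∂ₙ ∂ₖ, d is λ(d) + ∑ n xₙ ∂ₙ, and c is zero. In `M'(λ)` every nonzero hₘ kills the generator, so the
generator yields everything under polynomials in the fₙ; the map to the Fock space sends these to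
the corresponding polynomials and is therefore injective. Hence `M'(λ)` is the polynomial ring,
𝒟ᵢM'(λ) is the same ring with xᵢ inverted, and, since Θ₋ᵤ becomes conjugation by xᵢ ^ u
(`locRep_theta`), 𝒟ᵢ^z M'(λ) is the span of the monomials with exponents in `twistExpo i z`. This
set depends only on z modulo ℤ, which gives the isomorphisms. Conversely the weights recover z
modulo ℤ, and i is the only index for which fᵢ acts surjectively.

Irreducibility rests on the operator fᵢ e₋ᵢ. It preserves the total degree D and is triangular for
the filtration by the degree j in the variables other than xᵢ, with diagonal entries (D - j)(J + 1 -
D - j) (`feOp_mono`, `monoSpan_boundedExpo_le`). Where these do not vanish, every p in a stable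
subspace W is fᵢ e₋ᵢ q with q in W, so xᵢ⁻¹ p = e₋ᵢ q lies in W (`inv_mul_mem`). If neither z nor z
- J is an integer this makes W closed under division by xᵢ. Then xᵢ ^ (-z) W is again stable,
contains a nonzero polynomial, and for J ≠ 0 the eₘ lower its degree until a nonzero constant
remains (`one_mem_of_isStable`). For 𝒟ᵢM'/M' with J not an integer, division is possible only in
negative degree; one first lowers the degree without becoming polynomial, and then works with the
vectors whose products with all sufficiently negative powers of xᵢ lie in W
(`monoSpan_twistExpo_le_of_lt`).

Reducibility in the remaining cases comes from e₋ᵢ: the vectors on which it is nilpotent form a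
submodule, and one exhibits a nonzero vector in its kernel (xᵢ ^ (J + 1), or the output of
`exists_eop_neg_eq_zero`) together with a power of xᵢ on which it is not nilpotent.

Injectivity of the eₘ is a leading term argument in xᵢ (`not_mem_of_leading`). Density and infinite
multiplicities follow from an explicit infinite family of monomials of any prescribed weight in the
coset (`exists_expo_family`). -/

namespace AffineSl2

/-! ### Differential operators on generalized Laurent polynomials -/

/-- Exponents of monomials in the variables `xₙ`, `n ∈ ℤ`, with complex powers. -/
abbrev Expo : Type := ℤ →₀ ℂ

/-- The algebra of the monomials `∏ xₙ ^ aₙ` with complex exponents. -/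
abbrev Laurent : Type := AddMonoidAlgebra ℂ Expo

/-- The monomial with exponent `a`. -/
noncomputable def mono (a : Expo) : Laurent := AddMonoidAlgebra.single a 1

/-- The power `xₙ ^ r`. -/
noncomputable def xpow (n : ℤ) (r : ℂ) : Laurent := mono (Finsupp.single n r)

theorem mono_zero : mono 0 = 1 := rfl

theorem mono_add (a b : Expo) : mono (a + b) = mono a * mono b := by
  simp [mono, AddMonoidAlgebra.single_mul_single]

theorem xpow_zero (n : ℤ) : xpow n 0 = 1 := by
  rw [xpow, Finsupp.single_zero, mono_zero]

theorem xpow_add (n : ℤ) (r s : ℂ) : xpow n (r + s) = xpow n r * xpow n s := by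
  rw [xpow, Finsupp.single_add, mono_add]; rfl

theorem xpow_mul_neg (n : ℤ) (r : ℂ) : xpow n r * xpow n (-r) = 1 := by
  rw [← xpow_add, add_neg_cancel, xpow_zero]

theorem xpow_natCast (n : ℤ) (k : ℕ) : xpow n k = xpow n 1 ^ k := by
  induction k with
  | zero => simp [xpow_zero]
  | succ k ih => rw [Nat.cast_succ, xpow_add, ih, pow_succ]

/-- The linear map with prescribed values on monomials. -/
noncomputable def ofMono {V : Type*} [AddCommGroup V] [Module ℂ V] (g : Expo → V) :
    Laurent →ₗ[ℂ] V where
  toFun p := Finsupp.linearCombination ℂ g p.coeff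
  map_add' p q := by simp
  map_smul' r p := by simp

theorem ofMono_mono {V : Type*} [AddCommGroup V] [Module ℂ V] (g : Expo → V) (a : Expo) :
    ofMono g (mono a) = g a := by
  simp [ofMono, mono]

theorem sum_smul_mono (p : Laurent) : (p.coeff.sum fun a r => r • mono a) = p := by
  conv_rhs => rw [← AddMonoidAlgebra.sum_coeff_single p]
  refine Finsupp.sum_congr fun a _ => ?_
  rw [mono, AddMonoidAlgebra.smul_single, smul_eq_mul, mul_one]

theorem laurent_induction {P : Laurent → Prop} (p : Laurent) (zero : P 0)
    (add : ∀ p q, P p → P q → P (p + q)) (smul_mono : ∀ (r : ℂ) (a : Expo), P (r • mono a)) : P p := by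
  rw [← sum_smul_mono p]
  exact Finset.sum_induction _ _ add zero fun a _ => smul_mono _ a

theorem linearMap_ext_mono {V : Type*} [AddCommGroup V] [Module ℂ V] {S T : Laurent →ₗ[ℂ] V}
    (h : ∀ a, S (mono a) = T (mono a)) : S = T := by
  refine LinearMap.ext fun p => ?_
  induction p using laurent_induction with
  | zero => simp
  | add p q hp hq => rw [map_add, map_add, hp, hq]
  | smul_mono r a => rw [map_smul, map_smul, h]

/-- Operators that commute with the multiplication by all `xₖ ^ r` are determined by their value
at `1`. -/
theorem eq_zero_of_commute_xpow {T : Laurent →ₗ[ℂ] Laurent} (h1 : T 1 = 0)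
    (hT : ∀ k r w, T (xpow k r * w) = xpow k r * T w) : T = 0 := by
  refine linearMap_ext_mono fun a => ?_
  rw [LinearMap.zero_apply]
  induction a using Finsupp.induction with
  | zero => rwa [mono_zero]
  | single_add k r b _ _ ih => rw [mono_add]; erw [hT]; rw [ih, mul_zero]

/-- The logarithmic derivative of a monomial along `∑ₙ xₙ₊ₘ ∂ₙ`. -/
noncomputable def logDer (m : ℤ) : Expo →ₗ[ℂ] Laurent :=
  Finsupp.linearCombination ℂ fun n => xpow n (-1) * xpow (n + m) 1

/-- The derivation `∑ₙ xₙ₊ₘ ∂ₙ`. -/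
noncomputable def shiftDer (m : ℤ) : Laurent →ₗ[ℂ] Laurent :=
  ofMono fun a => mono a * logDer m a

theorem shiftDer_mono (m : ℤ) (a : Expo) : shiftDer m (mono a) = mono a * logDer m a :=
  ofMono_mono _ _

theorem shiftDer_mono_mul (m : ℤ) (a : Expo) (w : Laurent) :
    shiftDer m (mono a * w) = mono a * (shiftDer m w + logDer m a * w) := by
  induction w using laurent_induction with
  | zero => simp
  | add p q hp hq => simp only [mul_add, map_add, hp, hq]; ring
  | smul_mono r b =>
    rw [mul_smul_comm, ← mono_add, map_smul, map_smul, shiftDer_mono, shiftDer_mono, map_add,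
      mono_add]
    simp only [Algebra.smul_def]
    ring

theorem logDer_single (m k : ℤ) (r : ℂ) :
    logDer m (Finsupp.single k r) = r • (xpow k (-1) * xpow (k + m) 1) := by
  simp [logDer]

/-- The Leibniz rule, written as the cost of moving a power of xₖ to the left. The analogous
formulas for the other operators have three uses: with r = 1 they give commutators with fₖ, with r =
z the twist, and for all r together they allow relations to be checked by induction on monomials. -/
theorem shiftDer_xpow_mul (m k : ℤ) (r : ℂ) (w : Laurent) :
    shiftDer m (xpow k r * w) =
      xpow k r * (shiftDer m w + r • (xpow k (-1) * xpow (k + m) 1 * w)) := by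
  rw [xpow, shiftDer_mono_mul, logDer_single, smul_mul_assoc]

theorem shiftDer_one (m : ℤ) : shiftDer m 1 = 0 := by
  rw [← mono_zero, shiftDer_mono, map_zero, mul_zero]

/-- The operator of `hₘ`. -/
noncomputable def hop (J : ℂ) (m : ℤ) : Laurent →ₗ[ℂ] Laurent :=
  (if m = 0 then J else 0) • LinearMap.id - (2 : ℂ) • shiftDer m

theorem hop_apply (J : ℂ) (m : ℤ) (w : Laurent) :
    hop J m w = (if m = 0 then J else 0) • w - (2 : ℂ) • shiftDer m w := rfl

theorem hop_one (J : ℂ) (m : ℤ) : hop J m 1 = (if m = 0 then J else 0) • 1 := by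
  rw [hop_apply, shiftDer_one, smul_zero, sub_zero]

theorem hop_xpow_mul (J : ℂ) (m k : ℤ) (r : ℂ) (w : Laurent) :
    hop J m (xpow k r * w) =
      xpow k r * (hop J m w - (2 * r) • (xpow k (-1) * xpow (k + m) 1 * w)) := by
  rw [hop_apply, hop_apply, shiftDer_xpow_mul]
  simp only [Algebra.smul_def, map_mul]
  ring

/-- The operator of `fₙ`, the multiplication by `xₙ`. -/
noncomputable def fop (n : ℤ) : Laurent →ₗ[ℂ] Laurent := LinearMap.mulLeft ℂ (xpow n 1)

theorem fop_apply (n : ℤ) (w : Laurent) : fop n w = xpow n 1 * w := rfl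

/-- The second order operator `∑ₙₖ xₙ₊ₖ₊ₘ ∂ₙ ∂ₖ`. -/
noncomputable def quadOp (m : ℤ) : Laurent →ₗ[ℂ] Laurent :=
  -- For fixed n the sum over k of xₙ₊ₖ₊ₘ ∂ₖ is `shiftDer (m + n)`, applied after ∂ₙ; only the n in
  -- the support of the exponent contribute, so the sum is finite.
  ofMono fun a => a.sum fun n r => r • shiftDer (m + n) (mono a * xpow n (-1))

theorem quadOp_mono (m : ℤ) (a : Expo) : quadOp m (mono a) =
    a.sum fun n r => r • shiftDer (m + n) (mono a * xpow n (-1)) := ofMono_mono _ _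

/-- The operator `∂ₙ`. -/
noncomputable def pderiv (n : ℤ) : Laurent →ₗ[ℂ] Laurent :=
  ofMono fun a => a n • (mono a * xpow n (-1))

theorem pderiv_mono (n : ℤ) (a : Expo) : pderiv n (mono a) = a n • (mono a * xpow n (-1)) :=
  ofMono_mono _ _

theorem pderiv_xpow_mul (n k : ℤ) (r : ℂ) (w : Laurent) :
    pderiv n (xpow k r * w) =
      xpow k r * (pderiv n w + (if n = k then r else 0) • (xpow k (-1) * w)) := by
  induction w using laurent_induction with
  | zero => simp
  | add p q hp hq => simp only [mul_add, map_add, hp, hq, smul_add]; ring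
  | smul_mono s b =>
    rw [mul_smul_comm, xpow, ← mono_add, map_smul, map_smul, pderiv_mono, pderiv_mono, mono_add,
      Finsupp.add_apply, Finsupp.single_apply]
    by_cases h : n = k
    · subst h
      simp only [if_pos, Algebra.smul_def, map_add]
      ring
    · rw [if_neg h, if_neg (Ne.symm h)]
      simp only [Algebra.smul_def, map_add, map_zero]
      ring

/-- Leibniz rule of second order: both derivatives hit `w`, or one hits each factor (twice by
symmetry, whence 2r), or both hit xₖ ^ r, which gives r(r - 1). -/
theorem quadOp_xpow_mul (m k : ℤ) (r : ℂ) (w : Laurent) :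
    quadOp m (xpow k r * w) =
      xpow k r * (quadOp m w + (2 * r) • (xpow k (-1) * shiftDer (m + k) w) +
        (r * (r - 1)) • (xpow k (-1) * xpow k (-1) * xpow (2 * k + m) 1 * w)) := by
  induction w using laurent_induction with
  | zero => simp
  | add p q hp hq => simp only [mul_add, map_add, hp, hq, smul_add]; ring
  | smul_mono s b =>
    have key : quadOp m (xpow k r * mono b) = xpow k r * (quadOp m (mono b) +
        (2 * r) • (xpow k (-1) * shiftDer (m + k) (mono b)) +
        (r * (r - 1)) • (xpow k (-1) * xpow k (-1) * xpow (2 * k + m) 1 * mono b)) := by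
      have h1 : xpow k r * mono b = mono (Finsupp.single k r + b) := by rw [mono_add]; rfl
      have h2 : ∀ n : ℤ, shiftDer (m + n) (xpow k r * mono b * xpow n (-1)) =
          xpow k r * (shiftDer (m + n) (mono b * xpow n (-1)) +
            r • (xpow k (-1) * xpow (k + (m + n)) 1 * (mono b * xpow n (-1)))) := by
        intro n
        rw [mul_assoc, shiftDer_xpow_mul]
      have h3 : shiftDer (m + k) (mono b * xpow k (-1)) = xpow k (-1) *
          (shiftDer (m + k) (mono b) - xpow k (-1) * xpow (2 * k + m) 1 * mono b) := by
        rw [mul_comm, shiftDer_xpow_mul, show k + (m + k) = 2 * k + m by ring, neg_smul, one_smul]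
        ring
      rw [h1, quadOp_mono, Finsupp.sum_add_index' (by simp) (by intros; rw [add_smul]),
        Finsupp.sum_single_index (by simp), ← h1]
      simp only [h2]
      rw [h3, show k + (m + k) = 2 * k + m by ring, quadOp_mono,
        show shiftDer (m + k) (mono b) = mono b * logDer (m + k) b from shiftDer_mono _ _, logDer,
        Finsupp.linearCombination_apply]
      have h4 : (b.sum fun n s => s • (xpow k r * (shiftDer (m + n) (mono b * xpow n (-1)) +
            r • (xpow k (-1) * xpow (k + (m + n)) 1 * (mono b * xpow n (-1)))))) =
          xpow k r * ((b.sum fun n s => s • shiftDer (m + n) (mono b * xpow n (-1))) +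
            r • (xpow k (-1) * (mono b *
              (b.sum fun n s => s • (xpow n (-1) * xpow (n + (m + k)) 1))))) := by
        simp only [Finsupp.sum, Algebra.smul_def, Finset.mul_sum, ← Finset.sum_add_distrib]
        refine Finset.sum_congr rfl fun n _ => ?_
        rw [show k + (m + n) = n + (m + k) by ring]
        ring
      rw [h4]
      generalize (b.sum fun n s => s • (xpow n (-1) * xpow (n + (m + k)) 1)) = S
      generalize (b.sum fun n s => s • shiftDer (m + n) (mono b * xpow n (-1))) = S'
      simp only [Algebra.smul_def, map_mul, map_sub, map_one, map_ofNat]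
      ring
    rw [mul_smul_comm, map_smul, key, map_smul, map_smul]
    simp only [Algebra.smul_def]
    ring

/-- The operator of `eₘ`. -/
noncomputable def eop (J : ℂ) (m : ℤ) : Laurent →ₗ[ℂ] Laurent := J • pderiv (-m) - quadOp m

theorem eop_apply (J : ℂ) (m : ℤ) (w : Laurent) :
    eop J m w = J • pderiv (-m) w - quadOp m w := rfl

theorem eop_one (J : ℂ) (m : ℤ) : eop J m 1 = 0 := by
  rw [eop_apply, ← mono_zero, pderiv_mono, quadOp_mono]
  simp

/-- The mixed terms assemble into hₘ₊ₖ: the contribution of J ∂₋ₘ is present exactly when m + k = 0,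
which is when hₘ₊ₖ contains the scalar J. -/
theorem eop_xpow_mul (J : ℂ) (m k : ℤ) (r : ℂ) (w : Laurent) :
    eop J m (xpow k r * w) =
      xpow k r * (eop J m w + r • (xpow k (-1) * hop J (m + k) w) -
        (r * (r - 1)) • (xpow k (-1) * xpow k (-1) * xpow (2 * k + m) 1 * w)) := by
  rw [eop_apply, eop_apply, hop_apply, pderiv_xpow_mul, quadOp_xpow_mul]
  by_cases h : -m = k
  · have h' : m + k = 0 := by omega
    rw [if_pos h, if_pos h']
    simp only [Algebra.smul_def, map_mul]
    ring
  · have h' : ¬ m + k = 0 := by omega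
    rw [if_neg h, if_neg h']
    simp only [Algebra.smul_def, map_mul, map_zero]
    ring

/-- The operator of `d`. -/
noncomputable def dop (κ : ℂ) : Laurent →ₗ[ℂ] Laurent :=
  ofMono fun a => (κ + a.sum fun n r => n * r) • mono a

theorem dop_mono (κ : ℂ) (a : Expo) :
    dop κ (mono a) = (κ + a.sum fun n r => n * r) • mono a := ofMono_mono _ _

theorem dop_one (κ : ℂ) : dop κ 1 = κ • 1 := by
  rw [← mono_zero, dop_mono]; simp

theorem dop_xpow_mul (κ : ℂ) (k : ℤ) (r : ℂ) (w : Laurent) :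
    dop κ (xpow k r * w) = xpow k r * (dop κ w + ((k : ℂ) * r) • w) := by
  induction w using laurent_induction with
  | zero => simp
  | add p q hp hq => simp only [mul_add, map_add, hp, hq, smul_add]; ring
  | smul_mono s b =>
    rw [mul_smul_comm, xpow, ← mono_add, map_smul, map_smul, dop_mono, dop_mono,
      Finsupp.sum_add_index' (by simp) (by intros; ring), Finsupp.sum_single_index (by simp),
      mono_add]
    simp only [Algebra.smul_def, map_add]
    ring

end AffineSl2

namespace AffineSl2

/-! ### The Fock representation of the affine Lie algebra -/

theorem smul_op_apply (r : ℂ) (S : Laurent →ₗ[ℂ] Laurent) (w : Laurent) :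
    (r • S) w = r • S w := rfl

/-- How the commutation relations are verified: agreement at the vacuum 1, and a difference that
commutes with all powers of the variables. The second condition is where the formulas for moving xₖ
^ r to the left are used. -/
theorem eq_of_commute_xpow {S T : Laurent →ₗ[ℂ] Laurent} (h1 : S 1 = T 1)
    (h : ∀ k r w, S (xpow k r * w) - T (xpow k r * w) = xpow k r * (S w - T w)) : S = T :=
  sub_eq_zero.mp (eq_zero_of_commute_xpow (by rw [LinearMap.sub_apply, h1, sub_self])
    fun k r w => h k r w)

theorem hop_fop (J : ℂ) (m n : ℤ) (w : Laurent) :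
    hop J m (fop n w) - fop n (hop J m w) = -(2 : ℂ) • fop (m + n) w := by
  rw [fop_apply, hop_xpow_mul, fop_apply, fop_apply, add_comm n m]
  have h := xpow_mul_neg n 1
  simp only [Algebra.smul_def, map_mul, map_one, map_neg]
  linear_combination -(algebraMap ℂ Laurent 2 * xpow (m + n) 1 * w) * h

theorem eop_fop (J : ℂ) (m n : ℤ) (w : Laurent) :
    eop J m (fop n w) - fop n (eop J m w) = hop J (m + n) w := by
  rw [fop_apply, eop_xpow_mul, fop_apply]
  have h := xpow_mul_neg n 1
  simp only [Algebra.smul_def, map_mul, map_one, map_sub]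
  linear_combination hop J (m + n) w * h

theorem dop_fop (κ : ℂ) (n : ℤ) (w : Laurent) :
    dop κ (fop n w) - fop n (dop κ w) = (n : ℂ) • fop n w := by
  rw [fop_apply, dop_xpow_mul, fop_apply]
  simp only [Algebra.smul_def, map_mul, map_one]
  ring

theorem hop_smul_one (J : ℂ) (m : ℤ) (r : ℂ) :
    hop J m (r • 1) = (r * if m = 0 then J else 0) • 1 := by
  rw [map_smul, hop_one, smul_smul]

theorem hop_comm (J : ℂ) (m n : ℤ) : hop J m ∘ₗ hop J n = hop J n ∘ₗ hop J m := by
  refine eq_of_commute_xpow ?_ fun k r w => ?_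
  · simp only [LinearMap.comp_apply, hop_one, hop_smul_one, mul_comm]
  · simp only [LinearMap.comp_apply, hop_xpow_mul, map_sub, map_smul, mul_assoc]
    rw [show k + n + m = k + m + n by ring]
    simp only [Algebra.smul_def, map_mul, map_one, map_neg, map_ofNat]
    have h1 := xpow_mul_neg (k + m) 1
    have h2 := xpow_mul_neg (k + n) 1
    linear_combination
      4 * (algebraMap ℂ Laurent r) * xpow k r * xpow k (-1) * xpow (k + m + n) 1 * w * (h2 - h1)

theorem dop_hop (J κ : ℂ) (m : ℤ) :
    dop κ ∘ₗ hop J m - hop J m ∘ₗ dop κ = (m : ℂ) • hop J m := by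
  refine eq_of_commute_xpow ?_ fun k r w => ?_
  · simp only [LinearMap.comp_apply, LinearMap.sub_apply, smul_op_apply, hop_one, dop_one,
      map_smul]
    by_cases h : m = 0 <;> simp [h, smul_smul, mul_comm]
  · simp only [LinearMap.comp_apply, LinearMap.sub_apply, smul_op_apply, hop_xpow_mul,
      dop_xpow_mul, map_sub, map_smul, map_add, mul_assoc]
    simp only [Algebra.smul_def, map_mul, map_one, map_neg, map_ofNat, Int.cast_add, map_add]
    ring

theorem hop_eop (J : ℂ) (m n : ℤ) :
    hop J m ∘ₗ eop J n - eop J n ∘ₗ hop J m = (2 : ℂ) • eop J (m + n) := by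
  refine eq_of_commute_xpow ?_ fun k r w => ?_
  · simp only [LinearMap.comp_apply, LinearMap.sub_apply, smul_op_apply, hop_one, eop_one,
      map_smul, map_zero, smul_zero, sub_zero]
  · have hc := LinearMap.congr_fun (hop_comm J m (n + k)) w
    simp only [LinearMap.comp_apply] at hc
    simp only [LinearMap.comp_apply, LinearMap.sub_apply, smul_op_apply, hop_xpow_mul,
      eop_xpow_mul, map_sub, map_smul, map_add, mul_assoc, hc]
    rw [show n + (k + m) = m + n + k by ring, show 2 * k + n + m = 2 * k + (m + n) by ring,
      show k + m + (n + k) = 2 * k + (m + n) by ring, show k + (n + k) = 2 * k + n by ring]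
    have h1 := xpow_mul_neg (k + m) 1
    have h2 := xpow_mul_neg (2 * k + n) 1
    have h3 := xpow_mul_neg k 1
    simp only [Algebra.smul_def, map_mul, map_one, map_neg, map_ofNat, map_sub]
    linear_combination h1 * (2 * xpow k r * algebraMap ℂ Laurent r * xpow k (-1) *
        hop J (m + n + k) w + 4 * xpow k r * algebraMap ℂ Laurent r * xpow k (-1) ^ 2 *
        xpow (2 * k + (m + n)) 1 * w * (1 - algebraMap ℂ Laurent r)) -
      h2 * (2 * xpow k r * algebraMap ℂ Laurent r * xpow k (-1) ^ 2 *
        xpow (2 * k + (m + n)) 1 * w * (1 - algebraMap ℂ Laurent r))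

theorem dop_eop (J κ : ℂ) (m : ℤ) :
    dop κ ∘ₗ eop J m - eop J m ∘ₗ dop κ = (m : ℂ) • eop J m := by
  refine eq_of_commute_xpow ?_ fun k r w => ?_
  · simp only [LinearMap.comp_apply, LinearMap.sub_apply, smul_op_apply, eop_one, dop_one,
      map_smul, map_zero, smul_zero, sub_zero]
  · have hc := LinearMap.congr_fun (dop_hop J κ (m + k)) w
    simp only [LinearMap.comp_apply, LinearMap.sub_apply, smul_op_apply] at hc
    simp only [LinearMap.comp_apply, LinearMap.sub_apply, smul_op_apply, eop_xpow_mul,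
      dop_xpow_mul, map_sub, map_smul, map_add, mul_assoc]
    simp only [Algebra.smul_def, map_mul, map_one, map_neg, map_ofNat, Int.cast_add, map_add,
      map_sub, Int.cast_mul, Int.cast_ofNat] at hc ⊢
    linear_combination xpow k r * algebraMap ℂ Laurent r * xpow k (-1) * hc

/-- Moving xₖ ^ r through two operators of type e leaves commutators of types [h, h] and [h, e]
applied to `w`; these are already known, which is why this relation comes last. -/
theorem eop_comm (J : ℂ) (m n : ℤ) : eop J m ∘ₗ eop J n = eop J n ∘ₗ eop J m := by
  refine eq_of_commute_xpow ?_ fun k r w => ?_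
  · simp only [LinearMap.comp_apply, eop_one, map_zero]
  · have hc := LinearMap.congr_fun (hop_comm J (m + k) (n + k)) w
    have hm := LinearMap.congr_fun (hop_eop J (m + k) n) w
    have hn := LinearMap.congr_fun (hop_eop J (n + k) m) w
    simp only [LinearMap.comp_apply, LinearMap.sub_apply, smul_op_apply] at hc hm hn
    rw [show m + k + n = m + n + k by ring] at hm
    rw [show n + k + m = m + n + k by ring] at hn
    simp only [LinearMap.comp_apply, eop_xpow_mul, hop_xpow_mul, map_sub, map_smul, map_add,
      mul_assoc, hc]
    rw [show m + (2 * k + n) = m + n + 2 * k by ring, show n + (2 * k + m) = m + n + 2 * k by ring,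
      show 2 * (2 * k + n) + m = m + 2 * n + 4 * k by ring,
      show 2 * (2 * k + m) + n = 2 * m + n + 4 * k by ring,
      show 2 * k + n + (m + k) = m + n + 3 * k by ring,
      show 2 * k + m + (n + k) = m + n + 3 * k by ring,
      show k + (n + k) = 2 * k + n by ring, show k + (m + k) = 2 * k + m by ring]
    have h1 := xpow_mul_neg (2 * k + m) 1
    have h2 := xpow_mul_neg (2 * k + n) 1
    simp only [Algebra.smul_def, map_mul, map_one, map_neg, map_ofNat, map_sub] at hm hn ⊢
    linear_combination xpow k r * algebraMap ℂ Laurent r * xpow k (-1) * (hm - hn) +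
      xpow k r * algebraMap ℂ Laurent r * xpow k (-1) ^ 2 *
        ((algebraMap ℂ Laurent r - 1) * hop J (m + n + 2 * k) w +
        (6 * algebraMap ℂ Laurent r - 4 - 2 * algebraMap ℂ Laurent r ^ 2) * xpow k (-1) *
          xpow (m + n + 3 * k) 1 * w) * (h1 - h2)

end AffineSl2

/-! ### From the generating operators to a representation of the enveloping algebra -/

namespace AffineSl2

/-- The operator of `a ⊗ tᵐ`. -/
noncomputable def slOp (J : ℂ) (m : ℤ) : Sl2 →ₗ[ℂ] Module.End ℂ Laurent where
  toFun a := a.1 0 1 • eop J m + a.1 1 0 • fop m + a.1 0 0 • hop J m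
  map_add' a b := by
    change (a.1 0 1 + b.1 0 1) • eop J m + (a.1 1 0 + b.1 1 0) • fop m +
      (a.1 0 0 + b.1 0 0) • hop J m = _
    module
  map_smul' r a := by
    change (r * a.1 0 1) • eop J m + (r * a.1 1 0) • fop m + (r * a.1 0 0) • hop J m = _
    rw [RingHom.id_apply]
    module

theorem slOp_apply (J : ℂ) (m : ℤ) (a : Sl2) (w : Laurent) :
    slOp J m a w = a.1 0 1 • eop J m w + a.1 1 0 • fop m w + a.1 0 0 • hop J m w := rfl

theorem sl_trace (a : Sl2) : a.1 1 1 = -a.1 0 0 := by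
  have h : Matrix.trace a.1 = 0 := LinearMap.mem_ker.mp a.2
  rw [Matrix.trace_fin_two] at h
  linear_combination h

/-- No Killing form term occurs: at central charge zero the loop algebra itself is represented. -/
theorem slOp_lie (J : ℂ) (m n : ℤ) (a b : Sl2) :
    slOp J (m + n) ⁅a, b⁆ = slOp J m a * slOp J n b - slOp J n b * slOp J m a := by
  refine LinearMap.ext fun w => ?_
  have h1 := LinearMap.congr_fun (eop_comm J m n) w
  have h2 := LinearMap.congr_fun (hop_comm J m n) w
  have h3 := LinearMap.congr_fun (hop_eop J m n) w
  have h4 := LinearMap.congr_fun (hop_eop J n m) w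
  have h5 := eop_fop J m n w
  have h6 := eop_fop J n m w
  have h7 := hop_fop J m n w
  have h8 := hop_fop J n m w
  have h9 : fop m (fop n w) = fop n (fop m w) := by simp only [fop_apply]; ring
  rw [add_comm n m] at h4 h6 h8
  simp only [LinearMap.comp_apply, LinearMap.sub_apply, smul_op_apply] at h1 h2 h3 h4
  simp only [LinearMap.sub_apply, Module.End.mul_apply, slOp_apply, map_add, map_smul,
    LieAlgebra.SpecialLinear.sl_bracket, Matrix.sub_apply, Matrix.mul_apply, Fin.sum_univ_two,
    sl_trace]
  simp only [Algebra.smul_def, map_add, map_sub, map_mul, map_neg, map_ofNat] at h3 h4 h7 h8 ⊢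
  generalize algebraMap ℂ Laurent (a.1 0 0) = a0 at *
  generalize algebraMap ℂ Laurent (a.1 0 1) = a1 at *
  generalize algebraMap ℂ Laurent (a.1 1 0) = a2 at *
  generalize algebraMap ℂ Laurent (b.1 0 0) = b0 at *
  generalize algebraMap ℂ Laurent (b.1 0 1) = b1 at *
  generalize algebraMap ℂ Laurent (b.1 1 0) = b2 at *
  linear_combination -a1 * b1 * h1 - a0 * b0 * h2 - a0 * b1 * h3 + a1 * b0 * h4 -
    a1 * b2 * h5 + a2 * b1 * h6 - a0 * b2 * h7 + a2 * b0 * h8 - a2 * b2 * h9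

theorem dop_slOp (J κ : ℂ) (m : ℤ) (a : Sl2) :
    dop κ * slOp J m a - slOp J m a * dop κ = (m : ℂ) • slOp J m a := by
  refine LinearMap.ext fun w => ?_
  have h1 := LinearMap.congr_fun (dop_eop J κ m) w
  have h2 := LinearMap.congr_fun (dop_hop J κ m) w
  have h3 := dop_fop κ m w
  simp only [LinearMap.comp_apply, LinearMap.sub_apply, smul_op_apply] at h1 h2
  simp only [LinearMap.sub_apply, Module.End.mul_apply, smul_op_apply, slOp_apply, map_add,
    map_smul]
  simp only [Algebra.smul_def] at *
  linear_combination algebraMap ℂ Laurent (a.1 0 1) * h1 + algebraMap ℂ Laurent (a.1 0 0) * h2 +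
    algebraMap ℂ Laurent (a.1 1 0) * h3

/-- The operator of a loop. -/
noncomputable def loopOp (J : ℂ) : Loop →ₗ[ℂ] Module.End ℂ Laurent :=
  Finsupp.lsum ℂ (slOp J) ∘ₗ Loop.coeff.toLinearMap

theorem loopOp_monomial (J : ℂ) (m : ℤ) (a : Sl2) : loopOp J (monomial m a) = slOp J m a := by
  simp [loopOp, coeff_monomial]

theorem loopOp_lie (J : ℂ) (x y : Loop) :
    loopOp J ⁅x, y⁆ = loopOp J x * loopOp J y - loopOp J y * loopOp J x := by
  induction x using loop_induction with
  | zero => simp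
  | add x x' hx hx' => simp only [add_lie, map_add, hx, hx', add_mul, mul_add]; abel
  | tmul m a =>
    induction y using loop_induction with
    | zero => simp
    | add x x' hx hx' => simp only [lie_add, map_add, hx, hx', add_mul, mul_add]; abel
    | tmul n b => rw [monomial_lie, loopOp_monomial, loopOp_monomial, loopOp_monomial, slOp_lie]

theorem loopOp_degree (J κ : ℂ) (x : Loop) :
    loopOp J (degree x) = dop κ * loopOp J x - loopOp J x * dop κ := by
  induction x using loop_induction with
  | zero => simp
  | add x x' hx hx' => simp only [map_add, hx, hx', add_mul, mul_add]; abel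
  | tmul m a => rw [degree_monomial, map_smul, loopOp_monomial, dop_slOp]

/-- The operator of an element of the affine Lie algebra; `c` acts by zero. -/
noncomputable def affineOp (J κ : ℂ) : AffineSl2 →ₗ[ℂ] Module.End ℂ Laurent where
  toFun x := loopOp J x.loop + x.dCoeff • dop κ
  map_add' x y := by simp only [add_loop, add_dCoeff, map_add, add_smul]; abel
  map_smul' r x := by simp only [smul_loop, smul_dCoeff, map_smul, mul_smul, smul_add,
    RingHom.id_apply]

theorem affineOp_apply (J κ : ℂ) (x : AffineSl2) :
    affineOp J κ x = loopOp J x.loop + x.dCoeff • dop κ := rfl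

theorem affineOp_lie (J κ : ℂ) (x y : AffineSl2) :
    affineOp J κ ⁅x, y⁆ = affineOp J κ x * affineOp J κ y - affineOp J κ y * affineOp J κ x := by
  simp only [affineOp_apply, lie_loop, lie_dCoeff, map_add, map_sub, map_smul, loopOp_lie,
    loopOp_degree J κ, zero_smul, add_zero, add_mul, mul_add, smul_mul_assoc, mul_smul_comm,
    smul_sub]
  module

section

attribute [local instance 100] LieRing.ofAssociativeRing

/-- The representation of `U` on generalized Laurent polynomials. -/
noncomputable def fockRep (J κ : ℂ) : U →ₐ[ℂ] Module.End ℂ Laurent :=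
  UniversalEnvelopingAlgebra.lift ℂ
    { (affineOp J κ) with map_lie' := fun {x y} => affineOp_lie J κ x y }

theorem fockRep_ι (J κ : ℂ) (x : AffineSl2) : fockRep J κ (ι x) = affineOp J κ x :=
  UniversalEnvelopingAlgebra.lift_ι_apply ℂ _ x

end

theorem fockRep_e (J κ : ℂ) (n : ℤ) : fockRep J κ (ι (eₙ n)) = eop J n := by
  refine LinearMap.ext fun w => ?_
  rw [fockRep_ι, affineOp_apply, eₙ, loopOp_monomial, zero_smul, add_zero, slOp_apply]
  simp [e]

theorem fockRep_f (J κ : ℂ) (n : ℤ) : fockRep J κ (ι (fₙ n)) = fop n := by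
  refine LinearMap.ext fun w => ?_
  rw [fockRep_ι, affineOp_apply, fₙ, loopOp_monomial, zero_smul, add_zero, slOp_apply]
  simp [f]

theorem fockRep_h (J κ : ℂ) (n : ℤ) : fockRep J κ (ι (hₙ n)) = hop J n := by
  refine LinearMap.ext fun w => ?_
  rw [fockRep_ι, affineOp_apply, hₙ, loopOp_monomial, zero_smul, add_zero, slOp_apply]
  simp [h]

theorem fockRep_c (J κ : ℂ) : fockRep J κ (ι c) = 0 := by
  simp [fockRep_ι, affineOp_apply, c]

theorem fockRep_d (J κ : ℂ) : fockRep J κ (ι d) = dop κ := by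
  simp [fockRep_ι, affineOp_apply, d]

/-- The affine Lie algebra is spanned by the standard generators. -/
theorem affine_induction {P : AffineSl2 → Prop} (x : AffineSl2)
    (add : ∀ x y, P x → P y → P (x + y)) (smul : ∀ (r : ℂ) x, P x → P (r • x))
    (he : ∀ n, P (eₙ n)) (hf : ∀ n, P (fₙ n)) (hh : ∀ n, P (hₙ n)) (hc : P c) (hd : P d) :
    P x := by
  have hzero : P 0 := by simpa using smul 0 c hc
  have hmon : ∀ m a, P ⟨monomial m a, 0, 0⟩ := by
    intro m a
    have ha : a = a.1 0 1 • e + a.1 1 0 • f + a.1 0 0 • h := by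
      apply Subtype.ext
      ext i j
      fin_cases i <;> fin_cases j <;> simp [e, f, h, sl_trace]
    have hlin : ∀ (r s t : ℂ), (⟨monomial m (r • e + s • f + t • h), 0, 0⟩ : AffineSl2) =
        r • eₙ m + s • fₙ m + t • hₙ m := by
      intro r s t
      ext1
      · simp only [add_loop, smul_loop, eₙ, fₙ, hₙ, ← coeff_symm_single, Finsupp.single_add,
          map_add, ← Finsupp.smul_single, map_smul]
      · simp [eₙ, fₙ, hₙ]
      · simp [eₙ, fₙ, hₙ]
    rw [ha, hlin]
    exact add _ _ (add _ _ (smul _ _ (he m)) (smul _ _ (hf m))) (smul _ _ (hh m))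
  have hloop : ∀ l : Loop, P ⟨l, 0, 0⟩ := by
    intro l
    induction l using loop_induction with
    | zero => exact hzero
    | add l l' hl hl' =>
      have : (⟨l + l', 0, 0⟩ : AffineSl2) = ⟨l, 0, 0⟩ + ⟨l', 0, 0⟩ := by ext1 <;> simp
      rw [this]
      exact add _ _ hl hl'
    | tmul m a => exact hmon m a
  have hx : x = ⟨x.loop, 0, 0⟩ + x.cCoeff • c + x.dCoeff • d := by
    ext1 <;> simp [c, d]
  rw [hx]
  exact add _ _ (add _ _ (hloop _) (smul _ _ hc)) (smul _ _ hd)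

end AffineSl2

namespace AffineSl2

/-! ### Spans of monomials -/

/-- The span of the monomials with exponents in `S`. -/
def monoSpan (S : Set Expo) : Submodule ℂ Laurent where
  carrier := {p | ∀ a, p.coeff a ≠ 0 → a ∈ S}
  add_mem' {p q} hp hq a ha := by
    by_contra h
    have h1 : p.coeff a = 0 := by by_contra h'; exact h (hp a h')
    have h2 : q.coeff a = 0 := by by_contra h'; exact h (hq a h')
    exact ha (by simp [h1, h2])
  zero_mem' a ha := absurd rfl ha
  smul_mem' r p hp a ha := hp a fun h => ha (by simp [h])

theorem mem_monoSpan {S : Set Expo} {p : Laurent} :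
    p ∈ monoSpan S ↔ ∀ a, p.coeff a ≠ 0 → a ∈ S := Iff.rfl

theorem coeff_mono_self (a : Expo) : (mono a).coeff a = 1 := by simp [mono]

theorem coeff_mono_of_ne {a b : Expo} (h : a ≠ b) : (mono a).coeff b = 0 := by
  simp [mono, h]

theorem mono_ne_zero (a : Expo) : mono a ≠ 0 := fun h => by
  have := coeff_mono_self a
  rw [h] at this
  simp at this

theorem mono_mem_monoSpan {S : Set Expo} {a : Expo} : mono a ∈ monoSpan S ↔ a ∈ S := by
  refine ⟨fun h => h a (by rw [coeff_mono_self]; exact one_ne_zero), fun h b hb => ?_⟩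
  by_contra h'
  exact hb (coeff_mono_of_ne fun hab => h' (hab ▸ h))

theorem monoSpan_le {S : Set Expo} {W : Submodule ℂ Laurent} (h : ∀ a ∈ S, mono a ∈ W) :
    monoSpan S ≤ W := by
  intro p hp
  rw [← sum_smul_mono p]
  refine Submodule.sum_mem _ fun a ha => W.smul_mem _ (h a (hp a ?_))
  simpa using ha

theorem monoSpan_mono {S T : Set Expo} (h : S ⊆ T) : monoSpan S ≤ monoSpan T :=
  fun _ hp a ha => h (hp a ha)

theorem map_mem_monoSpan {S T : Set Expo} {A : Laurent →ₗ[ℂ] Laurent}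
    (h : ∀ a ∈ S, A (mono a) ∈ monoSpan T) {p : Laurent} (hp : p ∈ monoSpan S) :
    A p ∈ monoSpan T :=
  (monoSpan_le (W := (monoSpan T).comap A) h) hp

theorem shiftDer_mono_mem {T : Set Expo} {m : ℤ} {a : Expo}
    (h : ∀ n, a n ≠ 0 → a + Finsupp.single n (-1) + Finsupp.single (n + m) 1 ∈ T) :
    shiftDer m (mono a) ∈ monoSpan T := by
  rw [shiftDer_mono, logDer, Finsupp.linearCombination_apply, Finsupp.sum, Finset.mul_sum]
  refine Submodule.sum_mem _ fun n hn => ?_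
  rw [mul_smul_comm, ← mul_assoc, xpow, xpow, ← mono_add, ← mono_add]
  exact Submodule.smul_mem _ _ (mono_mem_monoSpan.mpr (h n (by simpa using hn)))

theorem quadOp_mono_mem {T : Set Expo} {m : ℤ} {a : Expo}
    (h : ∀ n k, a n ≠ 0 → (a + Finsupp.single n (-1) : Expo) k ≠ 0 →
      a + Finsupp.single n (-1) + Finsupp.single k (-1) + Finsupp.single (k + (m + n)) 1 ∈ T) :
    quadOp m (mono a) ∈ monoSpan T := by
  rw [quadOp_mono]
  refine Submodule.sum_mem _ fun n hn => Submodule.smul_mem _ _ ?_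
  rw [xpow, ← mono_add]
  exact shiftDer_mono_mem fun k hk => h n k (by simpa using hn) hk

/-- Sets of exponents whose span is stable under multiplication by variables and derivatives. -/
structure IsAdmissible (S : Set Expo) : Prop where
  add : ∀ a ∈ S, ∀ n, a + Finsupp.single n 1 ∈ S
  -- Lowering is demanded only where the entry is nonzero, because otherwise the derivative has
  -- coefficient zero. This is what makes natural exponents admissible.
  sub : ∀ a ∈ S, ∀ n, a n ≠ 0 → a + Finsupp.single n (-1) ∈ S

theorem IsAdmissible.fop_mem {S : Set Expo} (hS : IsAdmissible S) (n : ℤ) {p : Laurent}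
    (hp : p ∈ monoSpan S) : fop n p ∈ monoSpan S := by
  refine map_mem_monoSpan (fun a ha => ?_) hp
  rw [fop_apply, mul_comm, xpow, ← mono_add]
  exact mono_mem_monoSpan.mpr (hS.add a ha n)

theorem IsAdmissible.shiftDer_mem {S : Set Expo} (hS : IsAdmissible S) (m : ℤ) {p : Laurent}
    (hp : p ∈ monoSpan S) : shiftDer m p ∈ monoSpan S :=
  map_mem_monoSpan (fun a ha => shiftDer_mono_mem fun n hn =>
    hS.add _ (hS.sub a ha n hn) _) hp

theorem IsAdmissible.hop_mem {S : Set Expo} (hS : IsAdmissible S) (J : ℂ) (m : ℤ) {p : Laurent}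
    (hp : p ∈ monoSpan S) : hop J m p ∈ monoSpan S :=
  Submodule.sub_mem _ (Submodule.smul_mem _ _ hp)
    (Submodule.smul_mem _ _ (hS.shiftDer_mem m hp))

theorem IsAdmissible.quadOp_mem {S : Set Expo} (hS : IsAdmissible S) (m : ℤ) {p : Laurent}
    (hp : p ∈ monoSpan S) : quadOp m p ∈ monoSpan S :=
  map_mem_monoSpan (fun a ha => quadOp_mono_mem fun n k hn hk =>
    hS.add _ (hS.sub _ (hS.sub a ha n hn) k hk) _) hp

theorem IsAdmissible.pderiv_mem {S : Set Expo} (hS : IsAdmissible S) (n : ℤ) {p : Laurent}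
    (hp : p ∈ monoSpan S) : pderiv n p ∈ monoSpan S := by
  refine map_mem_monoSpan (fun a ha => ?_) hp
  rw [pderiv_mono]
  by_cases h : a n = 0
  · rw [h, zero_smul]; exact Submodule.zero_mem _
  · rw [xpow, ← mono_add]
    exact Submodule.smul_mem _ _ (mono_mem_monoSpan.mpr (hS.sub a ha n h))

theorem IsAdmissible.eop_mem {S : Set Expo} (hS : IsAdmissible S) (J : ℂ) (m : ℤ) {p : Laurent}
    (hp : p ∈ monoSpan S) : eop J m p ∈ monoSpan S :=
  Submodule.sub_mem _ (Submodule.smul_mem _ _ (hS.pderiv_mem _ hp)) (hS.quadOp_mem m hp)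

theorem dop_mem (κ : ℂ) {S : Set Expo} {p : Laurent} (hp : p ∈ monoSpan S) :
    dop κ p ∈ monoSpan S := by
  refine map_mem_monoSpan (fun a ha => ?_) hp
  rw [dop_mono]
  exact Submodule.smul_mem _ _ (mono_mem_monoSpan.mpr ha)

/-- Subspaces stable under the operators of `eₘ`, `fₘ` and `hₘ`. -/
structure IsStable (J : ℂ) (W : Submodule ℂ Laurent) : Prop where
  -- The operator of d is not required: the irreducibility arguments work for the eₘ, fₘ and hₘ
  -- alone.
  eop_mem : ∀ m, ∀ p ∈ W, eop J m p ∈ W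
  fop_mem : ∀ m, ∀ p ∈ W, fop m p ∈ W
  hop_mem : ∀ m, ∀ p ∈ W, hop J m p ∈ W

theorem IsAdmissible.isStable {S : Set Expo} (hS : IsAdmissible S) (J : ℂ) :
    IsStable J (monoSpan S) :=
  ⟨fun m _ hp => hS.eop_mem J m hp, fun m _ hp => hS.fop_mem m hp, fun m _ hp => hS.hop_mem J m hp⟩

/-- The exponents of polynomials. -/
def polyExpo : Set Expo := {a | ∀ n, ∃ k : ℕ, a n = k}

/-- The exponents `a` with `aₙ ∈ ℕ` for `n ≠ i` and `aᵢ ∈ z + ℤ`. -/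
def twistExpo (i : ℤ) (z : ℂ) : Set Expo :=
  {a | (∀ n, n ≠ i → ∃ k : ℕ, a n = k) ∧ ∃ k : ℤ, a i = z + k}

theorem exists_nat_add_single {a : Expo} {n : ℤ} (h : ∃ k : ℕ, a n = k) (m : ℤ) :
    ∃ k : ℕ, (a + Finsupp.single m 1 : Expo) n = k := by
  obtain ⟨k, hk⟩ := h
  by_cases hmn : m = n
  · exact ⟨k + 1, by simp [hk, hmn]⟩
  · exact ⟨k, by simp [hk, hmn]⟩

theorem exists_nat_sub_single {a : Expo} {n : ℤ} (h : ∃ k : ℕ, a n = k) {m : ℤ} (hm : a m ≠ 0) :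
    ∃ k : ℕ, (a + Finsupp.single m (-1) : Expo) n = k := by
  obtain ⟨k, hk⟩ := h
  by_cases hmn : m = n
  · subst hmn
    have hk0 : k ≠ 0 := by rintro rfl; exact hm (by simpa using hk)
    refine ⟨k - 1, ?_⟩
    rw [Finsupp.add_apply, Finsupp.single_eq_same, hk, Nat.cast_sub (by omega)]
    push_cast; ring
  · exact ⟨k, by simp [hk, hmn]⟩

theorem isAdmissible_polyExpo : IsAdmissible polyExpo :=
  ⟨fun _ ha m n => exists_nat_add_single (ha n) m,
    fun _ ha _ hm n => exists_nat_sub_single (ha n) hm⟩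

theorem isAdmissible_twistExpo (i : ℤ) (z : ℂ) : IsAdmissible (twistExpo i z) := by
  refine ⟨fun a ha m => ⟨fun n hn => exists_nat_add_single (ha.1 n hn) m, ?_⟩,
    fun a ha m hm => ⟨fun n hn => exists_nat_sub_single (ha.1 n hn) hm, ?_⟩⟩
  · obtain ⟨k, hk⟩ := ha.2
    by_cases hmi : m = i
    · exact ⟨k + 1, by simp [hk, hmi]; ring⟩
    · exact ⟨k, by simp [hk, hmi]⟩
  · obtain ⟨k, hk⟩ := ha.2
    by_cases hmi : m = i
    · exact ⟨k - 1, by simp [hk, hmi]; ring⟩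
    · exact ⟨k, by simp [hk, hmi]⟩

theorem polyExpo_subset_twistExpo (i : ℤ) : polyExpo ⊆ twistExpo i 0 := fun a ha =>
  ⟨fun n _ => ha n, by obtain ⟨k, hk⟩ := ha i; exact ⟨k, by simp [hk]⟩⟩

/-- Source of all the isomorphisms: the space realizing the twisted localization sees only the class
of z modulo ℤ. -/
theorem twistExpo_add_int (i : ℤ) (z : ℂ) (k : ℤ) : twistExpo i (z + k) = twistExpo i z := by
  ext a
  refine and_congr_right fun _ => ⟨fun ⟨l, hl⟩ => ⟨k + l, by rw [hl]; push_cast; ring⟩,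
    fun ⟨l, hl⟩ => ⟨l - k, by rw [hl]; push_cast; ring⟩⟩

theorem add_single_mem_twistExpo {i : ℤ} {z : ℂ} {a : Expo} (ha : a ∈ twistExpo i z) (r : ℂ) :
    a + Finsupp.single i r ∈ twistExpo i (z + r) := by
  refine ⟨fun n hn => ?_, ?_⟩
  · obtain ⟨k, hk⟩ := ha.1 n hn
    exact ⟨k, by simp [hk, Ne.symm hn]⟩
  · obtain ⟨k, hk⟩ := ha.2
    exact ⟨k, by simp [hk]; ring⟩

theorem xpow_mul_mem {i : ℤ} {z : ℂ} {p : Laurent} (hp : p ∈ monoSpan (twistExpo i z)) (r : ℂ) :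
    xpow i r * p ∈ monoSpan (twistExpo i (z + r)) := by
  refine map_mem_monoSpan (A := LinearMap.mulLeft ℂ (xpow i r)) (fun a ha => ?_) hp
  rw [LinearMap.mulLeft_apply, mul_comm, xpow, ← mono_add]
  exact mono_mem_monoSpan.mpr (add_single_mem_twistExpo ha r)

/-- The total degree of an exponent. -/
noncomputable def expoDeg : Expo →ₗ[ℂ] ℂ := Finsupp.linearCombination ℂ fun _ => (1 : ℂ)

theorem expoDeg_single (n : ℤ) (r : ℂ) : expoDeg (Finsupp.single n r) = r := by
  simp [expoDeg]

/-- The eigenvalue of `∑ n xₙ ∂ₙ` on a monomial. -/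
noncomputable def expoMoment : Expo →ₗ[ℂ] ℂ := Finsupp.linearCombination ℂ fun n => (n : ℂ)

theorem expoMoment_single (n : ℤ) (r : ℂ) : expoMoment (Finsupp.single n r) = r * n := by
  simp [expoMoment]

theorem hop_zero_mono (J : ℂ) (a : Expo) : hop J 0 (mono a) = (J - 2 * expoDeg a) • mono a := by
  have h : logDer 0 a = expoDeg a • (1 : Laurent) := by
    rw [logDer, expoDeg, Finsupp.linearCombination_apply, Finsupp.linearCombination_apply,
      Finsupp.sum, Finsupp.sum, Finset.sum_smul]
    refine Finset.sum_congr rfl fun n _ => ?_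
    rw [add_zero, mul_comm, xpow_mul_neg, smul_eq_mul, mul_one]
  rw [hop_apply, shiftDer_mono, h, if_pos rfl]
  simp only [Algebra.smul_def, map_sub, map_mul]
  ring

theorem dop_mono_eq (κ : ℂ) (a : Expo) : dop κ (mono a) = (κ + expoMoment a) • mono a := by
  rw [dop_mono, expoMoment, Finsupp.linearCombination_apply]
  congr 2
  exact Finsupp.sum_congr fun n _ => by rw [smul_eq_mul, mul_comm]

end AffineSl2

namespace AffineSl2

/-! ### The operator of `fᵢ e₋ᵢ` is triangular -/

/-- The vectors annihilated by some `χ(T)` with `χ(0) ≠ 0`. -/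
def invPart (T : Module.End ℂ Laurent) : Submodule ℂ Laurent where
  carrier := {p | ∃ χ : Polynomial ℂ, χ.eval 0 ≠ 0 ∧ Polynomial.aeval T χ p = 0}
  add_mem' := by
    rintro p q ⟨χ, hχ, hp⟩ ⟨ψ, hψ, hq⟩
    refine ⟨χ * ψ, by simp [hχ, hψ], ?_⟩
    rw [map_add]
    nth_rewrite 1 [mul_comm]
    rw [map_mul, map_mul, Module.End.mul_apply, Module.End.mul_apply, hp, hq, map_zero, map_zero,
      add_zero]
  zero_mem' := ⟨1, by simp, by simp⟩
  smul_mem' := by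
    rintro r p ⟨χ, hχ, hp⟩
    exact ⟨χ, hχ, by rw [map_smul, hp, smul_zero]⟩

theorem aeval_mem {T : Module.End ℂ Laurent} {W : Submodule ℂ Laurent} (hW : ∀ p ∈ W, T p ∈ W)
    (χ : Polynomial ℂ) {p : Laurent} (hp : p ∈ W) : Polynomial.aeval T χ p ∈ W := by
  induction χ using Polynomial.induction_on with
  | C a => rw [Polynomial.aeval_C]; exact W.smul_mem a hp
  | add χ ψ h1 h2 => rw [map_add]; exact W.add_mem h1 h2
  | monomial n a ih =>
    rw [pow_succ, ← mul_assoc, mul_comm, map_mul, Polynomial.aeval_X]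
    exact hW _ ih

/-- `T` is onto on the part of an invariant subspace where it is invertible. -/
theorem exists_preimage {T : Module.End ℂ Laurent} {W : Submodule ℂ Laurent}
    (hW : ∀ p ∈ W, T p ∈ W) {p : Laurent} (hp : p ∈ W) (hT : p ∈ invPart T) :
    ∃ q ∈ W, T q = p := by
  obtain ⟨χ, hχ, h0⟩ := hT
  -- Write χ = X ψ + χ(0). Then χ(T) p = 0 says T(ψ(T) p) = -χ(0) p, and ψ(T) p stays in `W`.
  refine ⟨-(χ.eval 0)⁻¹ • Polynomial.aeval T χ.divX p, W.smul_mem _ (aeval_mem hW _ hp), ?_⟩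
  rw [← Polynomial.divX_mul_X_add χ, mul_comm, map_add, map_mul, Polynomial.aeval_X,
    Polynomial.aeval_C, Polynomial.coeff_zero_eq_eval_zero, LinearMap.add_apply,
    Module.End.mul_apply, Module.algebraMap_end_apply] at h0
  rw [map_smul, neg_smul, neg_eq_iff_eq_neg, inv_smul_eq_iff₀ hχ, eq_neg_of_add_eq_zero_left h0,
    smul_neg]

/-- The exponents of degree `D` with natural entries outside `i`, of total degree less than `k`
outside `i`. -/
def boundedExpo (i : ℤ) (D : ℂ) (k : ℕ) : Set Expo :=
  {a | (∀ n, n ≠ i → ∃ l : ℕ, a n = l) ∧ expoDeg a = D ∧ ∃ j : ℕ, j < k ∧ a i = D - j}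

/-- The operator of `fᵢ e₋ᵢ`. -/
noncomputable def feOp (J : ℂ) (i : ℤ) : Module.End ℂ Laurent := fop i ∘ₗ eop J (-i)

theorem feOp_apply (J : ℂ) (i : ℤ) (p : Laurent) : feOp J i p = fop i (eop J (-i) p) := rfl

theorem mono_eq_xpow_mul (i : ℤ) (a : Expo) : mono a = xpow i (a i) * mono (a.erase i) := by
  rw [xpow, ← mono_add, Finsupp.single_add_erase]

theorem expoDeg_erase (i : ℤ) (a : Expo) : expoDeg (a.erase i) = expoDeg a - a i := by
  conv_rhs => rw [← Finsupp.single_add_erase i a, map_add, expoDeg_single]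
  simp

/-- With r = aᵢ and D the total degree, h₀ contributes J - 2(D - r) on the variables other than xᵢ,
and the double derivative in xᵢ contributes -(r - 1); the sum times r is the diagonal entry. In the
remaining term both derivatives act on the other variables. -/
theorem feOp_mono (J : ℂ) (i : ℤ) (a : Expo) : feOp J i (mono a) =
    (a i * (J + 1 + a i - 2 * expoDeg a)) • mono a -
      xpow i (a i + 1) * quadOp (-i) (mono (a.erase i)) := by
  rw [feOp_apply, fop_apply, mono_eq_xpow_mul i a, eop_xpow_mul, eop_apply, pderiv_mono, neg_neg,
    Finsupp.erase_same, zero_smul, smul_zero, zero_sub, neg_add_cancel, hop_zero_mono,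
    expoDeg_erase, show 2 * i + -i = i by ring, xpow_add]
  have h := xpow_mul_neg i 1
  simp only [Algebra.smul_def, map_mul, map_add, map_sub, map_one, map_ofNat]
  linear_combination (algebraMap ℂ Laurent (a i) * (algebraMap ℂ Laurent J -
    2 * (algebraMap ℂ Laurent (expoDeg a) - algebraMap ℂ Laurent (a i)) -
    (algebraMap ℂ Laurent (a i) - 1)) * xpow i (a i) * mono (a.erase i) -
    algebraMap ℂ Laurent (a i) * (algebraMap ℂ Laurent (a i) - 1) * xpow i (a i) *
      mono (a.erase i) * xpow i 1 * xpow i (-1)) * h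

/-- Here j is the total degree outside `i`, the index of the filtration in which `feOp` is
triangular. -/
theorem exists_nat_expoDeg_sub {i : ℤ} {a : Expo} (h : ∀ n, n ≠ i → ∃ l : ℕ, a n = l) :
    ∃ j : ℕ, a i = expoDeg a - j := by
  have h2 : ∃ j : ℕ, expoDeg (a.erase i) = j := by
    rw [expoDeg, Finsupp.linearCombination_apply, Finsupp.sum]
    refine Finset.sum_induction _ (fun r : ℂ => ∃ j : ℕ, r = j) ?_ ⟨0, by simp⟩ fun n hn => ?_
    · rintro _ _ ⟨j, rfl⟩ ⟨k, rfl⟩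
      exact ⟨j + k, by simp⟩
    · have hni : n ≠ i := by rintro rfl; simp at hn
      rw [smul_eq_mul, mul_one, Finsupp.erase_ne hni]
      exact h n hni
  obtain ⟨j, hj⟩ := h2
  rw [expoDeg_erase] at hj
  exact ⟨j, by linear_combination -hj⟩

/-- Two variables other than xᵢ are removed and one is created, while the power of xᵢ in front keeps
the total degree. So the degree outside `i` drops by two if the new variable is xᵢ and by one
otherwise, hence strictly. -/
theorem quadOp_erase_mem {i : ℤ} {a : Expo} {j : ℕ}
    (h : ∀ n, n ≠ i → ∃ l : ℕ, a n = l) (hj : a i = expoDeg a - j) :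
    xpow i (a i + 1) * quadOp (-i) (mono (a.erase i)) ∈
      monoSpan (boundedExpo i (expoDeg a) j) := by
  have h0 : ∀ n, (a.erase i) n ≠ 0 → n ≠ i := by rintro n hn rfl; simp at hn
  have hmem : quadOp (-i) (mono (a.erase i)) ∈
      monoSpan {b | b + Finsupp.single i (a i + 1) ∈ boundedExpo i (expoDeg a) j} := by
    refine quadOp_mono_mem fun n k hn hk => ?_
    have hni := h0 n hn
    have hki : k ≠ i := by
      rintro rfl
      exact hk (by simp [hni])
    have hnat : ∀ l, l ≠ i → ∃ t : ℕ, (a.erase i + Finsupp.single n (-1) + Finsupp.single k (-1) +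
        Finsupp.single (k + (-i + n)) 1 + Finsupp.single i (a i + 1) : Expo) l = t := by
      intro l hl
      have h1 : ∃ t : ℕ, (a.erase i) l = t := by rw [Finsupp.erase_ne hl]; exact h l hl
      obtain ⟨t, ht⟩ := exists_nat_add_single
        (exists_nat_sub_single (exists_nat_sub_single h1 hn) hk) (k + (-i + n))
      exact ⟨t, by rw [Finsupp.add_apply, ht]; simp [Ne.symm hl]⟩
    have hdeg : expoDeg (a.erase i + Finsupp.single n (-1) + Finsupp.single k (-1) +
        Finsupp.single (k + (-i + n)) 1 + Finsupp.single i (a i + 1)) = expoDeg a := by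
      simp only [map_add, expoDeg_single, expoDeg_erase]
      ring
    refine ⟨hnat, hdeg, ?_⟩
    obtain ⟨t, ht⟩ := exists_nat_expoDeg_sub hnat
    refine ⟨t, ?_, by rw [ht, hdeg]⟩
    rw [hdeg] at ht
    by_cases hs : k + (-i + n) = i
    · have : ((t + 2 : ℕ) : ℂ) = (j : ℕ) := by
        simp [hni, hki, hs] at ht
        push_cast
        linear_combination ht - hj
      have := Nat.cast_injective this
      omega
    · have : ((t + 1 : ℕ) : ℂ) = (j : ℕ) := by
        simp [hni, hki, hs] at ht
        push_cast
        linear_combination ht - hj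
      have := Nat.cast_injective this
      omega
  refine map_mem_monoSpan (A := LinearMap.mulLeft ℂ (xpow i (a i + 1))) (fun b hb => ?_) hmem
  rw [LinearMap.mulLeft_apply, mul_comm, xpow, ← mono_add]
  exact mono_mem_monoSpan.mpr hb

theorem boundedExpo_mono (i : ℤ) (D : ℂ) {j k : ℕ} (h : j ≤ k) :
    boundedExpo i D j ⊆ boundedExpo i D k := fun _ ⟨h1, h2, l, hl, h3⟩ =>
  ⟨h1, h2, l, hl.trans_le h, h3⟩

theorem feOp_mem {J : ℂ} {i : ℤ} {D : ℂ} {k : ℕ} {p : Laurent}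
    (hp : p ∈ monoSpan (boundedExpo i D k)) : feOp J i p ∈ monoSpan (boundedExpo i D k) := by
  refine map_mem_monoSpan (fun a ha => ?_) hp
  obtain ⟨h1, rfl, j, hjk, hj⟩ := id ha
  rw [feOp_mono]
  exact Submodule.sub_mem _ (Submodule.smul_mem _ _ (mono_mem_monoSpan.mpr ha))
    (monoSpan_mono (boundedExpo_mono i _ hjk.le) (quadOp_erase_mem h1 hj))

/-- On layer j, where aᵢ = D - j, the diagonal entry of `feOp` is (D - j)(J + 1 - D - j).
Multiplying a polynomial that kills the lower layer by X minus this entry kills the new monomial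
too, and its value at 0 remains nonzero. -/
theorem monoSpan_boundedExpo_le {J : ℂ} {i : ℤ} {D : ℂ} {k : ℕ}
    (h : ∀ j : ℕ, j < k → (D - j) * (J + 1 - D - j) ≠ 0) :
    monoSpan (boundedExpo i D k) ≤ invPart (feOp J i) := by
  induction k with
  | zero =>
    refine monoSpan_le fun a ha => ?_
    obtain ⟨_, _, j, hj, _⟩ := ha
    omega
  | succ k ih =>
    have ih := ih fun j hj => h j (by omega)
    refine monoSpan_le fun a ha => ?_
    obtain ⟨h1, rfl, j, hjk, hj⟩ := id ha
    rcases Nat.lt_succ_iff_lt_or_eq.mp hjk with hlt | rfl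
    · exact ih (mono_mem_monoSpan.mpr ⟨h1, rfl, j, hlt, hj⟩)
    · obtain ⟨χ, hχ, h0⟩ := ih (quadOp_erase_mem h1 hj)
      refine ⟨χ * (Polynomial.X - Polynomial.C (a i * (J + 1 + a i - 2 * expoDeg a))), ?_, ?_⟩
      · have := h j (by omega)
        simp only [Polynomial.eval_mul, Polynomial.eval_sub, Polynomial.eval_X, Polynomial.eval_C,
          zero_sub, ne_eq, mul_eq_zero, neg_eq_zero, not_or, hχ, not_false_eq_true, true_and]
        rw [hj]
        constructor
        · exact left_ne_zero_of_mul this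
        · intro h'
          exact right_ne_zero_of_mul this (by linear_combination h')
      · rw [map_mul, Module.End.mul_apply, map_sub, Polynomial.aeval_X, Polynomial.aeval_C,
          LinearMap.sub_apply, feOp_mono, Module.algebraMap_end_apply, sub_sub_cancel_left, map_neg,
          h0, neg_zero]

/-- The mechanism that inverts xᵢ inside a submodule: p = fᵢ e₋ᵢ q with q in `W`, and then xᵢ⁻¹ p =
e₋ᵢ q. -/
theorem inv_mul_mem {J : ℂ} {i : ℤ} {W : Submodule ℂ Laurent} (hW : IsStable J W) {p : Laurent}
    (hp : p ∈ W) (hT : p ∈ invPart (feOp J i)) : xpow i (-1) * p ∈ W := by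
  obtain ⟨q, hq, rfl⟩ := exists_preimage (T := feOp J i)
    (fun p hp => hW.fop_mem i _ (hW.eop_mem _ _ hp)) hp hT
  rw [feOp_apply, fop_apply, ← mul_assoc, mul_comm (xpow i (-1)), xpow_mul_neg, one_mul]
  exact hW.eop_mem _ _ hq

end AffineSl2

namespace AffineSl2

/-! ### Irreducibility of the polynomial Fock space -/

/-- The coefficient of a monomial as a linear functional. -/
noncomputable def coeffAt (a : Expo) : Laurent →ₗ[ℂ] ℂ :=
  Finsupp.lapply a ∘ₗ (AddMonoidAlgebra.coeffLinearEquiv ℂ).toLinearMap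

theorem coeffAt_apply (a : Expo) (p : Laurent) : coeffAt a p = p.coeff a := rfl

theorem coeffAt_mono (a b : Expo) : coeffAt b (mono a) = if a = b then 1 else 0 := by
  rw [coeffAt_apply]
  split_ifs with h
  · rw [h, coeff_mono_self]
  · exact coeff_mono_of_ne h

theorem mem_monoSpan_support (p : Laurent) : p ∈ monoSpan {a | p.coeff a ≠ 0} := fun _ ha => ha

/-- A linear map that sends monomials to multiples of monomials, injectively on exponents, scales
the coefficients. -/
theorem coeffAt_of_mono {A : Laurent →ₗ[ℂ] Laurent} {g : Expo → ℂ} {σ : Expo → Expo}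
    (hσ : Function.Injective σ) (hA : ∀ a, A (mono a) = g a • mono (σ a)) (a : Expo)
    (p : Laurent) : coeffAt (σ a) (A p) = g a * coeffAt a p := by
  have : coeffAt (σ a) ∘ₗ A = g a • coeffAt a := by
    refine linearMap_ext_mono fun b => ?_
    rw [LinearMap.comp_apply, hA, map_smul, LinearMap.smul_apply, coeffAt_mono, coeffAt_mono]
    by_cases h : b = a
    · rw [h, if_pos rfl, if_pos rfl]
    · rw [if_neg h, if_neg fun h' => h (hσ h'), smul_zero, smul_zero]
  exact LinearMap.congr_fun this p

theorem coeffAt_mono_mul (a b : Expo) (p : Laurent) :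
    coeffAt (b + a) (mono b * p) = coeffAt a p := by
  have := coeffAt_of_mono (A := LinearMap.mulLeft ℂ (mono b)) (g := fun _ => 1)
    (add_right_injective b) (fun a => by rw [LinearMap.mulLeft_apply, ← mono_add, one_smul]) a p
  rwa [one_mul] at this

theorem coeffAt_pderiv (n : ℤ) (a : Expo) (p : Laurent) :
    coeffAt (a + Finsupp.single n (-1)) (pderiv n p) = a n * coeffAt a p :=
  coeffAt_of_mono (A := pderiv n) (g := fun a => a n)
    (add_left_injective (Finsupp.single n (-1))) (fun a => by rw [pderiv_mono, mono_add]; rfl) a p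

theorem eq_smul_one_of_pderiv_eq_zero {p : Laurent} (h : ∀ n, pderiv n p = 0) :
    p = p.coeff 0 • 1 := by
  apply AddMonoidAlgebra.ext
  ext a
  by_cases ha : a = 0
  · rw [ha, ← mono_zero]
    simp [mono]
  · obtain ⟨n, hn⟩ := Finsupp.ne_iff.mp ha
    have h1 := coeffAt_pderiv n a p
    rw [h, map_zero, eq_comm, mul_eq_zero] at h1
    rw [← coeffAt_apply, h1.resolve_left hn, ← mono_zero, ← coeffAt_apply, map_smul, coeffAt_mono,
      if_neg (Ne.symm ha), smul_zero]

/-- Renaming the variables. -/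
noncomputable def rename (g : ℤ → ℤ) : Laurent →ₗ[ℂ] Laurent :=
  ofMono fun a => mono (a.mapDomain g)

theorem rename_mono (g : ℤ → ℤ) (a : Expo) : rename g (mono a) = mono (a.mapDomain g) :=
  ofMono_mono _ _

/-- The exponents of monomials in the variables `xₙ`, `|n| ≤ N`. -/
def rangeExpo (N : ℕ) : Set Expo := {a | ∀ n : ℤ, a n ≠ 0 → |n| ≤ N}

theorem exists_mem_rangeExpo (p : Laurent) : ∃ N, p ∈ monoSpan (rangeExpo N) := by
  induction p using laurent_induction with
  | zero => exact ⟨0, Submodule.zero_mem _⟩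
  | add p q hp hq =>
    obtain ⟨N, hN⟩ := hp
    obtain ⟨M, hM⟩ := hq
    refine ⟨max N M, Submodule.add_mem _ (monoSpan_mono ?_ hN) (monoSpan_mono ?_ hM)⟩
    · exact fun a ha n hn => (ha n hn).trans (by simp)
    · exact fun a ha n hn => (ha n hn).trans (by simp)
  | smul_mono r a =>
    refine ⟨∑ n ∈ a.support, n.natAbs, Submodule.smul_mem _ _ (mono_mem_monoSpan.mpr ?_)⟩
    intro n hn
    rw [Int.abs_eq_natAbs, Int.ofNat_le]
    exact Finset.single_le_sum (f := Int.natAbs) (fun _ _ => Nat.zero_le _) (by simpa using hn)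

theorem pderiv_eq_zero {N : ℕ} {p : Laurent} (hp : p ∈ monoSpan (rangeExpo N)) {n : ℤ}
    (hn : (N : ℤ) < |n|) : pderiv n p = 0 := by
  have : monoSpan (rangeExpo N) ≤ LinearMap.ker (pderiv n) := monoSpan_le fun a ha => by
    have : a n = 0 := by
      by_contra h
      exact absurd (ha n h) (not_le.mpr hn)
    rw [LinearMap.mem_ker, pderiv_mono, this, zero_smul]
  exact this hp

/-- Far away, `quadOp` only depends on the shift up to renaming the new variables. -/
theorem rename_quadOp {N : ℕ} {p : Laurent} (hp : p ∈ monoSpan (rangeExpo N)) {m : ℤ}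
    (hm : (3 * N : ℤ) < m) (m₀ : ℤ) :
    rename (fun n => if |n| ≤ N then n else n - m + m₀) (quadOp m p) = quadOp m₀ p := by
  -- The variables created by `quadOp m` have index n + k + m with |n|, |k| ≤ N, which exceeds N
  -- because m > 3N. They are disjoint from the old variables, so `g` can fix the old ones and shift
  -- the new ones by m₀ - m.
  set g : ℤ → ℤ := fun n => if |n| ≤ N then n else n - m + m₀ with hg
  have hfix : ∀ b ∈ rangeExpo N, b.mapDomain g = b := by
    intro b hb
    conv_rhs => rw [← Finsupp.mapDomain_id (v := b)]
    refine Finsupp.mapDomain_congr fun n hn => ?_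
    rw [hg, id]
    exact if_pos (hb n (by simpa using hn))
  have hsub : ∀ (b : Expo) (n : ℤ), b ∈ rangeExpo N → |n| ≤ N →
      b + Finsupp.single n (-1) ∈ rangeExpo N := by
    intro b n hb hn k hk
    by_cases hkn : n = k
    · rwa [← hkn]
    · exact hb k (by simpa [hkn] using hk)
  have hshift : ∀ (b : Expo) (n : ℤ), b ∈ rangeExpo N → |n| ≤ N →
      rename g (shiftDer (m + n) (mono b)) = shiftDer (m₀ + n) (mono b) := by
    intro b n hb hn
    rw [shiftDer_mono, shiftDer_mono, logDer, logDer, Finsupp.linearCombination_apply,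
      Finsupp.linearCombination_apply, Finsupp.sum, Finsupp.sum, Finset.mul_sum, Finset.mul_sum,
      map_sum]
    refine Finset.sum_congr rfl fun k hk => ?_
    have hkN := hb k (by simpa using hk)
    have hgk : g (k + (m + n)) = k + (m₀ + n) := by
      rw [hg]
      have : ¬ |k + (m + n)| ≤ N := by
        rw [abs_le] at *
        omega
      simp only [this, if_false]
      ring
    rw [mul_smul_comm, mul_smul_comm, map_smul]
    simp only [xpow, ← mono_add]
    rw [rename_mono, ← add_assoc, Finsupp.mapDomain_add, hfix _ (hsub b k hb hkN),
      Finsupp.mapDomain_single, hgk, add_assoc]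
  have : monoSpan (rangeExpo N) ≤ LinearMap.eqLocus (rename g ∘ₗ quadOp m) (quadOp m₀) := by
    refine monoSpan_le fun a ha => ?_
    rw [LinearMap.mem_eqLocus, LinearMap.comp_apply, quadOp_mono, quadOp_mono, Finsupp.sum,
      Finsupp.sum, map_sum]
    refine Finset.sum_congr rfl fun n hn => ?_
    have hnN := ha n (by simpa using hn)
    rw [map_smul, xpow, ← mono_add, hshift _ _ (hsub a n ha hnN) hnN]
  exact this hp

/-- For m large the variable x₋ₘ does not occur in `p`, so eₘ p = 0 reduces to `quadOp m p = 0`.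
Renaming the new variables transfers this to every m₀. Then e₋ₙ p = J ∂ₙ p, and J ≠ 0 makes all
derivatives vanish. -/
theorem eq_smul_one_of_eop_eq_zero {J : ℂ} (hJ : J ≠ 0) {p : Laurent} (h : ∀ m, eop J m p = 0) :
    p = p.coeff 0 • 1 := by
  obtain ⟨N, hN⟩ := exists_mem_rangeExpo p
  have hq : ∀ m₀, quadOp m₀ p = 0 := by
    intro m₀
    have h1 := h (3 * N + 1)
    rw [eop_apply, pderiv_eq_zero hN (by rw [abs_neg, abs_of_nonneg] <;> omega), smul_zero,
      zero_sub, neg_eq_zero] at h1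
    rw [← rename_quadOp hN (m := 3 * N + 1) (by omega), h1, map_zero]
  refine eq_smul_one_of_pderiv_eq_zero fun n => ?_
  have h1 := h (-n)
  rw [eop_apply, hq, sub_zero, neg_neg] at h1
  exact (smul_eq_zero.mp h1).resolve_left hJ

/-- The exponents of polynomials of degree less than `k`. -/
def polyDegExpo (k : ℕ) : Set Expo := {a | a ∈ polyExpo ∧ ∃ j : ℕ, j < k ∧ expoDeg a = j}

theorem exists_nat_expoDeg {a : Expo} (h : a ∈ polyExpo) : ∃ j : ℕ, expoDeg a = j := by
  rw [expoDeg, Finsupp.linearCombination_apply, Finsupp.sum]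
  refine Finset.sum_induction _ (fun r : ℂ => ∃ j : ℕ, r = j) ?_ ⟨0, by simp⟩ fun n hn => ?_
  · rintro _ _ ⟨j, rfl⟩ ⟨k, rfl⟩
    exact ⟨j + k, by simp⟩
  · rw [smul_eq_mul, mul_one]
    exact h n

theorem eop_mono_mem (J : ℂ) {T : Set Expo} {m : ℤ} {a : Expo}
    (h1 : a (-m) ≠ 0 → a + Finsupp.single (-m) (-1) ∈ T)
    (h2 : ∀ n k, a n ≠ 0 → (a + Finsupp.single n (-1) : Expo) k ≠ 0 →
      a + Finsupp.single n (-1) + Finsupp.single k (-1) + Finsupp.single (k + (m + n)) 1 ∈ T) :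
    eop J m (mono a) ∈ monoSpan T := by
  refine Submodule.sub_mem _ (Submodule.smul_mem _ _ ?_) (quadOp_mono_mem h2)
  rw [pderiv_mono]
  by_cases h : a (-m) = 0
  · rw [h, zero_smul]; exact Submodule.zero_mem _
  · rw [xpow, ← mono_add]
    exact Submodule.smul_mem _ _ (mono_mem_monoSpan.mpr (h1 h))

theorem eop_mem_polyDegExpo {J : ℂ} {m : ℤ} {k : ℕ} {p : Laurent}
    (hp : p ∈ monoSpan (polyDegExpo (k + 1))) : eop J m p ∈ monoSpan (polyDegExpo k) := by
  have key : ∀ a b : Expo, a ∈ polyDegExpo (k + 1) → b ∈ polyExpo → expoDeg b = expoDeg a - 1 →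
      b ∈ polyDegExpo k := by
    rintro a b ⟨_, j, hj, hja⟩ hb hdeg
    obtain ⟨l, hl⟩ := exists_nat_expoDeg hb
    refine ⟨hb, l, ?_, hl⟩
    have : ((l + 1 : ℕ) : ℂ) = (j : ℕ) := by push_cast; linear_combination -hl + hdeg + hja
    have := Nat.cast_injective this
    omega
  have hS := isAdmissible_polyExpo
  refine map_mem_monoSpan (fun a ha => eop_mono_mem J (fun h => ?_) fun n l hn hl => ?_) hp
  · exact key a _ ha (hS.sub a ha.1 _ h) (by rw [map_add, expoDeg_single]; ring)
  · exact key a _ ha (hS.add _ (hS.sub _ (hS.sub a ha.1 _ hn) _ hl) _)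
      (by simp only [map_add, expoDeg_single]; ring)

theorem exists_mem_polyDegExpo {p : Laurent} (hp : p ∈ monoSpan polyExpo) :
    ∃ k, p ∈ monoSpan (polyDegExpo k) := by
  have hmono : ∀ {j k : ℕ}, j ≤ k → polyDegExpo j ⊆ polyDegExpo k :=
    fun h a ⟨h1, l, h2, h3⟩ => ⟨h1, l, h2.trans_le h, h3⟩
  let W : Submodule ℂ Laurent :=
    { carrier := {p | ∃ k, p ∈ monoSpan (polyDegExpo k)}
      add_mem' := by
        rintro p q ⟨j, hj⟩ ⟨k, hk⟩
        exact ⟨max j k, Submodule.add_mem _ (monoSpan_mono (hmono (le_max_left _ _)) hj)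
          (monoSpan_mono (hmono (le_max_right _ _)) hk)⟩
      zero_mem' := ⟨0, Submodule.zero_mem _⟩
      smul_mem' := fun r p ⟨k, hk⟩ => ⟨k, Submodule.smul_mem _ _ hk⟩ }
  refine (monoSpan_le (W := W) fun a ha => ?_) hp
  obtain ⟨j, hj⟩ := exists_nat_expoDeg ha
  exact ⟨j + 1, mono_mem_monoSpan.mpr ⟨ha, j, by omega, hj⟩⟩

/-- Induction on the degree: a nonzero polynomial killed by every eₘ is constant, and otherwise some
eₘ yields a nonzero polynomial of smaller degree in `W`. -/
theorem one_mem_of_isStable {J : ℂ} (hJ : J ≠ 0) {W : Submodule ℂ Laurent} (hW : IsStable J W)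
    {p : Laurent} (hpW : p ∈ W) (hp : p ∈ monoSpan polyExpo) (h0 : p ≠ 0) : 1 ∈ W := by
  obtain ⟨k, hk⟩ := exists_mem_polyDegExpo hp
  induction k generalizing p with
  | zero =>
    refine absurd ?_ h0
    apply AddMonoidAlgebra.ext
    ext a
    by_contra h
    obtain ⟨_, j, hj, _⟩ := hk a h
    omega
  | succ k ih =>
    by_cases h : ∀ m, eop J m p = 0
    · have h1 := eq_smul_one_of_eop_eq_zero hJ h
      have h2 : p.coeff 0 ≠ 0 := fun h3 => h0 (by rw [h1, h3, zero_smul])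
      rw [h1] at hpW
      exact (W.smul_mem_iff h2).mp hpW
    · push Not at h
      obtain ⟨m, hm⟩ := h
      exact ih (hW.eop_mem m p hpW) (isAdmissible_polyExpo.eop_mem J m hp) hm
        (eop_mem_polyDegExpo hk)

theorem mono_mul_mem {J : ℂ} {W : Submodule ℂ Laurent} (hW : IsStable J W) {a : Expo}
    (ha : a ∈ polyExpo) {p : Laurent} (hp : p ∈ W) : mono a * p ∈ W := by
  induction a using Finsupp.induction with
  | zero => rwa [mono_zero, one_mul]
  | single_add n r b hn _ ih =>
    have hbn : b n = 0 := by simpa using hn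
    have hb : b ∈ polyExpo := by
      intro k
      by_cases hk : n = k
      · exact ⟨0, by rw [← hk, hbn, Nat.cast_zero]⟩
      · obtain ⟨j, hj⟩ := ha k
        exact ⟨j, by simpa [hk] using hj⟩
    obtain ⟨j, hj⟩ := ha n
    rw [Finsupp.add_apply, Finsupp.single_eq_same, hbn, add_zero] at hj
    rw [mono_add, mul_assoc, hj]
    change xpow n j * _ ∈ W
    rw [xpow_natCast]
    have key : ∀ (j : ℕ), ∀ q ∈ W, xpow n 1 ^ j * q ∈ W := by
      intro j
      induction j with
      | zero => intro q hq; simpa using hq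
      | succ j ih => intro q hq; rw [pow_succ, mul_assoc]; exact ih _ (hW.fop_mem n q hq)
    exact key j _ (ih hb)

end AffineSl2

namespace AffineSl2

/-! ### Irreducibility of localized Fock spaces -/

theorem xpow_neg_natCast_mul_mem {i : ℤ} {W : Submodule ℂ Laurent}
    (hinv : ∀ p ∈ W, xpow i (-1) * p ∈ W) (k : ℕ) {p : Laurent} (hp : p ∈ W) :
    xpow i (-k) * p ∈ W := by
  induction k with
  | zero => simpa [xpow_zero] using hp
  | succ k ih =>
    rw [Nat.cast_succ, neg_add, add_comm, xpow_add, mul_assoc]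
    exact hinv _ ih

theorem xpow_natCast_mul_mem {J : ℂ} {i : ℤ} {W : Submodule ℂ Laurent} (hW : IsStable J W)
    (k : ℕ) {p : Laurent} (hp : p ∈ W) : xpow i k * p ∈ W := by
  induction k with
  | zero => simpa [xpow_zero] using hp
  | succ k ih =>
    rw [Nat.cast_succ, add_comm, xpow_add, mul_assoc]
    exact hW.fop_mem i _ ih

theorem erase_mem_polyExpo {i : ℤ} {a : Expo} (h : ∀ n, n ≠ i → ∃ k : ℕ, a n = k) :
    a.erase i ∈ polyExpo := by
  intro n
  by_cases hn : n = i
  · exact ⟨0, by rw [hn, Finsupp.erase_same, Nat.cast_zero]⟩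
  · rw [Finsupp.erase_ne hn]
    exact h n hn

theorem mem_polyExpo_of_twistExpo {i : ℤ} {z : ℂ} {a : Expo} (ha : a ∈ twistExpo i z)
    (h : ∃ k : ℕ, a i = k) : a ∈ polyExpo := by
  intro n
  by_cases hn : n = i
  · rwa [hn]
  · exact ha.1 n hn

/-- Clearing denominators. Asking for all large exponents, not just one, makes the condition
additive in `p`, so that it can be tested on monomials. -/
theorem exists_xpow_mul_mem_poly {i : ℤ} {p : Laurent} (hp : p ∈ monoSpan (twistExpo i 0)) :
    ∃ N : ℕ, ∀ M : ℕ, N ≤ M → xpow i M * p ∈ monoSpan polyExpo := by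
  let W : Submodule ℂ Laurent :=
    { carrier := {p | ∃ N : ℕ, ∀ M : ℕ, N ≤ M → xpow i M * p ∈ monoSpan polyExpo}
      add_mem' := by
        rintro p q ⟨j, hj⟩ ⟨k, hk⟩
        refine ⟨max j k, fun M hM => ?_⟩
        rw [mul_add]
        exact Submodule.add_mem _ (hj M (by omega)) (hk M (by omega))
      zero_mem' := ⟨0, fun M _ => by rw [mul_zero]; exact Submodule.zero_mem _⟩
      smul_mem' := fun r p ⟨k, hk⟩ => ⟨k, fun M hM => by
        rw [mul_smul_comm]; exact Submodule.smul_mem _ _ (hk M hM)⟩ }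
  refine (monoSpan_le (W := W) fun a ha => ?_) hp
  obtain ⟨k, hk⟩ := ha.2
  refine ⟨k.natAbs, fun M hM => ?_⟩
  rw [mul_comm, xpow, ← mono_add]
  refine mono_mem_monoSpan.mpr (mem_polyExpo_of_twistExpo (add_single_mem_twistExpo ha M) ?_)
  refine ⟨(k + M).toNat, ?_⟩
  rw [Finsupp.add_apply, hk, Finsupp.single_eq_same, zero_add,
    ← Int.cast_natCast (R := ℂ) (k + M).toNat, Int.toNat_of_nonneg (by omega)]
  push_cast; ring

theorem monoSpan_twistExpo_le {J : ℂ} {i : ℤ} {W : Submodule ℂ Laurent} (hW : IsStable J W)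
    (hinv : ∀ k : ℕ, xpow i (-k) ∈ W) : monoSpan (twistExpo i 0) ≤ W := by
  refine monoSpan_le fun a ha => ?_
  obtain ⟨k, hk⟩ := ha.2
  have h1 : xpow i k ∈ W := by
    obtain ⟨n, rfl | rfl⟩ := k.eq_nat_or_neg
    · have := xpow_natCast_mul_mem (i := i) hW n (hinv 0)
      rw [Nat.cast_zero, neg_zero, xpow_zero, mul_one] at this
      exact_mod_cast this
    · rw [Int.cast_neg, Int.cast_natCast]
      exact hinv n
  rw [mono_eq_xpow_mul i a, hk, zero_add, mul_comm]
  exact mono_mul_mem hW (erase_mem_polyExpo ha.1) h1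

/-- After clearing denominators the polynomial case puts 1 into `W`; division by xᵢ then gives all
its negative powers, and multiplication by the variables gives the rest. -/
theorem eq_top_of_inv {J : ℂ} (hJ : J ≠ 0) {i : ℤ} {W : Submodule ℂ Laurent} (hW : IsStable J W)
    (hinv : ∀ p ∈ W, xpow i (-1) * p ∈ W) {p : Laurent} (hpW : p ∈ W)
    (hp : p ∈ monoSpan (twistExpo i 0)) (h0 : p ≠ 0) : monoSpan (twistExpo i 0) ≤ W := by
  obtain ⟨N, hN⟩ := exists_xpow_mul_mem_poly hp
  have h1 : xpow i N * p ≠ 0 := by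
    intro h
    apply h0
    rw [← one_mul p, ← xpow_mul_neg i N, mul_comm (xpow i N), mul_assoc, h, mul_zero]
  have h2 := one_mem_of_isStable hJ hW (xpow_natCast_mul_mem hW N hpW) (hN N le_rfl) h1
  refine monoSpan_twistExpo_le hW fun k => ?_
  simpa using xpow_neg_natCast_mul_mem hinv k h2

/-- Removal of a twist. Conjugation by xᵢ ^ r changes the operators only by terms built from h's,
multiplications and powers of xᵢ⁻¹, and `W` absorbs these because it is closed under division by xᵢ.
-/
theorem isStable_comap_xpow {J : ℂ} {i : ℤ} {W : Submodule ℂ Laurent} (hW : IsStable J W)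
    (hinv : ∀ p ∈ W, xpow i (-1) * p ∈ W) (r : ℂ) :
    IsStable J (W.comap (LinearMap.mulLeft ℂ (xpow i r))) := by
  have hf : ∀ n p, xpow i r * p ∈ W → xpow i r * (xpow n 1 * p) ∈ W := fun n p hp => by
    rw [mul_left_comm]; exact hW.fop_mem n _ hp
  have hu : ∀ p, xpow i r * p ∈ W → xpow i r * (xpow i (-1) * p) ∈ W := fun p hp => by
    rw [mul_left_comm]; exact hinv _ hp
  have hh : ∀ m p, xpow i r * p ∈ W → xpow i r * hop J m p ∈ W := fun m p hp => by
    have h1 := hW.hop_mem m _ hp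
    rw [hop_xpow_mul, mul_sub, mul_smul_comm] at h1
    refine (Submodule.sub_mem_iff_left _ (W.smul_mem _ ?_)).mp h1
    rw [mul_assoc (xpow i (-1))]
    exact hu _ (hf _ _ hp)
  refine ⟨fun m p hp => ?_, fun m p hp => hf m p hp, fun m p hp => hh m p hp⟩
  have h1 := hW.eop_mem m _ hp
  rw [LinearMap.mulLeft_apply, eop_xpow_mul, mul_sub, mul_add, mul_smul_comm, mul_smul_comm] at h1
  refine (Submodule.add_mem_iff_left _ (W.smul_mem r ?_)).mp
    ((Submodule.sub_mem_iff_left _ (W.smul_mem _ ?_)).mp h1)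
  · exact hu _ (hh _ _ hp)
  · rw [mul_assoc, mul_assoc]
    exact hu _ (hu _ (hf _ _ hp))

/-- A nonzero subrepresentation of a generic twisted localization is everything. -/
theorem monoSpan_twistExpo_le_of_generic {J : ℂ} (hJ : J ≠ 0) {i : ℤ} {z : ℂ}
    (hz : ¬ IsInteger z) (hzJ : ¬ IsInteger (z - J)) {W : Submodule ℂ Laurent}
    (hW : IsStable J W) (hle : W ≤ monoSpan (twistExpo i z)) {p : Laurent} (hp : p ∈ W)
    (h0 : p ≠ 0) : monoSpan (twistExpo i z) ≤ W := by
  -- The total degree D lies in z + ℤ, so a vanishing factor of (D - l)(J + 1 - D - l) would make z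
  -- or z - J an integer.
  have hinvPart : monoSpan (twistExpo i z) ≤ invPart (feOp J i) := by
    refine monoSpan_le fun a ha => ?_
    obtain ⟨j, hj⟩ := exists_nat_expoDeg_sub ha.1
    obtain ⟨k, hk⟩ := ha.2
    refine monoSpan_boundedExpo_le (D := expoDeg a) (k := j + 1) (fun l _ => ?_)
      (mono_mem_monoSpan.mpr ⟨ha.1, rfl, j, by omega, hj⟩)
    refine mul_ne_zero (fun h => hz ⟨l - k - j, ?_⟩) (fun h => hzJ ⟨1 - k - j - l, ?_⟩)
    · push_cast
      linear_combination h - hk + hj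
    · push_cast
      linear_combination -h - hk + hj
  have hinv : ∀ p ∈ W, xpow i (-1) * p ∈ W := fun p hp => inv_mul_mem hW hp (hinvPart (hle hp))
  -- Division by xᵢ ^ z carries `W` to a stable subspace of the untwisted localization.
  have h1 := eq_top_of_inv hJ (i := i) (isStable_comap_xpow hW hinv z) (fun p hp => by
      rw [Submodule.mem_comap, LinearMap.mulLeft_apply, mul_left_comm]; exact hinv _ hp)
    (p := xpow i (-z) * p) (by
      rw [Submodule.mem_comap, LinearMap.mulLeft_apply, ← mul_assoc, xpow_mul_neg, one_mul]
      exact hp)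
    (by simpa using xpow_mul_mem (hle hp) (-z)) (fun h => h0 (by
      have := congrArg (xpow i z * ·) h
      simpa only [← mul_assoc, xpow_mul_neg, one_mul, mul_zero] using this))
  intro q hq
  have h2 := h1 (show xpow i (-z) * q ∈ _ by simpa using xpow_mul_mem hq (-z))
  rwa [Submodule.mem_comap, LinearMap.mulLeft_apply, ← mul_assoc, xpow_mul_neg, one_mul] at h2

/-! ### Leading terms in `xᵢ` -/

/-- The exponents of xᵢ are complex; their real parts provide the order needed to speak of leading
terms. -/
theorem shiftDer_erase_mem (i m : ℤ) (a : Expo) :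
    shiftDer m (mono (a.erase i)) ∈ monoSpan {b : Expo | 0 ≤ (b i).re} := by
  refine shiftDer_mono_mem fun n hn => ?_
  have hni : n ≠ i := by rintro rfl; simp at hn
  by_cases h : n + m = i <;> simp [hni, h]

theorem quadOp_erase_mem_re (i m : ℤ) (a : Expo) :
    quadOp m (mono (a.erase i)) ∈ monoSpan {b : Expo | 0 ≤ (b i).re} := by
  refine quadOp_mono_mem fun n k hn hk => ?_
  have hni : n ≠ i := by rintro rfl; simp at hn
  have hki : k ≠ i := by rintro rfl; simp [hni] at hk
  by_cases h : k + (m + n) = i <;> simp [hni, hki, h]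

theorem xpow_mul_mem_re {i : ℤ} {s : ℝ} {p : Laurent}
    (hp : p ∈ monoSpan {b : Expo | s ≤ (b i).re}) (r : ℂ) :
    xpow i r * p ∈ monoSpan {b : Expo | s + r.re ≤ (b i).re} := by
  refine map_mem_monoSpan (A := LinearMap.mulLeft ℂ (xpow i r)) (fun a ha => ?_) hp
  rw [LinearMap.mulLeft_apply, mul_comm, xpow, ← mono_add]
  refine mono_mem_monoSpan.mpr ?_
  simpa using ha

theorem monoSpan_re_mono (i : ℤ) {s t : ℝ} (h : t ≤ s) :
    monoSpan {b : Expo | s ≤ (b i).re} ≤ monoSpan {b : Expo | t ≤ (b i).re} :=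
  monoSpan_mono fun _ ha => h.trans ha

/-- The part of `eₘ` that lowers the exponent of `xᵢ` by two. -/
theorem eop_mono_add_mem (J : ℂ) (i m : ℤ) (a : Expo) :
    eop J m (mono a) + (a i * (a i - 1)) •
      mono (a + (Finsupp.single i (-2) + Finsupp.single (2 * i + m) 1)) ∈
      monoSpan {b : Expo | (a i).re - 1 ≤ (b i).re} := by
  have h1 : mono (a + (Finsupp.single i (-2) + Finsupp.single (2 * i + m) 1)) =
      xpow i (a i) * (xpow i (-1) * xpow i (-1) * xpow (2 * i + m) 1 * mono (a.erase i)) := by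
    rw [mono_add, mono_eq_xpow_mul i a, mono_add, show (-2 : ℂ) = -1 + -1 by norm_num,
      Finsupp.single_add, mono_add]
    simp only [xpow]
    ring
  have h2 : eop J m (mono a) + (a i * (a i - 1)) •
      mono (a + (Finsupp.single i (-2) + Finsupp.single (2 * i + m) 1)) =
      xpow i (a i) * eop J m (mono (a.erase i)) +
        a i • (xpow i (-1) * (xpow i (a i) * hop J (m + i) (mono (a.erase i)))) := by
    rw [h1, mono_eq_xpow_mul i a, eop_xpow_mul]
    simp only [Algebra.smul_def]
    ring
  have h0 : mono (a.erase i) ∈ monoSpan {b : Expo | 0 ≤ (b i).re} :=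
    mono_mem_monoSpan.mpr (by simp)
  -- The bound -1 is cruder than the truth: the monomial with xᵢ⁻¹, arising for -m = i, has
  -- coefficient zero. It is all that is needed.
  have h3 : eop J m (mono (a.erase i)) ∈ monoSpan {b : Expo | -1 ≤ (b i).re} := by
    refine Submodule.sub_mem _ (Submodule.smul_mem _ _ ?_)
      (monoSpan_re_mono i (by norm_num) (quadOp_erase_mem_re i m a))
    rw [pderiv_mono, xpow, ← mono_add]
    refine Submodule.smul_mem _ _ (mono_mem_monoSpan.mpr ?_)
    by_cases h : -m = i <;> simp [h]
  have h4 : hop J (m + i) (mono (a.erase i)) ∈ monoSpan {b : Expo | 0 ≤ (b i).re} :=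
    Submodule.sub_mem _ (Submodule.smul_mem _ _ h0)
      (Submodule.smul_mem _ _ (shiftDer_erase_mem i _ a))
  rw [h2]
  refine Submodule.add_mem _ (monoSpan_re_mono i ?_ (xpow_mul_mem_re h3 (a i)))
    (Submodule.smul_mem _ _ (monoSpan_re_mono i ?_
      (xpow_mul_mem_re (xpow_mul_mem_re h4 (a i)) (-1))))
  · linarith
  · simp

/-- The part of `e₋ᵢ` that lowers the exponent of `xᵢ` by one. -/
theorem eop_neg_mono_sub_mem (J : ℂ) (i : ℤ) (a : Expo) :
    eop J (-i) (mono a) - (a i * (J + 1 + a i - 2 * expoDeg a)) •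
      mono (a + Finsupp.single i (-1)) ∈ monoSpan {b : Expo | (a i).re ≤ (b i).re} := by
  have h1 : eop J (-i) (mono a) - (a i * (J + 1 + a i - 2 * expoDeg a)) •
      mono (a + Finsupp.single i (-1)) = -(xpow i (a i) * quadOp (-i) (mono (a.erase i))) := by
    have h2 := feOp_mono J i a
    rw [feOp_apply, fop_apply, xpow_add] at h2
    have h3 := xpow_mul_neg i 1
    rw [mono_add]
    change _ - _ • (_ * xpow i (-1)) = _
    simp only [Algebra.smul_def] at h2 ⊢
    linear_combination xpow i (-1) * h2 + (-eop J (-i) (mono a) -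
      xpow i (a i) * quadOp (-i) (mono (a.erase i))) * h3
  rw [h1]
  refine Submodule.neg_mem _ (monoSpan_re_mono i ?_
    (xpow_mul_mem_re (quadOp_erase_mem_re i _ a) (a i)))
  linarith

end AffineSl2

namespace AffineSl2

open Classical in
/-- Leading term argument for injectivity modulo a span of monomials. -/
theorem not_mem_of_leading {i : ℤ} {A : Laurent →ₗ[ℂ] Laurent} {g : Expo → ℂ} {τ : Expo} {t : ℝ}
    (hτ : (τ i).re < t)
    (hA : ∀ a, A (mono a) - g a • mono (a + τ) ∈ monoSpan {b : Expo | (a i).re + t ≤ (b i).re})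
    {S' : Set Expo} (hS' : ∀ p ∈ monoSpan S', A p ∈ monoSpan S') {p : Laurent}
    (hp : p ∉ monoSpan S')
    (hg : ∀ a, p.coeff a ≠ 0 → a ∉ S' → g a ≠ 0 ∧ a + τ ∉ S') : A p ∉ monoSpan S' := by
  have hne : (p.coeff.support.filter fun a => a ∉ S').Nonempty := by
    rw [mem_monoSpan] at hp
    push Not at hp
    obtain ⟨a, ha, ha'⟩ := hp
    exact ⟨a, by simp [ha, ha']⟩
  -- Among the exponents of `p` outside `S'` take one whose xᵢ-exponent has least real part. Its
  -- leading term a + τ cannot be cancelled: the remainder terms of the competing exponents lie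
  -- strictly higher, since Re τᵢ < t.
  obtain ⟨a, ha, hmin⟩ := Finset.exists_min_image _ (fun a : Expo => (a i).re) hne
  simp only [Finset.mem_filter, Finsupp.mem_support_iff] at ha hmin
  obtain ⟨hga, haτ⟩ := hg a ha.1 ha.2
  have hB : ∀ b, ofMono (fun a => g a • mono (a + τ)) (mono b) = g b • mono (b + τ) :=
    fun b => ofMono_mono _ b
  have h1 := coeffAt_of_mono (A := ofMono fun a => g a • mono (a + τ)) (g := g)
    (add_left_injective τ) hB a p
  have h2 : monoSpan {a | p.coeff a ≠ 0} ≤ LinearMap.eqLocus (coeffAt (a + τ) ∘ₗ A)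
      (coeffAt (a + τ) ∘ₗ ofMono fun a => g a • mono (a + τ)) := by
    refine monoSpan_le fun b hb => ?_
    rw [LinearMap.mem_eqLocus, LinearMap.comp_apply, LinearMap.comp_apply, hB]
    by_cases hbS : b ∈ S'
    -- Monomials inside `S'` are sent into the span of `S'`, and a + τ is not in `S'`.
    · have h3 : coeffAt (a + τ) (A (mono b)) = 0 := by
        by_contra h
        exact haτ (hS' _ (mono_mem_monoSpan.mpr hbS) _ h)
      have h4 : ¬ b + τ = a + τ := fun h => ha.2 (add_left_injective τ h ▸ hbS)
      rw [h3, map_smul, coeffAt_mono, if_neg h4, smul_zero]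
    · rw [← sub_eq_zero, ← map_sub]
      by_contra h
      have h3 := hA b _ h
      have h4 := hmin b ⟨hb, hbS⟩
      simp only [Set.mem_ofPred_eq, Finsupp.add_apply, Complex.add_re] at h3
      linarith
  have h3 := h2 (mem_monoSpan_support p)
  rw [LinearMap.mem_eqLocus, LinearMap.comp_apply, LinearMap.comp_apply, h1] at h3
  intro h
  exact haτ (h _ (by rw [← coeffAt_apply, h3]; exact mul_ne_zero hga ha.1))

/-- For m ≠ -i the leading term is -aᵢ(aᵢ - 1) xᵢ⁻² x₂ᵢ₊ₘ. For m = -i the new variable is xᵢ itself,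
so this term lowers the xᵢ-exponent only by one and merges with the first order terms into the
diagonal entry of `feOp`. -/
theorem eop_not_mem {J : ℂ} {i : ℤ} (m : ℤ) {S' : Set Expo} (hS' : IsAdmissible S') {p : Laurent}
    (hp : p ∉ monoSpan S')
    (h : ∀ a, p.coeff a ≠ 0 → a ∉ S' →
      (m = -i → J + 1 + a i - 2 * expoDeg a ≠ 0) ∧ a i ≠ 0 ∧ a i ≠ 1 ∧
        ∀ b : Expo, b i = a i - 1 ∨ b i = a i - 2 → b ∉ S') :
    eop J m p ∉ monoSpan S' := by
  by_cases hm : m = -i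
  · subst hm
    refine not_mem_of_leading (i := i) (t := 0)
      (g := fun a => a i * (J + 1 + a i - 2 * expoDeg a)) (τ := Finsupp.single i (-1)) (by simp)
      (fun a => by rw [add_zero]; exact eop_neg_mono_sub_mem J i a)
      (fun q hq => hS'.eop_mem J _ hq) hp fun a ha haS => ?_
    obtain ⟨h1, h2, h3, h4⟩ := h a ha haS
    exact ⟨mul_ne_zero h2 (h1 rfl), h4 _ (Or.inl (by simp; ring))⟩
  · have hmi : 2 * i + m ≠ i := by omega
    refine not_mem_of_leading (i := i) (t := -1) (g := fun a => -(a i * (a i - 1)))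
      (τ := Finsupp.single i (-2) + Finsupp.single (2 * i + m) 1) (by simp [hmi])
      (fun a => by
        rw [neg_smul, sub_neg_eq_add, ← sub_eq_add_neg]; exact eop_mono_add_mem J i m a)
      (fun q hq => hS'.eop_mem J _ hq) hp fun a ha haS => ?_
    obtain ⟨h1, h2, h3, h4⟩ := h a ha haS
    exact ⟨neg_ne_zero.mpr (mul_ne_zero h2 (sub_ne_zero.mpr h3)),
      h4 _ (Or.inr (by simp [hmi]; ring))⟩

theorem fop_not_mem {n i : ℤ} {z : ℂ} {S' : Set Expo}
    (hS' : ∀ a ∈ twistExpo i z, a + Finsupp.single n 1 ∈ S' → a ∈ S') {p : Laurent}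
    (hp : p ∈ monoSpan (twistExpo i z)) (hp' : p ∉ monoSpan S') : fop n p ∉ monoSpan S' := by
  intro h
  refine hp' fun a ha => hS' a (hp a ha) ?_
  have h1 := coeffAt_mono_mul a (Finsupp.single n 1) p
  rw [add_comm]
  exact h _ (by rw [← coeffAt_apply]; erw [h1]; exact ha)

/-! ### The quotient of the localization -/

theorem exists_neg_of_not_mem_polyExpo {i : ℤ} {a : Expo} (ha : a ∈ twistExpo i 0)
    (h : a ∉ polyExpo) : ∃ k : ℕ, a i = -(k + 1) := by
  obtain ⟨k, hk⟩ := ha.2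
  have hneg : k < 0 := by
    by_contra hk0
    refine h (mem_polyExpo_of_twistExpo ha ⟨k.toNat, ?_⟩)
    rw [hk, zero_add, ← Int.cast_natCast (R := ℂ) k.toNat, Int.toNat_of_nonneg (by omega)]
  refine ⟨(-k - 1).toNat, ?_⟩
  rw [hk, zero_add, ← Int.cast_natCast (R := ℂ) (-k - 1).toNat, Int.toNat_of_nonneg (by omega)]
  push_cast; ring

theorem not_mem_polyExpo_of_neg {i : ℤ} {a : Expo} {k : ℕ} (h : a i = -(k + 1)) :
    a ∉ polyExpo := by
  intro ha
  obtain ⟨j, hj⟩ := ha i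
  have : ((j + k + 1 : ℕ) : ℂ) = (0 : ℕ) := by push_cast; linear_combination h - hj
  have := Nat.cast_injective this
  omega

/-- Nonpolynomial exponents have aᵢ a negative integer, hence neither 0 nor 1, and lowering aᵢ keeps
it negative. The value of J matters only for m = -i, where a zero of the leading coefficient would
force J to be an integer. -/
theorem eop_not_mem_poly {J : ℂ} {i : ℤ} (m : ℤ) (hJ : m = -i → ¬ IsInteger J) {p : Laurent}
    (hp : p ∈ monoSpan (twistExpo i 0)) (hp' : p ∉ monoSpan polyExpo) :
    eop J m p ∉ monoSpan polyExpo := by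
  refine eop_not_mem (i := i) m isAdmissible_polyExpo hp' fun a ha haS => ?_
  obtain ⟨k, hk⟩ := exists_neg_of_not_mem_polyExpo (hp a ha) haS
  obtain ⟨j, hj⟩ := exists_nat_expoDeg_sub (hp a ha).1
  refine ⟨fun hm h => hJ hm ⟨2 * j - 1 - k - 1, ?_⟩, ?_, ?_, ?_⟩
  · push_cast
    linear_combination h - hk - 2 * (hj - hk)
  · rw [hk, neg_ne_zero]
    exact Nat.cast_add_one_ne_zero k
  · intro h
    have : ((k + 2 : ℕ) : ℂ) = (0 : ℕ) := by push_cast; linear_combination hk - h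
    have := Nat.cast_injective this
    omega
  · rintro b (hb | hb)
    · exact not_mem_polyExpo_of_neg (i := i) (k := k + 1) (by rw [hb, hk]; push_cast; ring)
    · exact not_mem_polyExpo_of_neg (i := i) (k := k + 2) (by rw [hb, hk]; push_cast; ring)

/-- The exponents of the localization of degree less than `k`. -/
def degTwistExpo (i : ℤ) (k : ℤ) : Set Expo :=
  {a | a ∈ twistExpo i 0 ∧ ∃ j : ℤ, j < k ∧ expoDeg a = j}

theorem eop_mem_degTwistExpo {J : ℂ} {i m k : ℤ} {p : Laurent}
    (hp : p ∈ monoSpan (degTwistExpo i k)) : eop J m p ∈ monoSpan (degTwistExpo i (k - 1)) := by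
  have key : ∀ a b : Expo, a ∈ degTwistExpo i k → b ∈ twistExpo i 0 →
      expoDeg b = expoDeg a - 1 → b ∈ degTwistExpo i (k - 1) := by
    rintro a b ⟨_, j, hj, hja⟩ hb hdeg
    exact ⟨hb, j - 1, by omega, by rw [hdeg, hja]; push_cast; ring⟩
  have hS := isAdmissible_twistExpo i 0
  refine map_mem_monoSpan (fun a ha => eop_mono_mem J (fun h => ?_) fun n l hn hl => ?_) hp
  · exact key a _ ha (hS.sub a ha.1 _ h) (by rw [map_add, expoDeg_single]; ring)
  · exact key a _ ha (hS.add _ (hS.sub _ (hS.sub a ha.1 _ hn) _ hl) _)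
      (by simp only [map_add, expoDeg_single]; ring)

theorem exists_mem_degTwistExpo {i : ℤ} {p : Laurent} (hp : p ∈ monoSpan (twistExpo i 0)) :
    ∃ k : ℕ, p ∈ monoSpan (degTwistExpo i k) := by
  have hmono : ∀ {j k : ℕ}, j ≤ k → degTwistExpo i j ⊆ degTwistExpo i k :=
    fun h a ⟨h1, l, h2, h3⟩ => ⟨h1, l, by omega, h3⟩
  let W : Submodule ℂ Laurent :=
    { carrier := {p | ∃ k : ℕ, p ∈ monoSpan (degTwistExpo i k)}
      add_mem' := by
        rintro p q ⟨j, hj⟩ ⟨k, hk⟩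
        exact ⟨max j k, Submodule.add_mem _ (monoSpan_mono (hmono (le_max_left _ _)) hj)
          (monoSpan_mono (hmono (le_max_right _ _)) hk)⟩
      zero_mem' := ⟨0, Submodule.zero_mem _⟩
      smul_mem' := fun r p ⟨k, hk⟩ => ⟨k, Submodule.smul_mem _ _ hk⟩ }
  refine (monoSpan_le (W := W) fun a ha => ?_) hp
  obtain ⟨j, hj⟩ := exists_nat_expoDeg_sub ha.1
  obtain ⟨k, hk⟩ := ha.2
  refine ⟨(k + j).toNat + 1, mono_mem_monoSpan.mpr ⟨ha, k + j, by omega, ?_⟩⟩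
  push_cast
  linear_combination hk - hj

theorem exists_neg_degree_of_not_mem {J : ℂ} {i : ℤ} {W : Submodule ℂ Laurent}
    (hW : IsStable J W) {p : Laurent} (hpW : p ∈ W) (hp : p ∈ monoSpan (twistExpo i 0))
    (hp' : p ∉ monoSpan polyExpo) :
    ∃ q ∈ W, q ∈ monoSpan (degTwistExpo i 0) ∧ q ∉ monoSpan polyExpo := by
  obtain ⟨k, hk⟩ := exists_mem_degTwistExpo hp
  induction k generalizing p with
  | zero => exact ⟨p, hpW, hk, hp'⟩
  | succ k ih =>
    -- Any index other than -i would do: e₋ᵢ₊₁ is injective modulo polynomials for every J, and it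
    -- lowers the total degree by one.
    refine ih (hW.eop_mem (-i + 1) p hpW) ((isAdmissible_twistExpo i 0).eop_mem J _ hp)
      (eop_not_mem_poly _ (by omega) hp hp') ?_
    have := eop_mem_degTwistExpo (J := J) (m := -i + 1) hk
    simpa using this

/-- For negative integral D the factor D - l never vanishes, and J + 1 - D - l vanishes only for
integral J. -/
theorem degTwistExpo_zero_le_invPart {J : ℂ} (hJ : ¬ IsInteger J) (i : ℤ) :
    monoSpan (degTwistExpo i 0) ≤ invPart (feOp J i) := by
  refine monoSpan_le fun a ⟨ha, d, hd, hda⟩ => ?_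
  obtain ⟨j, hj⟩ := exists_nat_expoDeg_sub ha.1
  refine monoSpan_boundedExpo_le (D := expoDeg a) (k := j + 1) (fun l _ => ?_)
    (mono_mem_monoSpan.mpr ⟨ha.1, rfl, j, by omega, hj⟩)
  refine mul_ne_zero (fun h => ?_) (fun h => hJ ⟨d + l - 1, ?_⟩)
  · rw [hda] at h
    have : ((d - l : ℤ) : ℂ) = (0 : ℤ) := by push_cast; exact h
    have := Int.cast_injective this
    omega
  · push_cast
    linear_combination h + hda

/-- The quotient of the localization by the polynomials is irreducible if `J` is not an integer. -/
theorem monoSpan_twistExpo_le_of_lt {J : ℂ} (hJ : ¬ IsInteger J) {i : ℤ}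
    {W : Submodule ℂ Laurent} (hW : IsStable J W) {p : Laurent} (hpW : p ∈ W)
    (hp : p ∈ monoSpan (twistExpo i 0)) (hp' : p ∉ monoSpan polyExpo) :
    monoSpan (twistExpo i 0) ≤ W := by
  -- `W` itself need not be closed under division by xᵢ; this space of vectors that enter `W` after
  -- multiplication by every sufficiently negative power of xᵢ is.
  let X : Submodule ℂ Laurent :=
    { carrier := {q | ∃ N : ℕ, ∀ M : ℕ, N ≤ M → xpow i (-M) * q ∈ W}
      add_mem' := by
        rintro p q ⟨j, hj⟩ ⟨k, hk⟩
        refine ⟨max j k, fun M hM => ?_⟩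
        rw [mul_add]
        exact Submodule.add_mem _ (hj M (by omega)) (hk M (by omega))
      zero_mem' := ⟨0, fun M _ => by rw [mul_zero]; exact Submodule.zero_mem _⟩
      smul_mem' := fun r p ⟨k, hk⟩ => ⟨k, fun M hM => by
        rw [mul_smul_comm]; exact Submodule.smul_mem _ _ (hk M hM)⟩ }
  have hXinv : ∀ q ∈ X, xpow i (-1) * q ∈ X := by
    rintro q ⟨N, hN⟩
    refine ⟨N, fun M hM => ?_⟩
    have := hN (M + 1) (by omega)
    rwa [← mul_assoc, ← xpow_add, ← neg_add, ← Nat.cast_succ]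
  have hcancel : ∀ (M : ℕ) (q : Laurent), xpow i M * (xpow i (-M) * q) = q := by
    intro M q
    rw [← mul_assoc, xpow_mul_neg, one_mul]
  have hcancel' : ∀ (M : ℕ) (q : Laurent), xpow i (-M) * (xpow i M * q) = q := by
    intro M q
    rw [← mul_assoc, mul_comm (xpow i (-M)), xpow_mul_neg, one_mul]
  have hXf : ∀ m, ∀ q ∈ X, xpow m 1 * q ∈ X := by
    rintro m q ⟨N, hN⟩
    refine ⟨N, fun M hM => ?_⟩
    rw [mul_left_comm]
    exact hW.fop_mem m _ (hN M hM)
  have hXh : ∀ m, ∀ q ∈ X, hop J m q ∈ X := by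
    rintro m q ⟨N, hN⟩
    refine ⟨N, fun M hM => ?_⟩
    have h1 := hW.hop_mem m _ (hN M hM)
    rw [hop_xpow_mul, mul_sub, mul_smul_comm] at h1
    refine (Submodule.sub_mem_iff_left _ (W.smul_mem _ ?_)).mp h1
    have h2 := hW.fop_mem (i + m) _ (hN (M + 1) (by omega))
    rw [Nat.cast_succ, neg_add, xpow_add, fop_apply] at h2
    convert h2 using 1
    ring
  -- The same conjugation formulas with exponent -M: the correction terms enter `W` for large M
  -- because `X` is closed under h's, multiplications and xᵢ⁻¹.
  have hX : IsStable J X := by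
    refine ⟨?_, hXf, hXh⟩
    rintro m q hq
    obtain ⟨N, hN⟩ := id hq
    obtain ⟨N', hN'⟩ := hXinv _ (hXh (m + i) q hq)
    obtain ⟨N'', hN''⟩ := hXinv _ (hXinv _ (hXf (2 * i + m) q hq))
    refine ⟨N + N' + N'', fun M hM => ?_⟩
    have h1 := hW.eop_mem m _ (hN M (by omega))
    rw [eop_xpow_mul, mul_sub, mul_add, mul_smul_comm, mul_smul_comm] at h1
    refine (Submodule.add_mem_iff_left _ (W.smul_mem _ ?_)).mp
      ((Submodule.sub_mem_iff_left _ (W.smul_mem _ ?_)).mp h1)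
    · exact hN' M (by omega)
    · have := hN'' M (by omega)
      rwa [mul_assoc, mul_assoc]
  obtain ⟨q, hqW, hq, hq'⟩ := exists_neg_degree_of_not_mem hW hpW hp hp'
  -- In negative degree xᵢ can be divided out inside `W`, and each division lowers the degree
  -- further, so the process never stops.
  have hqX : q ∈ X := by
    have key : ∀ M : ℕ, xpow i (-M) * q ∈ W ∧ xpow i (-M) * q ∈ monoSpan (degTwistExpo i 0) := by
      intro M
      induction M with
      | zero => simpa [xpow_zero] using ⟨hqW, hq⟩
      | succ M ih =>
        rw [Nat.cast_succ, neg_add, add_comm, xpow_add, mul_assoc]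
        refine ⟨inv_mul_mem hW ih.1 (degTwistExpo_zero_le_invPart hJ i ih.2), ?_⟩
        refine map_mem_monoSpan (A := LinearMap.mulLeft ℂ (xpow i (-1))) (fun a ha => ?_) ih.2
        rw [LinearMap.mulLeft_apply, mul_comm, xpow, ← mono_add]
        obtain ⟨h1, j, hj, hja⟩ := ha
        refine mono_mem_monoSpan.mpr ⟨?_, j - 1, by omega, ?_⟩
        · have h2 := add_single_mem_twistExpo h1 (-1)
          have h3 := twistExpo_add_int i 0 (-1)
          push_cast at h3
          rwa [h3] at h2
        · rw [map_add, hja, expoDeg_single]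
          push_cast; ring
    exact ⟨0, fun M _ => (key M).1⟩
  have hJ0 : J ≠ 0 := fun h => hJ ⟨0, by simp [h]⟩
  have h1 := eq_top_of_inv hJ0 hX hXinv hqX (monoSpan_mono (fun a ha => ha.1) hq)
    fun h => hq' (by rw [h]; exact Submodule.zero_mem _)
  -- Having 1 in `X` puts all sufficiently negative powers of xᵢ into `W`; multiplication by xᵢ ^ N
  -- then supplies every xᵢ ^ (-k).
  obtain ⟨N, hN⟩ := h1 (show (1 : Laurent) ∈ _ from by
    rw [← mono_zero]
    exact mono_mem_monoSpan.mpr ⟨fun n _ => ⟨0, by simp⟩, 0, by simp⟩)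
  refine monoSpan_twistExpo_le hW fun k => ?_
  have h2 := xpow_natCast_mul_mem (i := i) hW N (hN (N + k) (by omega))
  rwa [mul_one, ← xpow_add, show (N : ℂ) + -((N + k : ℕ) : ℂ) = -k by push_cast; ring] at h2

/-! ### Vectors on which `e₋ᵢ` is nilpotent -/

/-- As c acts by zero, e₋ᵢ, fᵢ and h₀ act as an sl₂-triple and the powers of xᵢ form strings for it;
the lowering of the exponent stops exactly at r = 0 and r = J + 1. -/
theorem eop_neg_xpow (J : ℂ) (i : ℤ) (r : ℂ) :
    eop J (-i) (xpow i r) = (r * (J + 1 - r)) • xpow i (r - 1) := by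
  have h1 := eop_xpow_mul J (-i) i r 1
  rw [mul_one, eop_one, zero_add, neg_add_cancel, hop_one, if_pos rfl,
    show 2 * i + -i = i by ring, mul_one] at h1
  rw [h1, show r - 1 = r + -1 by ring, xpow_add]
  have h2 := xpow_mul_neg i 1
  simp only [Algebra.smul_def, map_mul, map_sub, map_add, map_neg, map_one]
  linear_combination -(xpow i r * algebraMap ℂ Laurent r * (algebraMap ℂ Laurent r - 1) *
    xpow i (-1)) * h2

theorem eop_neg_pow_xpow {J : ℂ} {i : ℤ} {r : ℂ} (h : ∀ k : ℕ, (r - k) * (J + 1 - r + k) ≠ 0)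
    (n : ℕ) : ∃ s : ℂ, s ≠ 0 ∧ (eop J (-i) ^ n) (xpow i r) = s • xpow i (r - n) := by
  induction n with
  | zero => exact ⟨1, one_ne_zero, by simp⟩
  | succ n ih =>
    obtain ⟨s, hs, h1⟩ := ih
    refine ⟨s * ((r - n) * (J + 1 - r + n)), mul_ne_zero hs (h n), ?_⟩
    rw [pow_succ', Module.End.mul_apply, h1, map_smul, eop_neg_xpow, smul_smul]
    congr 2
    · ring
    · push_cast; ring

/-- For integral `J` the localization contains a nonpolynomial vector annihilated by `e₋ᵢ`. -/
theorem exists_eop_neg_eq_zero (j i : ℤ) :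
    ∃ v ∈ monoSpan (twistExpo i 0), v ∉ monoSpan polyExpo ∧ eop (j : ℂ) (-i) v = 0 := by
  -- With D = j + 1 - k the factor j + 1 - D - l equals k - l, so the diagonal entry first vanishes
  -- on layer k. The size of k makes D negative, which keeps D - l away from zero. The monomial xᵢ ^
  -- (D - k) xᵢ₊₁ ^ k lies in this layer and is not a polynomial.
  set k : ℕ := j.natAbs + 2 with hk
  set D : ℂ := (j : ℂ) + 1 - k with hD
  set a : Expo := Finsupp.single i (D - k) + Finsupp.single (i + 1) (k : ℂ) with ha
  have hai : a i = D - k := by simp [ha]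
  have hdeg : expoDeg a = D := by rw [ha, map_add, expoDeg_single, expoDeg_single]; ring
  have hnat : ∀ n, n ≠ i → ∃ l : ℕ, a n = l := by
    intro n hn
    by_cases h : n = i + 1
    · exact ⟨k, by simp [ha, h]⟩
    · exact ⟨0, by simp [ha, Ne.symm hn, Ne.symm h]⟩
  have hneg : a i = -(((2 * k - j - 2).toNat : ℕ) + 1) := by
    rw [hai, ← Int.cast_natCast (R := ℂ) (2 * k - j - 2).toNat, Int.toNat_of_nonneg (by omega), hD]
    push_cast; ring
  have hle : monoSpan (boundedExpo i D k) ≤ invPart (feOp j i) := by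
    refine monoSpan_boundedExpo_le fun l hl => mul_ne_zero (fun h => ?_) fun h => ?_
    · have : ((j + 1 - k - l : ℤ) : ℂ) = (0 : ℤ) := by push_cast; rw [← h, hD]
      have := Int.cast_injective this
      omega
    · have : ((k - l : ℤ) : ℂ) = (0 : ℤ) := by push_cast; rw [← h, hD]; ring
      have := Int.cast_injective this
      omega
  -- The diagonal entry at `a` is zero, so the image lies entirely in the lower layers, where some
  -- χ(T) with χ(0) ≠ 0 kills it.
  have hT : feOp j i (mono a) ∈ monoSpan (boundedExpo i D k) := by
    have h1 : (a i * ((j : ℂ) + 1 + a i - 2 * expoDeg a)) = 0 := by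
      rw [hdeg, hai, hD]; ring
    rw [feOp_mono, h1, zero_smul, zero_sub]
    have h2 := quadOp_erase_mem hnat (j := k) (by rw [hai, hdeg])
    rw [hdeg] at h2
    exact Submodule.neg_mem _ h2
  obtain ⟨χ, hχ, h0⟩ := hle hT
  have ha' : a ∈ boundedExpo i D (k + 1) := ⟨hnat, hdeg, k, by omega, hai⟩
  -- T χ(T) = χ(T) T kills the monomial `a`, and χ(T) keeps it with coefficient χ(0), so the vector
  -- is not a polynomial.
  refine ⟨Polynomial.aeval (feOp j i) χ (mono a), ?_, ?_, ?_⟩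
  · have h1 := aeval_mem (T := feOp j i) (W := monoSpan (boundedExpo i D (k + 1)))
      (fun p hp => feOp_mem hp) χ (mono_mem_monoSpan.mpr ha')
    refine monoSpan_mono (fun b hb => ?_) h1
    obtain ⟨h1, _, l, _, hl⟩ := hb
    exact ⟨h1, j + 1 - k - l, by rw [hl, hD]; push_cast; ring⟩
  · intro h
    refine not_mem_polyExpo_of_neg hneg (h a ?_)
    have h1 : Polynomial.aeval (feOp j i) χ (mono a) = χ.eval 0 • mono a +
        Polynomial.aeval (feOp j i) χ.divX (feOp j i (mono a)) := by
      conv_lhs => rw [← Polynomial.divX_mul_X_add χ]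
      rw [map_add, map_mul, Polynomial.aeval_X, Polynomial.aeval_C,
        Polynomial.coeff_zero_eq_eval_zero, LinearMap.add_apply, Module.End.mul_apply,
        Module.algebraMap_end_apply, add_comm]
    have h2 : coeffAt a (Polynomial.aeval (feOp j i) χ.divX (feOp j i (mono a))) = 0 := by
      by_contra h3
      obtain ⟨_, _, l, hl, hl'⟩ := aeval_mem (fun p hp => feOp_mem hp) χ.divX hT a h3
      rw [hai] at hl'
      have : ((k : ℕ) : ℂ) = (l : ℕ) := by linear_combination -hl'
      have := Nat.cast_injective this
      omega
    rw [← coeffAt_apply, h1, map_add, h2, map_smul, coeffAt_mono, if_pos rfl, add_zero, smul_eq_mul,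
      mul_one]
    exact hχ
  · have h1 : fop i (eop (j : ℂ) (-i) (Polynomial.aeval (feOp j i) χ (mono a))) = 0 := by
      rw [← feOp_apply, ← h0, ← Module.End.mul_apply, ← Module.End.mul_apply]
      have hc := (Commute.all χ Polynomial.X).map (Polynomial.aeval (feOp (j : ℂ) i))
      rw [Polynomial.aeval_X] at hc
      rw [hc.eq]
    rw [fop_apply] at h1
    rw [← one_mul (eop _ _ _), ← xpow_mul_neg i 1, mul_comm (xpow i 1), mul_assoc, h1, mul_zero]

end AffineSl2

namespace AffineSl2

/-! ### The Fock module -/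

/-- The space of generalized Laurent polynomials as a module over `U`. -/
def Fock (_J _κ : ℂ) : Type := Laurent

noncomputable instance (J κ : ℂ) : AddCommGroup (Fock J κ) := inferInstanceAs (AddCommGroup Laurent)

noncomputable instance (J κ : ℂ) : Module U (Fock J κ) :=
  Module.compHom Laurent (fockRep J κ).toRingHom

theorem affineOp_mem {J κ : ℂ} {W : Submodule ℂ Laurent} (hW : IsStable J W)
    (hd : ∀ p ∈ W, dop κ p ∈ W) (x : AffineSl2) : ∀ p ∈ W, affineOp J κ x p ∈ W := by
  induction x using affine_induction with
  | add x y hx hy =>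
    intro p hp
    rw [map_add]
    exact W.add_mem (hx p hp) (hy p hp)
  | smul r x hx =>
    intro p hp
    rw [map_smul, smul_op_apply]
    exact W.smul_mem r (hx p hp)
  | he n => rw [← fockRep_ι, fockRep_e]; exact hW.eop_mem n
  | hf n => rw [← fockRep_ι, fockRep_f]; exact hW.fop_mem n
  | hh n => rw [← fockRep_ι, fockRep_h]; exact hW.hop_mem n
  | hc => rw [← fockRep_ι, fockRep_c]; intro p _; exact W.zero_mem
  | hd => rw [← fockRep_ι, fockRep_d]; exact hd

theorem fockRep_mem {J κ : ℂ} {W : Submodule ℂ Laurent} (hW : IsStable J W)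
    (hd : ∀ p ∈ W, dop κ p ∈ W) (u : U) : ∀ p ∈ W, fockRep J κ u p ∈ W := by
  let T : Subalgebra ℂ U :=
    { carrier := {u | ∀ p ∈ W, fockRep J κ u p ∈ W}
      mul_mem' := fun {u v} hu hv p hp => by
        rw [map_mul, Module.End.mul_apply]
        exact hu _ (hv p hp)
      add_mem' := fun {u v} hu hv p hp => by
        rw [map_add]
        exact W.add_mem (hu p hp) (hv p hp)
      algebraMap_mem' := fun r p hp => by
        rw [AlgHom.commutes, Module.algebraMap_end_apply]
        exact W.smul_mem r hp }
  refine mem_of_ι_mem T (fun x p hp => ?_) u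
  rw [fockRep_ι]
  exact affineOp_mem hW hd x p hp

/-- The submodule of the Fock module spanned by the monomials with exponents in `S`. -/
noncomputable def fockSub (J κ : ℂ) {S : Set Expo} (hS : IsAdmissible S) :
    Submodule U (Fock J κ) where
  carrier := (monoSpan S : Set Laurent)
  add_mem' := (monoSpan S).add_mem
  zero_mem' := (monoSpan S).zero_mem
  smul_mem' u p hp := fockRep_mem (hS.isStable J) (fun _ => dop_mem κ) u p hp

theorem mem_fockSub {J κ : ℂ} {S : Set Expo} {hS : IsAdmissible S} {p : Fock J κ} :
    p ∈ fockSub J κ hS ↔ p ∈ monoSpan S := Iff.rfl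

/-! ### Weights of monomials -/

theorem δ_cartanH : δ cartanH = 0 := rfl

theorem δ_cartanC : δ cartanC = 0 := rfl

theorem δ_cartanD : δ cartanD = 1 := rfl

/-- The weight of the monomial with exponent `a`, if `1` has weight `λ`. -/
noncomputable def monoWeight (lam : Module.Dual ℂ cartan) (a : Expo) : Module.Dual ℂ cartan :=
  lam - expoDeg a • β + expoMoment a • δ

theorem monoWeight_cartanH (lam : Module.Dual ℂ cartan) (a : Expo) :
    monoWeight lam a cartanH = lam cartanH - 2 * expoDeg a := by
  simp only [monoWeight, LinearMap.add_apply, LinearMap.sub_apply, LinearMap.smul_apply,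
    β_cartanH, δ_cartanH, smul_eq_mul]
  ring

theorem monoWeight_cartanC (lam : Module.Dual ℂ cartan) (a : Expo) :
    monoWeight lam a cartanC = lam cartanC := by
  simp [monoWeight, β_cartanC, δ_cartanC]

theorem monoWeight_cartanD (lam : Module.Dual ℂ cartan) (a : Expo) :
    monoWeight lam a cartanD = lam cartanD + expoMoment a := by
  simp [monoWeight, β_cartanD, δ_cartanD]

theorem monoWeight_eq_iff {lam : Module.Dual ℂ cartan} {a b : Expo} :
    monoWeight lam a = monoWeight lam b ↔ expoDeg a = expoDeg b ∧ expoMoment a = expoMoment b := by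
  constructor
  · intro h
    have h1 := congrArg (fun μ => μ cartanH) h
    have h2 := congrArg (fun μ => μ cartanD) h
    simp only [monoWeight_cartanH, monoWeight_cartanD] at h1 h2
    constructor
    · linear_combination -h1 / 2
    · linear_combination h2
  · rintro ⟨h1, h2⟩
    rw [monoWeight, monoWeight, h1, h2]

section

variable {lam : Module.Dual ℂ cartan} {J κ : ℂ}

theorem affineOp_cartan_mono (hc : lam cartanC = 0) (hJ : lam cartanH = J) (hκ : lam cartanD = κ)
    (H : cartan) (a : Expo) :
    affineOp J κ H (mono a) = monoWeight lam a H • mono a := by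
  obtain ⟨x, hx⟩ := H
  induction hx using Submodule.span_induction with
  | mem x hx =>
    rcases hx with rfl | rfl | rfl
    · change affineOp J κ (hₙ 0) (mono a) = monoWeight lam a cartanH • mono a
      rw [← fockRep_ι, fockRep_h, hop_zero_mono, monoWeight_cartanH, hJ]
    · change affineOp J κ c (mono a) = monoWeight lam a cartanC • mono a
      rw [← fockRep_ι, fockRep_c, monoWeight_cartanC, hc, zero_smul]; rfl
    · change affineOp J κ d (mono a) = monoWeight lam a cartanD • mono a
      rw [← fockRep_ι, fockRep_d, dop_mono_eq, monoWeight_cartanD, hκ]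
  | zero =>
    change affineOp J κ 0 (mono a) = monoWeight lam a 0 • mono a
    simp
  | add x y hx hy ihx ihy =>
    change affineOp J κ (x + y) (mono a) = monoWeight lam a (⟨x, hx⟩ + ⟨y, hy⟩) • mono a
    rw [map_add, map_add, add_smul, ← ihx, ← ihy]; rfl
  | smul r x hx ihx =>
    change affineOp J κ (r • x) (mono a) = monoWeight lam a (r • ⟨x, hx⟩) • mono a
    rw [map_smul, map_smul, smul_assoc, ← ihx]; rfl

theorem coeffAt_affineOp_cartan (hc : lam cartanC = 0) (hJ : lam cartanH = J)
    (hκ : lam cartanD = κ) (H : cartan) (a : Expo) (p : Laurent) :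
    coeffAt a (affineOp J κ H p) = monoWeight lam a H * coeffAt a p :=
  coeffAt_of_mono (σ := id) (g := fun a => monoWeight lam a H)
    Function.injective_id (affineOp_cartan_mono hc hJ hκ H) a p

theorem algebraMap_fock_smul (r : ℂ) (p : Fock J κ) :
    algebraMap ℂ U r • p = @HSMul.hSMul ℂ Laurent Laurent _ r p :=
  (LinearMap.congr_fun (AlgHom.commutes (fockRep J κ) r) p).trans
    (Module.algebraMap_end_apply ..)

theorem monoWeight_eq_of_hasWeight (hc : lam cartanC = 0) (hJ : lam cartanH = J)
    (hκ : lam cartanD = κ) {μ : Module.Dual ℂ cartan} {p : Laurent}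
    (hp : HasWeight (V := Fock J κ) μ p) {a : Expo} (ha : p.coeff a ≠ 0) :
    monoWeight lam a = μ := by
  refine LinearMap.ext fun H => ?_
  have h1 : affineOp J κ H p = μ H • p := by
    rw [← fockRep_ι]; exact (hp H).trans (algebraMap_fock_smul (μ H) p)
  have h2 := coeffAt_affineOp_cartan hc hJ hκ H a p
  rw [h1, map_smul, smul_eq_mul] at h2
  exact (mul_right_cancel₀ ha h2).symm

end

theorem eq_zero_of_expoDeg_eq_zero {a : Expo} (ha : a ∈ polyExpo) (h : expoDeg a = 0) : a = 0 := by
  choose k hk using ha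
  rw [expoDeg, Finsupp.linearCombination_apply, Finsupp.sum] at h
  simp only [hk, smul_eq_mul, mul_one, ← Nat.cast_sum, Nat.cast_eq_zero,
    Finset.sum_eq_zero_iff] at h
  ext n
  by_cases hn : n ∈ a.support
  · rw [hk, h n hn]; simp
  · simpa using hn

/-! ### The quotient of the imaginary Verma module -/

section Verma

variable {lam : Module.Dual ℂ cartan} {J κ : ℂ}

theorem vermaIdeal_le_ker (hc : lam cartanC = 0) (hJ : lam cartanH = J) (hκ : lam cartanD = κ) :
    vermaIdeal lam ≤ LinearMap.ker (LinearMap.toSpanSingleton U (Fock J κ) (1 : Laurent)) := by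
  refine Submodule.span_le.mpr ?_
  rintro u (⟨a, ha, rfl⟩ | ⟨H, rfl⟩)
  · change fockRep J κ (ι a) 1 = 0
    induction ha using Submodule.span_induction with
    | mem x hx =>
      rcases hx with ⟨n, rfl⟩ | ⟨m, hm, rfl⟩
      · rw [fockRep_e, eop_one]
      · rw [fockRep_h, hop_one, if_neg hm.ne', zero_smul]
    | zero => rw [map_zero, map_zero]; rfl
    | add x y _ _ hx hy =>
      rw [map_add, map_add, LinearMap.add_apply, hx, hy, add_zero]
    | smul r x _ hx => rw [map_smul, map_smul, smul_op_apply, hx, smul_zero]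
  · change fockRep J κ (ι H - algebraMap ℂ U (lam H)) 1 = 0
    have h1 := affineOp_cartan_mono hc hJ hκ H 0
    rw [mono_zero] at h1
    rw [map_sub, LinearMap.sub_apply, fockRep_ι, h1, AlgHom.commutes, Module.algebraMap_end_apply]
    simp [monoWeight]

/-- The map from the imaginary Verma module to the Fock module. -/
noncomputable def vermaToFock (hc : lam cartanC = 0) (hJ : lam cartanH = J)
    (hκ : lam cartanD = κ) : ImaginaryVerma lam →ₗ[U] Fock J κ :=
  (vermaIdeal lam).liftQ _ (vermaIdeal_le_ker hc hJ hκ)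

theorem HasWeight.map {V V' : Type*} [AddCommGroup V] [Module U V] [AddCommGroup V'] [Module U V']
    {μ : Module.Dual ℂ cartan} {v : V} (hv : HasWeight μ v) (φ : V →ₗ[U] V') :
    HasWeight μ (φ v) := fun H => by
  rw [← map_smul, hv H, map_smul]

theorem vermaToFock_mem (hc : lam cartanC = 0) (hJ : lam cartanH = J)
    (hκ : lam cartanD = κ) (v : ImaginaryVerma lam) :
    vermaToFock hc hJ hκ v ∈ fockSub J κ isAdmissible_polyExpo := by
  obtain ⟨u, rfl⟩ := Submodule.mkQ_surjective _ v
  exact (fockSub J κ isAdmissible_polyExpo).smul_mem u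
    (mono_mem_monoSpan.mpr fun n => ⟨0, by simp⟩ : mono 0 ∈ monoSpan polyExpo)

/-- Among polynomials the weight λ - kδ forces total degree zero, hence a constant; constants have
weight λ, so k > 0 leaves only zero. -/
theorem vermaSubmodule_le_ker (hc : lam cartanC = 0) (hJ : lam cartanH = J)
    (hκ : lam cartanD = κ) : vermaSubmodule lam ≤ LinearMap.ker (vermaToFock hc hJ hκ) := by
  refine Submodule.span_le.mpr ?_
  rintro v ⟨k, hk, hv⟩
  have hw := hv.map (vermaToFock hc hJ hκ)
  have hp := mem_fockSub.mp (vermaToFock_mem hc hJ hκ v)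
  change vermaToFock hc hJ hκ v = 0
  generalize vermaToFock hc hJ hκ v = p at hw hp
  by_contra hne
  obtain ⟨a, ha⟩ : ∃ a, (p : Laurent).coeff a ≠ 0 := by
    by_contra! hall
    exact hne (AddMonoidAlgebra.ext (Finsupp.ext hall))
  have h1 := monoWeight_eq_of_hasWeight hc hJ hκ hw ha
  have h2 := congrArg (fun μ => μ cartanH) h1
  have h3 := congrArg (fun μ => μ cartanD) h1
  simp only [monoWeight_cartanH, monoWeight_cartanD, LinearMap.sub_apply, LinearMap.smul_apply,
    δ_cartanH, δ_cartanD] at h2 h3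
  have h4 : a = 0 := eq_zero_of_expoDeg_eq_zero (mem_monoSpan.mp hp a ha) (by
    simp at h2; exact h2)
  subst h4
  rw [map_zero, add_zero, nsmul_one, eq_comm, sub_eq_self, Nat.cast_eq_zero] at h3
  exact hk.ne' h3

/-- The map from `M'(λ)` to the Fock module. -/
noncomputable def vermaQuotientToFock (hc : lam cartanC = 0) (hJ : lam cartanH = J)
    (hκ : lam cartanD = κ) : VermaQuotient lam →ₗ[U] Fock J κ :=
  (vermaSubmodule lam).liftQ _ (vermaSubmodule_le_ker hc hJ hκ)

/-! ### Generation of `M'(λ)` by polynomials in the fₙ, and injectivity of the Fock map -/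

theorem lie_fₙ (m n : ℤ) : ⁅fₙ m, fₙ n⁆ = 0 := by
  ext1
  · simp only [lie_loop, fₙ, monomial_lie, lie_self]
    simp [← coeff_symm_single]
  · simp only [lie_cCoeff, fₙ, cocycle_monomial, zero_cCoeff]
    -- Since (ad f)³ = 0, the endomorphism (ad f)² is nilpotent and has trace zero; this kills the
    -- central term.
    have : killingForm ℂ Sl2 f f = 0 := by
      rw [killingForm_apply_apply]
      have h0 : (LieAlgebra.ad ℂ Sl2 f ∘ₗ LieAlgebra.ad ℂ Sl2 f) ^ 2 = 0 := by
        refine LinearMap.ext fun a => ?_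
        simp [pow_two, lie_f_lie_f_lie_f]
      exact (LinearMap.isNilpotent_trace_of_isNilpotent ⟨2, h0⟩).eq_zero
    rw [this]; simp
  · simp

theorem ι_fₙ_comm (m n : ℤ) : ι (fₙ m) * ι (fₙ n) = ι (fₙ n) * ι (fₙ m) := by
  have := ι_lie (fₙ m) (fₙ n)
  rw [lie_fₙ, map_zero] at this
  exact (sub_eq_zero.mp this.symm)

theorem exists_polyToU : ∃ F : MvPolynomial ℤ ℂ →ₐ[ℂ] U, ∀ n, F (MvPolynomial.X n) = ι (fₙ n) := by
  have hcomm : ∀ a ∈ Set.range (fun n => ι (fₙ n)), ∀ b ∈ Set.range (fun n => ι (fₙ n)),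
      a * b = b * a := by
    rintro _ ⟨m, rfl⟩ _ ⟨n, rfl⟩
    exact ι_fₙ_comm m n
  -- Evaluation of polynomials needs a commutative target, so it is done in the subalgebra generated
  -- by the commuting fₙ.
  let A := Algebra.adjoin ℂ (Set.range fun n => ι (fₙ n))
  let _ : CommRing A :=
    { (inferInstance : Ring A) with
      mul_comm := fun a b => by
        have := Algebra.isMulCommutative_adjoin ℂ hcomm
        exact this.is_comm.comm a b }
  refine ⟨A.val.comp (MvPolynomial.aeval fun n => (⟨ι (fₙ n), Algebra.subset_adjoin ⟨n, rfl⟩⟩ : A)),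
    fun n => ?_⟩
  simp

/-- The algebra map `ℂ[xₙ] → U` with `xₙ ↦ fₙ`. -/
noncomputable def polyToU : MvPolynomial ℤ ℂ →ₐ[ℂ] U := exists_polyToU.choose

theorem polyToU_X (n : ℤ) : polyToU (MvPolynomial.X n) = ι (fₙ n) := exists_polyToU.choose_spec n

/-- Polynomials as generalized Laurent polynomials. -/
noncomputable def polyToLaurent : MvPolynomial ℤ ℂ →ₐ[ℂ] Laurent :=
  MvPolynomial.aeval fun n => xpow n 1

theorem fockRep_polyToU (P : MvPolynomial ℤ ℂ) (w : Laurent) :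
    fockRep J κ (polyToU P) w = polyToLaurent P * w := by
  have h : (fockRep J κ).comp polyToU = (Algebra.lmul ℂ Laurent).comp polyToLaurent := by
    refine MvPolynomial.algHom_ext fun n => ?_
    simp only [AlgHom.comp_apply, polyToU_X, fockRep_f, polyToLaurent, MvPolynomial.aeval_X]
    rfl
  exact LinearMap.congr_fun (AlgHom.congr_fun h P) w

/-- Exponents of polynomials as complex exponents. -/
noncomputable def castExpo (t : ℤ →₀ ℕ) : Expo := 
  t.mapRange (Nat.cast : ℕ → ℂ) Nat.cast_zero

theorem castExpo_injective : Function.Injective castExpo :=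
  Finsupp.mapRange_injective _ Nat.cast_zero Nat.cast_injective

theorem polyToLaurent_monomial (t : ℤ →₀ ℕ) (r : ℂ) :
    polyToLaurent (MvPolynomial.monomial t r) = r • mono (castExpo t) := by
  have h1 : ∀ t : ℤ →₀ ℕ, polyToLaurent (MvPolynomial.monomial t 1) = mono (castExpo t) := by
    intro t
    induction t using Finsupp.induction_linear with
    | zero =>
      have : castExpo 0 = 0 := by simp [castExpo]
      rw [this, mono_zero]
      exact map_one polyToLaurent
    | add t t' ht ht' =>
      have : castExpo (t + t') = castExpo t + castExpo t' := by
        ext n; simp [castExpo]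
      rw [this, mono_add, ← ht, ← ht', ← map_mul, MvPolynomial.monomial_mul, mul_one]
    | single n k =>
      have : castExpo (Finsupp.single n k) = Finsupp.single n (k : ℂ) := by
        simp [castExpo]
      rw [this, ← MvPolynomial.X_pow_eq_monomial, map_pow]
      change _ = xpow n k
      rw [xpow_natCast, polyToLaurent, MvPolynomial.aeval_X]
  rw [← h1, ← map_smul, MvPolynomial.smul_monomial, smul_eq_mul, mul_one]

theorem coeffAt_polyToLaurent (P : MvPolynomial ℤ ℂ) (t : ℤ →₀ ℕ) :
    coeffAt (castExpo t) (polyToLaurent P) = P.coeff t := by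
  classical
  induction P using MvPolynomial.induction_on' with
  | add P Q hP hQ => rw [map_add, map_add, hP, hQ, MvPolynomial.coeff_add]
  | monomial s r =>
    rw [polyToLaurent_monomial, MvPolynomial.coeff_monomial, map_smul, coeffAt_mono]
    by_cases h : s = t
    · simp [h]
    · simp [h, castExpo_injective.ne h]

theorem polyToLaurent_injective : Function.Injective polyToLaurent := by
  refine (injective_iff_map_eq_zero _).mpr fun P hP => ?_
  ext t
  rw [← coeffAt_polyToLaurent, hP, map_zero, MvPolynomial.coeff_zero]

theorem exists_polyToLaurent_eq {p : Laurent} (hp : p ∈ monoSpan polyExpo) :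
    ∃ P, polyToLaurent P = p := by
  refine monoSpan_le (W := LinearMap.range polyToLaurent.toLinearMap) (fun a ha => ?_) hp
  choose k hk using ha
  refine ⟨MvPolynomial.monomial (Finsupp.onFinset a.support k fun n hn => ?_) 1, ?_⟩
  · rw [Finsupp.mem_support_iff, hk]; exact_mod_cast hn
  · change polyToLaurent _ = _
    rw [polyToLaurent_monomial, one_smul]
    congr 1
    ext n
    simp [castExpo, hk]

theorem lie_cartan_hₙ (H : cartan) (m : ℤ) :
    ⁅(H : AffineSl2), hₙ m⁆ = ((m : ℂ) * δ H) • hₙ m := by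
  obtain ⟨x, hx⟩ := H
  induction hx using Submodule.span_induction with
  | mem x hx =>
    rcases hx with rfl | rfl | rfl
    · change ⁅hₙ 0, hₙ m⁆ = ((m : ℂ) * δ cartanH) • hₙ m
      rw [δ_cartanH, mul_zero, zero_smul]
      ext1
      · simp only [lie_loop, hₙ, monomial_lie, lie_self]
        simp [← coeff_symm_single]
      · simp [hₙ, cocycle_monomial]
      · simp
    · change ⁅c, hₙ m⁆ = ((m : ℂ) * δ cartanC) • hₙ m
      rw [δ_cartanC, mul_zero, zero_smul]
      ext1 <;> simp [c, hₙ]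
    · change ⁅d, hₙ m⁆ = ((m : ℂ) * δ cartanD) • hₙ m
      rw [δ_cartanD, mul_one]
      ext1 <;> simp [d, hₙ, degree_monomial]
  | zero =>
    change ⁅(0 : AffineSl2), hₙ m⁆ = ((m : ℂ) * δ 0) • hₙ m
    simp
  | add x y hx hy ihx ihy =>
    change ⁅x + y, hₙ m⁆ = ((m : ℂ) * δ (⟨x, hx⟩ + ⟨y, hy⟩)) • hₙ m
    rw [map_add, mul_add, add_smul, ← ihx, ← ihy, add_lie]
  | smul r x hx ihx =>
    change ⁅r • x, hₙ m⁆ = ((m : ℂ) * δ (r • ⟨x, hx⟩)) • hₙ m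
    rw [map_smul, smul_eq_mul, mul_left_comm, mul_smul, ← ihx, smul_lie]

/-- The generator of `M'(λ)`. -/
noncomputable def vacuum (lam : Module.Dual ℂ cartan) : VermaQuotient lam :=
  Submodule.Quotient.mk (Submodule.Quotient.mk 1)

theorem mk_mk_eq_smul_vacuum (u : U) :
    (Submodule.Quotient.mk (Submodule.Quotient.mk u) : VermaQuotient lam) = u • vacuum lam := by
  rw [vacuum, ← Submodule.Quotient.mk_smul, ← Submodule.Quotient.mk_smul, smul_eq_mul, mul_one]

theorem smul_vacuum_of_gPlus {a : AffineSl2} (ha : a ∈ gPlus) : ι a • vacuum lam = 0 := by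
  rw [← mk_mk_eq_smul_vacuum, (Submodule.Quotient.mk_eq_zero (vermaIdeal lam)).mpr
    (Submodule.subset_span (Or.inl ⟨a, ha, rfl⟩)), Submodule.Quotient.mk_zero]

theorem mk_cartan_smul (H : cartan) : (Submodule.Quotient.mk (ι (H : AffineSl2)) :
    ImaginaryVerma lam) = algebraMap ℂ U (lam H) • Submodule.Quotient.mk 1 := by
  rw [← Submodule.Quotient.mk_smul, smul_eq_mul, mul_one, Submodule.Quotient.eq]
  exact Submodule.subset_span (Or.inr ⟨H, rfl⟩)

theorem cartan_smul_vacuum (H : cartan) :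
    ι (H : AffineSl2) • vacuum lam = algebraMap ℂ U (lam H) • vacuum lam := by
  rw [← mk_mk_eq_smul_vacuum, mk_cartan_smul]
  rfl

theorem hₙ_smul_vacuum {m : ℤ} (hm : m ≠ 0) : ι (hₙ m) • vacuum lam = 0 := by
  rcases hm.lt_or_gt with hm' | hm'
  · rw [← mk_mk_eq_smul_vacuum, Submodule.Quotient.mk_eq_zero]
    -- For m < 0 the vector hₘ ⊗ 1 of the imaginary Verma module has weight λ - |m|δ, hence is one
    -- of the generators of the submodule divided out.
    refine Submodule.subset_span ⟨m.natAbs, by omega, fun H => ?_⟩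
    have h1 := ι_lie (H : AffineSl2) (hₙ m)
    rw [lie_cartan_hₙ H m, map_smul, eq_sub_iff_add_eq] at h1
    have hmk : ∀ u v : U, (Submodule.Quotient.mk (u * v) : ImaginaryVerma lam) =
        u • Submodule.Quotient.mk v := fun u v => Submodule.Quotient.mk_smul _ u v
    have hm2 : ((m.natAbs : ℕ) : ℂ) = -(m : ℂ) := by
      have : ((m.natAbs : ℕ) : ℤ) = -m := by omega
      rw [← Int.cast_natCast, this, Int.cast_neg]
    rw [← hmk, ← h1, Submodule.Quotient.mk_add, hmk (ι (hₙ m)), mk_cartan_smul,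
      ← SemigroupAction.mul_smul (ι (hₙ m)), ← Algebra.commutes,
      SemigroupAction.mul_smul (algebraMap ℂ U (lam H)),
      ← hmk (ι (hₙ m)), mul_one, Algebra.smul_def, hmk, ← add_smul, ← map_add]
    congr 2
    rw [LinearMap.sub_apply, LinearMap.smul_apply, nsmul_eq_mul, hm2]
    ring
  · exact smul_vacuum_of_gPlus (Submodule.subset_span (Or.inr ⟨m, hm', rfl⟩))

theorem smul_vacuum_mem (x : AffineSl2) : ∃ P, ι x • vacuum lam = polyToU P • vacuum lam := by
  have hcart : ∀ H : cartan, ∃ P, ι (H : AffineSl2) • vacuum lam = polyToU P • vacuum lam :=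
    fun H => ⟨MvPolynomial.C (lam H), by
      rw [cartan_smul_vacuum, ← MvPolynomial.algebraMap_eq, AlgHom.commutes]⟩
  induction x using affine_induction with
  | add x y hx hy =>
    obtain ⟨P, hP⟩ := hx
    obtain ⟨Q, hQ⟩ := hy
    exact ⟨P + Q, by rw [map_add, map_add, add_smul, add_smul, hP, hQ]⟩
  | smul r x hx =>
    obtain ⟨P, hP⟩ := hx
    exact ⟨r • P, by
      rw [map_smul, map_smul, Algebra.smul_def, Algebra.smul_def, mul_smul, mul_smul, hP]⟩
  | he n => exact ⟨0, by
      rw [map_zero, zero_smul, smul_vacuum_of_gPlus (Submodule.subset_span (Or.inl ⟨n, rfl⟩))]⟩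
  | hf n => exact ⟨MvPolynomial.X n, by rw [polyToU_X]⟩
  | hh n =>
    rcases eq_or_ne n 0 with rfl | hn
    · exact hcart cartanH
    · exact ⟨0, by rw [map_zero, zero_smul, hₙ_smul_vacuum hn]⟩
  | hc => exact hcart cartanC
  | hd => exact hcart cartanD

/-- Induction on P for all x at once, because x fₙ = fₙ x + [x, fₙ] brings in a new Lie algebra
element. -/
theorem ι_smul_polyToU_smul (P : MvPolynomial ℤ ℂ) : ∀ x : AffineSl2,
    ∃ Q, ι x • polyToU P • vacuum lam = polyToU Q • vacuum lam := by
  induction P using MvPolynomial.induction_on with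
  | C r =>
    intro x
    obtain ⟨Q, hQ⟩ := smul_vacuum_mem (lam := lam) x
    refine ⟨r • Q, ?_⟩
    rw [← MvPolynomial.algebraMap_eq, AlgHom.commutes, ← mul_smul, ← Algebra.commutes, mul_smul, hQ,
      map_smul, Algebra.smul_def, mul_smul]
  | add P P' hP hP' =>
    intro x
    obtain ⟨Q, hQ⟩ := hP x
    obtain ⟨Q', hQ'⟩ := hP' x
    exact ⟨Q + Q', by rw [map_add, map_add, add_smul, smul_add, add_smul, hQ, hQ']⟩
  | mul_X P n hP =>
    intro x
    obtain ⟨Q, hQ⟩ := hP x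
    obtain ⟨Q', hQ'⟩ := hP ⁅x, fₙ n⁆
    refine ⟨MvPolynomial.X n * Q + Q', ?_⟩
    rw [mul_comm P, map_mul, map_add, map_mul, add_smul, mul_smul, mul_smul, polyToU_X, ← hQ,
      ← hQ', ← mul_smul, ← mul_smul (ι (fₙ n)), ← add_smul, ι_lie]
    congr 1
    abel

theorem exists_polyToU_smul (v : VermaQuotient lam) : ∃ P, v = polyToU P • vacuum lam := by
  let T : Subalgebra ℂ U :=
    { carrier := {u | ∀ P, ∃ Q, u • polyToU P • vacuum lam = polyToU Q • vacuum lam}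
      mul_mem' := fun {u v} hu hv P => by
        obtain ⟨Q, hQ⟩ := hv P
        obtain ⟨R, hR⟩ := hu Q
        exact ⟨R, by rw [mul_smul, hQ, hR]⟩
      add_mem' := fun {u v} hu hv P => by
        obtain ⟨Q, hQ⟩ := hu P
        obtain ⟨R, hR⟩ := hv P
        exact ⟨Q + R, by rw [add_smul, map_add, add_smul, hQ, hR]⟩
      algebraMap_mem' := fun r P => ⟨r • P, by
        rw [map_smul, Algebra.smul_def, mul_smul]⟩ }
  obtain ⟨w, rfl⟩ := Submodule.Quotient.mk_surjective _ v
  obtain ⟨u, rfl⟩ := Submodule.Quotient.mk_surjective _ w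
  have hu : u ∈ T := mem_of_ι_mem T (fun x P => ι_smul_polyToU_smul P x) u
  obtain ⟨Q, hQ⟩ := hu 1
  refine ⟨Q, ?_⟩
  rw [mk_mk_eq_smul_vacuum, ← hQ, map_one, one_smul]

theorem vermaQuotientToFock_polyToU_smul (hc : lam cartanC = 0) (hJ : lam cartanH = J)
    (hκ : lam cartanD = κ) (P : MvPolynomial ℤ ℂ) :
    vermaQuotientToFock hc hJ hκ (polyToU P • vacuum lam) = polyToLaurent P := by
  have h1 : vermaQuotientToFock hc hJ hκ (vacuum lam) = (1 : Laurent) :=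
    one_smul U (show Fock J κ from (1 : Laurent))
  rw [map_smul, h1]
  exact (fockRep_polyToU P 1).trans (mul_one _)

/-- Every vector is a polynomial in the fₙ applied to the vacuum, and the Fock map returns that
polynomial; no independent knowledge of a basis of `M'(λ)` is needed. -/
theorem vermaQuotientToFock_injective (hc : lam cartanC = 0) (hJ : lam cartanH = J)
    (hκ : lam cartanD = κ) : Function.Injective (vermaQuotientToFock hc hJ hκ) := by
  refine (injective_iff_map_eq_zero _).mpr fun v hv => ?_
  obtain ⟨P, rfl⟩ := exists_polyToU_smul v
  rw [vermaQuotientToFock_polyToU_smul] at hv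
  rw [polyToLaurent_injective (hv.trans (map_zero polyToLaurent).symm), map_zero, zero_smul]

theorem range_vermaQuotientToFock (hc : lam cartanC = 0) (hJ : lam cartanH = J)
    (hκ : lam cartanD = κ) :
    LinearMap.range (vermaQuotientToFock hc hJ hκ) = fockSub J κ isAdmissible_polyExpo := by
  apply le_antisymm
  · rintro _ ⟨v, rfl⟩
    obtain ⟨w, rfl⟩ := Submodule.Quotient.mk_surjective _ v
    exact vermaToFock_mem hc hJ hκ w
  · intro p hp
    obtain ⟨P, hP⟩ := exists_polyToLaurent_eq (mem_fockSub.mp hp)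
    exact ⟨polyToU P • vacuum lam, (vermaQuotientToFock_polyToU_smul hc hJ hκ P).trans hP⟩

/-- `M'(λ)` as the space of polynomials. -/
noncomputable def vermaHom (hc : lam cartanC = 0) (hJ : lam cartanH = J)
    (hκ : lam cartanD = κ) : VermaQuotient lam →+ Laurent :=
  (vermaQuotientToFock hc hJ hκ).toAddMonoidHom

theorem vermaHom_smul (hc : lam cartanC = 0) (hJ : lam cartanH = J) (hκ : lam cartanD = κ)
    (u : U) (v : VermaQuotient lam) :
    vermaHom hc hJ hκ (u • v) = fockRep J κ u (vermaHom hc hJ hκ v) :=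
  map_smul (vermaQuotientToFock hc hJ hκ) u v

theorem vermaHom_injective (hc : lam cartanC = 0) (hJ : lam cartanH = J) (hκ : lam cartanD = κ) :
    Function.Injective (vermaHom hc hJ hκ) := vermaQuotientToFock_injective hc hJ hκ

theorem range_vermaHom (hc : lam cartanC = 0) (hJ : lam cartanH = J) (hκ : lam cartanD = κ)
    (p : Laurent) : (∃ v, vermaHom hc hJ hκ v = p) ↔ p ∈ monoSpan polyExpo := by
  have h := range_vermaQuotientToFock hc hJ hκ
  exact (SetLike.ext_iff.mp h p)

end Verma

end AffineSl2

namespace AffineSl2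

/-! ### Localizations inside the Fock module -/

section Localization

variable (J κ : ℂ) (i : ℤ)

theorem fockRep_f_pow (n : ℕ) (w : Laurent) :
    fockRep J κ (ι (fₙ i) ^ n) w = xpow i n * w := by
  induction n with
  | zero => rw [pow_zero, map_one, Nat.cast_zero, xpow_zero, one_mul, Module.End.one_apply]
  | succ n ih =>
    rw [pow_succ', map_mul, Module.End.mul_apply, ih, fockRep_f, fop_apply, Nat.cast_succ, add_comm,
      xpow_add, mul_assoc]

theorem xpow_mul_xpow_neg_mul (r : ℂ) (w : Laurent) : xpow i r * (xpow i (-r) * w) = w := by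
  rw [← mul_assoc, xpow_mul_neg, one_mul]

theorem xpow_neg_mul_xpow_mul (r : ℂ) (w : Laurent) : xpow i (-r) * (xpow i r * w) = w := by
  rw [← mul_assoc, mul_comm (xpow i (-r)), xpow_mul_neg, one_mul]

theorem isUnit_fockRep (s : fPowers i) : IsUnit (fockRep J κ s) := by
  obtain ⟨_, n, rfl⟩ := s
  rw [Module.End.isUnit_iff]
  constructor
  · intro v w h
    have h' : fockRep J κ (ι (fₙ i) ^ n) v = fockRep J κ (ι (fₙ i) ^ n) w := h
    rw [fockRep_f_pow, fockRep_f_pow] at h'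
    rw [← xpow_neg_mul_xpow_mul i n v, h', xpow_neg_mul_xpow_mul]
  · exact fun w => ⟨xpow i (-n) * w, (fockRep_f_pow J κ i n _).trans (xpow_mul_xpow_neg_mul i _ w)⟩

/-- The powers of `fᵢ` as automorphisms of the Fock module. -/
noncomputable def fPowersUnits : fPowers i →* (Module.End ℂ Laurent)ˣ :=
  IsUnit.liftRight (((fockRep J κ) : U →* Module.End ℂ Laurent).comp (fPowers i).subtype)
    (isUnit_fockRep J κ i)

theorem coe_fPowersUnits (s : fPowers i) :
    (fPowersUnits J κ i s : Module.End ℂ Laurent) = fockRep J κ s := rfl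

theorem fPowersUnits_inv_apply {s : fPowers i} {n : ℕ} (hs : ι (fₙ i) ^ n = s) (w : Laurent) :
    ((fPowersUnits J κ i s)⁻¹ : (Module.End ℂ Laurent)ˣ).1 w = xpow i (-n) * w := by
  have h1 : (fPowersUnits J κ i s).1 (xpow i (-n) * w) = w := by
    rw [coe_fPowersUnits, ← hs, fockRep_f_pow, xpow_mul_xpow_neg_mul]
  conv_lhs => rw [← h1]
  rw [← Module.End.mul_apply, Units.inv_mul, Module.End.one_apply]

/-- The representation of the localization of `U`. -/
noncomputable def locRep : LocU i →+* Module.End ℂ Laurent :=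
  OreLocalization.universalHom (fockRep J κ : U →+* Module.End ℂ Laurent) (fPowersUnits J κ i)
    fun _ => rfl

theorem locRep_oreDiv (u : U) (s : fPowers i) : locRep J κ i (OreLocalization.oreDiv u s) =
    ((fPowersUnits J κ i s)⁻¹ : (Module.End ℂ Laurent)ˣ).1 * fockRep J κ u := rfl

theorem locRep_numerator (u : U) :
    locRep J κ i (OreLocalization.numeratorRingHom u) = fockRep J κ u :=
  OreLocalization.universalHom_commutes _ _ _

theorem locRep_smul (r : ℂ) (u : LocU i) : locRep J κ i (r • u) = r • locRep J κ i u := by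
  have h : algebraMap ℂ (LocU i) r = OreLocalization.numeratorRingHom (algebraMap ℂ U r) := rfl
  rw [Algebra.smul_def, map_mul, h, locRep_numerator, AlgHom.commutes, ← Algebra.smul_def]

theorem locRep_fUnit_inv (w : Laurent) :
    locRep J κ i (↑(fUnit i)⁻¹ : LocU i) w = xpow i (-1) * w := by
  have h1 : locRep J κ i (fUnit i : LocU i) (xpow i (-1) * w) = w := by
    rw [fUnit_val, locRep_numerator, fockRep_f, fop_apply, xpow_mul_xpow_neg_mul]
  conv_lhs => rw [← h1]
  rw [← Module.End.mul_apply, ← map_mul, Units.inv_mul, map_one, Module.End.one_apply]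

variable {J κ} {V : Type*} [AddCommGroup V] [Module U V] {φ : V →+ Laurent}
  (hφ : ∀ (u : U) (v : V), φ (u • v) = fockRep J κ u (φ v))

/-- The extension of a map to the Fock module to the localization. -/
noncomputable def locLift : Loc i V →+ Laurent where
  toFun := OreLocalization.liftExpand
    (fun v s => ((fPowersUnits J κ i s)⁻¹ : (Module.End ℂ Laurent)ˣ).1 (φ v)) (by
      intro v t s ht
      rw [hφ]
      set S := fPowersUnits J κ i s
      set T := fPowersUnits J κ i ⟨t * s, ht⟩
      have h1 : T.1 = fockRep J κ t * S.1 := map_mul (fockRep J κ) t s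
      have h2 : fockRep J κ t = T.1 * (S⁻¹).1 := by rw [h1, mul_assoc, Units.mul_inv, mul_one]
      rw [h2, ← Module.End.mul_apply, ← mul_assoc, Units.inv_mul, one_mul])
  map_zero' := by
    rw [← OreLocalization.zero_oreDiv (1 : fPowers i), OreLocalization.liftExpand_of, map_zero]
    exact map_zero _
  map_add' x y := by
    induction x using OreLocalization.ind with | _ v s
    induction y using OreLocalization.ind with | _ w t
    obtain ⟨r, q, h, h'⟩ := OreLocalization.oreDivAddChar' v w s t
    rw [h', OreLocalization.liftExpand_of, OreLocalization.liftExpand_of,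
      OreLocalization.liftExpand_of, map_add]
    set S := fPowersUnits J κ i s with hS
    set T := fPowersUnits J κ i t with hT
    set Q := fPowersUnits J κ i q with hQ
    have h1 : Q.1 * S.1 = fockRep J κ r * T.1 := by
      rw [hQ, hS, hT, coe_fPowersUnits, coe_fPowersUnits, coe_fPowersUnits, ← map_mul, ← map_mul, h]
    have h2 : fockRep J κ r = Q.1 * S.1 * (T⁻¹).1 := by rw [h1, mul_assoc, Units.mul_inv, mul_one]
    have h3 : φ (q • v) = fockRep J κ q (φ v) := hφ q v
    rw [map_mul, ← hS, ← hQ, h3, hφ, h2, mul_inv_rev, Units.val_mul]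
    change ((S⁻¹).1 * (Q⁻¹).1) (Q.1 (φ v) + (Q.1 * S.1 * (T⁻¹).1) (φ w)) = _
    rw [map_add, ← Module.End.mul_apply, ← Module.End.mul_apply, mul_assoc (S⁻¹).1 (Q⁻¹).1 Q.1,
      Units.inv_mul, mul_one, mul_assoc (S⁻¹).1, ← mul_assoc (Q⁻¹).1, ← mul_assoc (Q⁻¹).1, Units.inv_mul, one_mul,
      ← mul_assoc, Units.inv_mul, one_mul]

theorem locLift_oreDiv (v : V) (s : fPowers i) : locLift i hφ (OreLocalization.oreDiv v s) =
    ((fPowersUnits J κ i s)⁻¹ : (Module.End ℂ Laurent)ˣ).1 (φ v) := rfl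

theorem locLift_toLoc (v : V) : locLift i hφ (toLoc i V v) = φ v := by
  change locLift i hφ (OreLocalization.oreDiv v 1) = _
  rw [locLift_oreDiv, map_one, inv_one]
  rfl

theorem locLift_smul (u : LocU i) (v : Loc i V) :
    locLift i hφ (u • v) = locRep J κ i u (locLift i hφ v) := by
  induction u using OreLocalization.ind with | _ a s
  induction v using OreLocalization.ind with | _ v t
  obtain ⟨r, q, h, h'⟩ := OreLocalization.oreDivSMulChar' a v s t
  rw [h', locLift_oreDiv, locLift_oreDiv, locRep_oreDiv]
  set S := fPowersUnits J κ i s with hS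
  set T := fPowersUnits J κ i t with hT
  set Q := fPowersUnits J κ i q with hQ
  have h1 : Q.1 * fockRep J κ a = fockRep J κ r * T.1 := by
    rw [hQ, hT, coe_fPowersUnits, coe_fPowersUnits, ← map_mul, ← map_mul, h]
  have h2 : fockRep J κ r = Q.1 * fockRep J κ a * (T⁻¹).1 := by
    rw [h1, mul_assoc, Units.mul_inv, mul_one]
  rw [map_mul, ← hS, ← hQ, hφ, h2, mul_inv_rev, Units.val_mul]
  change ((S⁻¹).1 * (Q⁻¹).1 * (Q.1 * fockRep J κ a * (T⁻¹).1)) (φ v) =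
    ((S⁻¹).1 * fockRep J κ a * (T⁻¹).1) (φ v)
  rw [mul_assoc (S⁻¹).1, mul_assoc Q.1, ← mul_assoc (Q⁻¹).1, Units.inv_mul, one_mul, mul_assoc]

theorem locLift_injective (hinj : Function.Injective φ) : Function.Injective (locLift i hφ) := by
  refine (injective_iff_map_eq_zero _).mpr fun v hv => ?_
  induction v using OreLocalization.ind with | _ v t
  rw [locLift_oreDiv] at hv
  have h1 : φ v = 0 := by
    have := congrArg (fPowersUnits J κ i t).1 hv
    rwa [map_zero, ← Module.End.mul_apply, Units.mul_inv] at this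
  rw [hinj (h1.trans (map_zero φ).symm), OreLocalization.zero_oreDiv]

theorem range_locLift 
    (hr : ∀ p, (∃ v, φ v = p) ↔ p ∈ monoSpan polyExpo) (p : Laurent) :
    (∃ v, locLift i hφ v = p) ↔ p ∈ monoSpan (twistExpo i 0) := by
  constructor
  · rintro ⟨v, rfl⟩
    induction v using OreLocalization.ind with | _ v s
    obtain ⟨n, hn⟩ := s.2
    rw [locLift_oreDiv, fPowersUnits_inv_apply J κ i hn]
    have h1 : φ v ∈ monoSpan polyExpo := (hr _).mp ⟨v, rfl⟩
    have h2 := xpow_mul_mem (monoSpan_mono (polyExpo_subset_twistExpo i) h1) (-n)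
    have h3 := twistExpo_add_int i 0 (-n)
    push_cast at h3
    rwa [h3] at h2
  · intro hp
    obtain ⟨N, hN⟩ := exists_xpow_mul_mem_poly hp
    obtain ⟨v, hv⟩ := (hr _).mpr (hN N le_rfl)
    refine ⟨OreLocalization.oreDiv v ⟨ι (fₙ i) ^ N, Submonoid.pow_mem _ (Submonoid.mem_powers _) N⟩,
      ?_⟩
    rw [locLift_oreDiv, fPowersUnits_inv_apply J κ i (n := N) rfl, hv, xpow_neg_mul_xpow_mul]

end Localization

end AffineSl2

namespace AffineSl2

/-! ### Twisted localizations inside the Fock module -/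

theorem choose_two (z : ℂ) : Ring.choose z 2 = z * (z - 1) / 2 := by
  have h := Ring.descPochhammer_eq_factorial_smul_choose z 2
  simp [descPochhammer_succ_right, descPochhammer_zero, Polynomial.smeval_mul,
    Polynomial.smeval_sub, Polynomial.smeval_X] at h
  rw [eq_div_iff two_ne_zero, mul_comm, h]

theorem choose_neg_two (z : ℂ) : Ring.choose (-z) 2 = z * (z + 1) / 2 := by
  rw [choose_two]; ring

/-- Four powers of ad fᵢ suffice on the Lie algebra by `lie_f_pow_four`; in the Fock representation
the third one already vanishes, which leaves three terms. -/
theorem sum_range_four_choose (z : ℂ) (T : ℕ → Laurent) (h : T 3 = 0) :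
    ∑ j ∈ Finset.range 4, Ring.choose (-z) j • T j =
      T 0 - z • T 1 + (z * (z + 1) / 2) • T 2 := by
  simp only [Finset.sum_range_succ, Finset.sum_range_zero, h, Ring.choose_zero_right,
    Ring.choose_one_right, choose_neg_two]
  module

/-- The iterated commutators with `fᵢ`. -/
noncomputable def adF (i : ℤ) (A : Module.End ℂ Laurent) : Module.End ℂ Laurent :=
  fop i * A - A * fop i

theorem adF_apply (i : ℤ) (A : Module.End ℂ Laurent) (w : Laurent) :
    adF i A w = fop i (A w) - A (fop i w) := rfl

theorem adF_zero (i : ℤ) : adF i 0 = 0 := by simp [adF]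

theorem adF_add (i : ℤ) (A B : Module.End ℂ Laurent) : adF i (A + B) = adF i A + adF i B := by
  simp only [adF, mul_add, add_mul]; abel

theorem adF_smul (i : ℤ) (r : ℂ) (A : Module.End ℂ Laurent) : adF i (r • A) = r • adF i A := by
  simp only [adF, mul_smul_comm, smul_mul_assoc, smul_sub]

theorem adF_fop (i m : ℤ) : adF i (fop m) = 0 := by
  refine LinearMap.ext fun w => ?_
  rw [adF_apply, fop_apply, fop_apply, fop_apply, fop_apply, LinearMap.zero_apply]
  ring

theorem adF_hop (J : ℂ) (i m : ℤ) : adF i (hop J m) = (2 : ℂ) • fop (m + i) := by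
  refine LinearMap.ext fun w => ?_
  rw [adF_apply, smul_op_apply, ← neg_sub, hop_fop, neg_smul, neg_neg]

theorem adF_eop (J : ℂ) (i m : ℤ) : adF i (eop J m) = -hop J (m + i) := by
  refine LinearMap.ext fun w => ?_
  rw [adF_apply, LinearMap.neg_apply, ← neg_sub, eop_fop]

theorem adF_dop (κ : ℂ) (i : ℤ) : adF i (dop κ) = -(i : ℂ) • fop i := by
  refine LinearMap.ext fun w => ?_
  rw [adF_apply, smul_op_apply, ← neg_sub, dop_fop, neg_smul]

/-- The conjugate of `A` by `xᵢ ^ z` is the generalized conjugation. -/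
def IsConjugable (i : ℤ) (z : ℂ) (A : Module.End ℂ Laurent) : Prop :=
  ∀ w, A (xpow i z * w) =
    xpow i z * ∑ j ∈ Finset.range 4, Ring.choose (-z) j • (adF i)^[j] A (xpow i (-j) * w)

theorem IsConjugable.add {i : ℤ} {z : ℂ} {A B : Module.End ℂ Laurent} (hA : IsConjugable i z A)
    (hB : IsConjugable i z B) : IsConjugable i z (A + B) := fun w => by
  have h : ∀ j, (adF i)^[j] (A + B) = (adF i)^[j] A + (adF i)^[j] B := by
    intro j
    induction j with
    | zero => rfl
    | succ j ih => rw [Function.iterate_succ_apply', ih, adF_add, Function.iterate_succ_apply',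
        Function.iterate_succ_apply']
  simp only [h, LinearMap.add_apply, smul_add, Finset.sum_add_distrib, mul_add, hA w, hB w]

theorem IsConjugable.smul {i : ℤ} {z : ℂ} (r : ℂ) {A : Module.End ℂ Laurent}
    (hA : IsConjugable i z A) : IsConjugable i z (r • A) := fun w => by
  have h : ∀ j, (adF i)^[j] (r • A) = r • (adF i)^[j] A := by
    intro j
    induction j with
    | zero => rfl
    | succ j ih => rw [Function.iterate_succ_apply', ih, adF_smul, Function.iterate_succ_apply']
  simp only [h, smul_op_apply, hA w]
  rw [← mul_smul_comm, Finset.smul_sum]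
  simp only [smul_comm r]

theorem isConjugable_of {i : ℤ} {z : ℂ} {A : Module.End ℂ Laurent}
    (h3 : adF i (adF i (adF i A)) = 0)
    (h : ∀ w, A (xpow i z * w) = xpow i z * (A w - z • adF i A (xpow i (-1) * w) +
      (z * (z + 1) / 2) • adF i (adF i A) (xpow i (-2) * w))) : IsConjugable i z A := fun w => by
  rw [sum_range_four_choose z (fun j => (adF i)^[j] A (xpow i (-j) * w)), h]
  · simp only [Function.iterate_succ, Function.iterate_zero, Function.comp_apply, id_eq,
      Nat.cast_zero, Nat.cast_one, Nat.cast_ofNat, neg_zero, xpow_zero, one_mul]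
  · change adF i (adF i (adF i A)) _ = 0
    rw [h3]; rfl

theorem isConjugable_fop (i : ℤ) (z : ℂ) (m : ℤ) : IsConjugable i z (fop m) := by
  refine isConjugable_of (by rw [adF_fop, adF_zero, adF_zero]) fun w => ?_
  rw [adF_fop, adF_zero, LinearMap.zero_apply, LinearMap.zero_apply, smul_zero, smul_zero, add_zero,
    sub_zero, fop_apply, fop_apply]
  ring

theorem isConjugable_hop (J : ℂ) (i : ℤ) (z : ℂ) (m : ℤ) : IsConjugable i z (hop J m) := by
  refine isConjugable_of (by rw [adF_hop, adF_smul, adF_fop, smul_zero, adF_zero]) fun w => ?_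
  rw [adF_hop, adF_smul, adF_fop, smul_zero, LinearMap.zero_apply, smul_zero, add_zero,
    hop_xpow_mul, smul_op_apply, fop_apply, add_comm m i, smul_smul]
  congr 2
  rw [mul_comm z 2]
  congr 1
  ring

theorem isConjugable_dop (κ : ℂ) (i : ℤ) (z : ℂ) : IsConjugable i z (dop κ) := by
  refine isConjugable_of (by rw [adF_dop, adF_smul, adF_fop, smul_zero, adF_zero]) fun w => ?_
  rw [adF_dop, adF_smul, adF_fop, smul_zero, LinearMap.zero_apply, smul_zero, add_zero,
    dop_xpow_mul, smul_op_apply, fop_apply, xpow_mul_xpow_neg_mul]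
  congr 1
  module

theorem adF_neg (i : ℤ) (A : Module.End ℂ Laurent) : adF i (-A) = -adF i A := by
  refine LinearMap.ext fun w => ?_
  simp only [adF_apply, LinearMap.neg_apply, map_neg, neg_sub]
  ring

/-- The two corrections in `eop_xpow_mul` are the first and second commutators with fᵢ, namely -hₘ₊ᵢ
and -2 fₘ₊₂ᵢ, with coefficients rearranged into binomial ones. -/
theorem isConjugable_eop (J : ℂ) (i : ℤ) (z : ℂ) (m : ℤ) : IsConjugable i z (eop J m) := by
  have h2 : adF i (adF i (eop J m)) = -((2 : ℂ) • fop (m + i + i)) := by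
    rw [adF_eop, adF_neg, adF_hop]
  refine isConjugable_of (by rw [h2, adF_neg, adF_smul, adF_fop, smul_zero, neg_zero]) fun w => ?_
  have h3 : xpow i (-2) = xpow i (-1) * xpow i (-1) := by rw [← xpow_add]; norm_num
  rw [h2, adF_eop, LinearMap.neg_apply, LinearMap.neg_apply, smul_op_apply, fop_apply,
    eop_xpow_mul, hop_xpow_mul, h3, show i + (m + i) = 2 * i + m by ring,
    show m + i + i = 2 * i + m by ring]
  have h4 : ∀ v : Laurent, (z * (z + 1) / 2) • -((2 : ℂ) • v) = -((z * (z + 1)) • v) := by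
    intro v; module
  rw [h4]
  simp only [Algebra.smul_def, map_mul, map_sub, map_add, map_neg, map_ofNat, map_one]
  ring

variable (J κ : ℂ) (i : ℤ)

theorem isConjugable_affineOp (z : ℂ) (x : AffineSl2) : IsConjugable i z (affineOp J κ x) := by
  induction x using affine_induction with
  | add x y hx hy => rw [map_add]; exact hx.add hy
  | smul r x hx => rw [map_smul]; exact hx.smul r
  | he n => rw [← fockRep_ι, fockRep_e]; exact isConjugable_eop J i z n
  | hf n => rw [← fockRep_ι, fockRep_f]; exact isConjugable_fop i z n
  | hh n => rw [← fockRep_ι, fockRep_h]; exact isConjugable_hop J i z n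
  | hc => rw [← fockRep_ι, fockRep_c]; simpa using (isConjugable_fop i z 0).smul 0
  | hd => rw [← fockRep_ι, fockRep_d]; exact isConjugable_dop κ i z

theorem adMap_numerator (u : U) : adMap (fUnit i : LocU i) (OreLocalization.numeratorRingHom u) =
    OreLocalization.numeratorRingHom (adMap (ι (fₙ i)) u) := by
  rw [adMap_apply, adMap_apply, map_sub, map_mul, map_mul, fUnit_val]

theorem adMap_pow_numerator (u : U) (n : ℕ) :
    (adMap (fUnit i : LocU i) ^ n) (OreLocalization.numeratorRingHom u) =
      OreLocalization.numeratorRingHom ((adMap (ι (fₙ i)) ^ n) u) := by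
  induction n with
  | zero => rfl
  | succ n ih => rw [pow_succ', Module.End.mul_apply, ih, adMap_numerator, ← Module.End.mul_apply,
      ← pow_succ']

theorem adMap_pow_four_ι (x : AffineSl2) : (adMap (ι (fₙ i)) ^ 4) (ι x) = 0 := by
  have had : ∀ x : AffineSl2, adMap (ι (fₙ i)) (ι x) = ι ⁅fₙ i, x⁆ := fun x => by
    rw [ι_lie, adMap_apply]
  simp only [pow_succ, pow_zero, one_mul, Module.End.mul_apply, had]
  rw [lie_f_pow_four, map_zero]

theorem fockRep_adMap_pow (u : U) (n : ℕ) :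
    fockRep J κ ((adMap (ι (fₙ i)) ^ n) u) = (adF i)^[n] (fockRep J κ u) := by
  induction n with
  | zero => rfl
  | succ n ih => rw [pow_succ', Module.End.mul_apply, adMap_apply, map_sub, map_mul, map_mul, ih,
      fockRep_f, Function.iterate_succ_apply', adF]

theorem locRep_fUnit_inv_pow (n : ℕ) (w : Laurent) :
    locRep J κ i ((↑(fUnit i)⁻¹ : LocU i) ^ n) w = xpow i (-n) * w := by
  induction n with
  | zero => rw [pow_zero, map_one, Nat.cast_zero, neg_zero, xpow_zero, one_mul,
      Module.End.one_apply]
  | succ n ih => rw [pow_succ', map_mul, Module.End.mul_apply, ih, locRep_fUnit_inv, ← mul_assoc,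
      ← xpow_add, Nat.cast_succ, neg_add, add_comm]

/-- In the Fock space the power xᵢ ^ z exists for complex z, and Θ₋ᵤ with u = z is conjugation by
it. Both sides are multiplicative in `u`, so the generators suffice. This makes fᵢ^z v ↦ xᵢ ^ z v
linear over `U`. -/
theorem locRep_theta (z : ℂ) (u : U) (w : Laurent) :
    xpow i z * locRep J κ i (Θ i (-z) (OreLocalization.numeratorRingHom u)) w =
      fockRep J κ u (xpow i z * w) := by
  let T : Subalgebra ℂ U :=
    { carrier := {u | ∀ w, xpow i z * locRep J κ i (Θ i (-z) (OreLocalization.numeratorRingHom u)) w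
        = fockRep J κ u (xpow i z * w)}
      mul_mem' := fun {u v} hu hv w => by
        rw [map_mul, map_mul, map_mul, Module.End.mul_apply, hu, hv, map_mul (fockRep J κ),
          Module.End.mul_apply]
      add_mem' := fun {u v} hu hv w => by
        rw [map_add, map_add, map_add, LinearMap.add_apply, mul_add, hu, hv, map_add,
          LinearMap.add_apply]
      algebraMap_mem' := fun r w => by
        have h1 : (adMap (fUnit i : LocU i) ^ 1)
            (OreLocalization.numeratorRingHom (algebraMap ℂ U r)) = 0 := by
          rw [pow_one, adMap_numerator, adMap_apply, Algebra.commutes, sub_self, map_zero]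
        have h2 : Θ i (-z) (OreLocalization.numeratorRingHom (algebraMap ℂ U r)) =
            OreLocalization.numeratorRingHom (algebraMap ℂ U r) :=
          (thetaFun_eq_sum h1 le_rfl (-z)).trans (by simp)
        rw [h2, locRep_numerator, AlgHom.commutes, Module.algebraMap_end_apply,
          Module.algebraMap_end_apply, mul_smul_comm] }
  refine mem_of_ι_mem T (fun x w => ?_) u w
  have h1 : (adMap (fUnit i : LocU i) ^ 4) (OreLocalization.numeratorRingHom (ι x)) = 0 := by
    rw [adMap_pow_numerator, adMap_pow_four_ι, map_zero]
  have h2 : Θ i (-z) (OreLocalization.numeratorRingHom (ι x)) = _ :=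
    thetaFun_eq_sum h1 le_rfl (-z)
  rw [h2, map_sum, LinearMap.sum_apply, fockRep_ι, isConjugable_affineOp J κ i z x w]
  congr 1
  refine Finset.sum_congr rfl fun j _ => ?_
  rw [locRep_smul, smul_op_apply, map_mul, Module.End.mul_apply, adMap_pow_numerator,
    locRep_numerator, fockRep_adMap_pow, locRep_fUnit_inv_pow, fockRep_ι]

variable {J κ} {V : Type*} [AddCommGroup V] [Module U V] {φ : V →+ Laurent}
  (hφ : ∀ (u : U) (v : V), φ (u • v) = fockRep J κ u (φ v)) (z : ℂ)

/-- The embedding of the twisted localization. -/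
noncomputable def twistLift : TwistedLoc i z V →+ Laurent :=
  (LinearMap.mulLeft ℂ (xpow i z)).toAddMonoidHom.comp (locLift i hφ)

theorem twistLift_apply (v : Loc i V) : twistLift i hφ z v = xpow i z * locLift i hφ v := rfl

theorem twistLift_smul (u : U) (v : TwistedLoc i z V) :
    twistLift i hφ z (u • v) = fockRep J κ u (twistLift i hφ z v) := by
  have h : twistLift i hφ z (u • v) = xpow i z *
    locLift i hφ (Θ i (-z) (OreLocalization.numeratorRingHom u) • (show Loc i V from v)) := rfl
  rw [h, locLift_smul, locRep_theta]
  rfl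

theorem twistLift_injective (hinj : Function.Injective φ) :
    Function.Injective (twistLift i hφ z) := fun v w h => by
  have h' : xpow i z * locLift i hφ v = xpow i z * locLift i hφ w := h
  apply locLift_injective i hφ hinj
  rw [← xpow_neg_mul_xpow_mul i z (locLift i hφ v), h', xpow_neg_mul_xpow_mul]

theorem range_twistLift (hr : ∀ p, (∃ v, φ v = p) ↔ p ∈ monoSpan polyExpo) (p : Laurent) :
    (∃ v, twistLift i hφ z v = p) ↔ p ∈ monoSpan (twistExpo i z) := by
  constructor
  · rintro ⟨v, rfl⟩
    have h := xpow_mul_mem ((range_locLift i hφ hr _).mp ⟨v, rfl⟩) z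
    rwa [zero_add] at h
  · intro hp
    have h := xpow_mul_mem hp (-z)
    rw [add_neg_cancel] at h
    obtain ⟨v, hv⟩ := (range_locLift i hφ hr _).mpr h
    exact ⟨v, by rw [twistLift_apply, hv, xpow_mul_xpow_neg_mul]⟩

end AffineSl2

namespace AffineSl2

/-! ### Modules presented by monomials -/

/-- A presentation of the `U`-module `V` as the quotient of the span of the monomials with exponents
in `S` by the span of those with exponents in `S'`. -/
structure Presentation (J κ : ℂ) (S S' : Set Expo) (V : Type*) [AddCommGroup V] [Module U V] where
  map : monoSpan S →+ V
  -- The image is a separate variable `q`, so stability of `monoSpan S` under the action need not be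
  -- part of the data.
  smul_map : ∀ (u : U) (p q : monoSpan S), q.1 = fockRep J κ u p → u • map p = map q
  surjective : Function.Surjective map
  map_eq_zero_iff : ∀ p, map p = 0 ↔ p.1 ∈ monoSpan S'

namespace Presentation

variable {J κ : ℂ} {S S' : Set Expo} {V : Type*} [AddCommGroup V] [Module U V]

/-- The presentation of a quotient of a module embedded into the generalized Laurent polynomials. -/
noncomputable def ofEmbedding {L : Type*} [AddCommGroup L] [Module U L] (ψ : L →+ Laurent)
    (hψ : ∀ (u : U) (v : L), ψ (u • v) = fockRep J κ u (ψ v)) (hinj : Function.Injective ψ)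
    (hr : ∀ p, (∃ v, ψ v = p) ↔ p ∈ monoSpan S) (π : L →ₗ[U] V) (hπ : Function.Surjective π)
    (hker : ∀ v, π v = 0 ↔ ψ v ∈ monoSpan S') : Presentation J κ S S' V where
  map :=
    { toFun := fun p => π ((hr p).mpr p.2).choose
      map_zero' := by
        rw [hker, ((hr _).mpr (0 : monoSpan S).2).choose_spec]
        exact Submodule.zero_mem _
      map_add' := fun p q => by
        rw [← map_add]
        congr 1
        apply hinj
        rw [map_add, ((hr _).mpr (p + q).2).choose_spec, ((hr _).mpr p.2).choose_spec,
          ((hr _).mpr q.2).choose_spec]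
        rfl }
  smul_map u p q h := by
    change u • π _ = π _
    rw [← map_smul]
    congr 1
    apply hinj
    rw [hψ, ((hr _).mpr p.2).choose_spec, ((hr _).mpr q.2).choose_spec, h]
  surjective v := by
    obtain ⟨x, rfl⟩ := hπ v
    refine ⟨⟨ψ x, (hr _).mp ⟨x, rfl⟩⟩, ?_⟩
    change π _ = π x
    congr 1
    apply hinj
    exact (⟨x, rfl⟩ : ∃ v, ψ v = ψ x).choose_spec
  map_eq_zero_iff p := by
    change π _ = 0 ↔ _
    rw [hker, ((hr p.1).mpr p.2).choose_spec]

variable (P : Presentation J κ S S' V)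
include P

theorem map_smul (r : ℂ) (p : monoSpan S) : P.map (r • p) = algebraMap ℂ U r • P.map p :=
  (P.smul_map _ p (r • p) (by
    rw [AlgHom.commutes, Module.algebraMap_end_apply]; rfl)).symm

theorem map_ne_zero {p : monoSpan S} (hp : P.map p ≠ 0) : ∃ a, p.1.coeff a ≠ 0 ∧ a ∉ S' := by
  by_contra! h
  exact hp ((P.map_eq_zero_iff p).mpr h)

theorem map_mono_ne_zero {a : Expo} (ha : a ∈ S) (ha' : a ∉ S') :
    P.map ⟨mono a, mono_mem_monoSpan.mpr ha⟩ ≠ 0 := fun h =>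
  ha' (mono_mem_monoSpan.mp ((P.map_eq_zero_iff _).mp h))

theorem coeff_eq_of_map_eq {p q : monoSpan S} (h : P.map p = P.map q) {a : Expo} (ha : a ∉ S') :
    p.1.coeff a = q.1.coeff a := by
  have h1 : P.map (p - q) = 0 := by rw [map_sub, h, sub_self]
  rw [P.map_eq_zero_iff] at h1
  by_contra h2
  exact ha (h1 a (sub_ne_zero.mpr h2))

/-- The coefficient of a monomial. -/
noncomputable def coord {a : Expo} (ha : a ∉ S') : RestrictScalars ℂ U V →ₗ[ℂ] ℂ where
  toFun v := (Function.surjInv P.surjective (RestrictScalars.addEquiv ℂ U V v)).1.coeff a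
  map_add' v w := by
    refine P.coeff_eq_of_map_eq
      (q := Function.surjInv P.surjective (RestrictScalars.addEquiv ℂ U V v) +
        Function.surjInv P.surjective (RestrictScalars.addEquiv ℂ U V w)) ?_ ha
    rw [map_add P.map, Function.surjInv_eq P.surjective, Function.surjInv_eq P.surjective,
      Function.surjInv_eq P.surjective, map_add]
  map_smul' r v := by
    refine P.coeff_eq_of_map_eq (q := r • _) ?_ ha
    rw [P.map_smul, Function.surjInv_eq P.surjective, Function.surjInv_eq P.surjective,
      RestrictScalars.addEquiv_map_smul]

theorem coord_map {a : Expo} (ha : a ∉ S') (p : monoSpan S) :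
    P.coord ha ((RestrictScalars.addEquiv ℂ U V).symm (P.map p)) = p.1.coeff a :=
  P.coeff_eq_of_map_eq (Function.surjInv_eq P.surjective _) ha

theorem eq_of_coord {v w : RestrictScalars ℂ U V}
    (h : ∀ a (ha : a ∉ S'), P.coord ha v = P.coord ha w) : v = w := by
  obtain ⟨p, hp⟩ := P.surjective (RestrictScalars.addEquiv ℂ U V v)
  obtain ⟨q, hq⟩ := P.surjective (RestrictScalars.addEquiv ℂ U V w)
  obtain rfl : v = (RestrictScalars.addEquiv ℂ U V).symm (P.map p) := by rw [hp]; rfl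
  obtain rfl : w = (RestrictScalars.addEquiv ℂ U V).symm (P.map q) := by rw [hq]; rfl
  congr 1
  rw [← sub_eq_zero, ← map_sub, P.map_eq_zero_iff]
  intro a ha
  by_contra ha'
  have h1 := h a ha'
  rw [P.coord_map, P.coord_map] at h1
  exact ha (sub_eq_zero.mpr h1)

section Weight

variable {lam : Module.Dual ℂ cartan} (hc : lam cartanC = 0) (hJ : lam cartanH = J)
  (hκ : lam cartanD = κ)
include hc hJ hκ

theorem hasWeight_map_mono {a : Expo} (ha : a ∈ S) :
    HasWeight (monoWeight lam a) (P.map ⟨mono a, mono_mem_monoSpan.mpr ha⟩) := fun H => by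
  rw [← P.map_smul]
  refine P.smul_map _ _ _ ?_
  rw [fockRep_ι, affineOp_cartan_mono hc hJ hκ]
  rfl

theorem monoWeight_eq {μ : Module.Dual ℂ cartan} {p : monoSpan S} (hp : HasWeight μ (P.map p))
    {a : Expo} (ha : p.1.coeff a ≠ 0) (ha' : a ∉ S') : monoWeight lam a = μ := by
  refine LinearMap.ext fun H => ?_
  have hmem : affineOp J κ H p.1 ∈ monoSpan S := by
    intro b hb
    refine p.2 b fun h0 => hb ?_
    rw [← coeffAt_apply, coeffAt_affineOp_cartan hc hJ hκ, coeffAt_apply, h0, mul_zero]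
  have h1 := P.smul_map (ι (H : AffineSl2)) p ⟨_, hmem⟩ (by rw [fockRep_ι])
  rw [hp H, ← P.map_smul] at h1
  have h2 := P.coeff_eq_of_map_eq h1 ha'
  have h3 : μ H * p.1.coeff a = monoWeight lam a H * p.1.coeff a :=
    h2.trans (coeffAt_affineOp_cartan hc hJ hκ H a p.1)
  exact (mul_right_cancel₀ ha h3).symm

theorem coord_eq_zero {μ : Module.Dual ℂ cartan} {v : RestrictScalars ℂ U V}
    (hv : v ∈ weightSpace V μ) {a : Expo} (ha : a ∉ S') (hμ : monoWeight lam a ≠ μ) :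
    P.coord ha v = 0 := by
  obtain ⟨p, hp⟩ := P.surjective (RestrictScalars.addEquiv ℂ U V v)
  obtain rfl : v = (RestrictScalars.addEquiv ℂ U V).symm (P.map p) := by rw [hp]; rfl
  rw [P.coord_map]
  by_contra h
  exact hμ (P.monoWeight_eq hc hJ hκ hv h ha)

theorem isWeightModule : IsWeightModule V := by
  let _ := Classical.decEq (Module.Dual ℂ cartan)
  refine ⟨fun f g hfg => ?_, fun v => ?_⟩
  -- Directness: each coordinate sees only the component whose weight is that of its monomial, and
  -- the coordinates separate vectors.
  · have hcoord : ∀ a (ha : a ∉ S') (f : DirectSum _ fun μ => weightSpace V μ),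
        P.coord ha (DirectSum.coeAddMonoidHom (weightSpace V) f) =
          P.coord ha (f (monoWeight lam a)).1 := by
      intro a ha f
      induction f using DirectSum.induction_on with
      | zero => simp
      | add f g hf hg =>
        rw [map_add, map_add, hf, hg, ← map_add]
        rfl
      | of μ x =>
        rw [DirectSum.coeAddMonoidHom_of]
        by_cases h : monoWeight lam a = μ
        · subst h
          rw [DirectSum.of_eq_same]
        · rw [DirectSum.of_eq_of_ne _ _ _ h, P.coord_eq_zero hc hJ hκ x.2 ha h]
          exact (map_zero (P.coord ha)).symm
    refine DFinsupp.ext fun μ => Subtype.ext (P.eq_of_coord fun a ha => ?_)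
    by_cases h : monoWeight lam a = μ
    · subst h
      rw [← hcoord, ← hcoord, hfg]
    · rw [P.coord_eq_zero hc hJ hκ (f μ).2 ha h, P.coord_eq_zero hc hJ hκ (g μ).2 ha h]
  · suffices h : v ∈ ⨆ μ, weightSpace V μ by
      rw [Submodule.iSup_eq_range_dfinsupp_lsum] at h
      exact h
    obtain ⟨p, hp⟩ := P.surjective (RestrictScalars.addEquiv ℂ U V v)
    obtain rfl : v = (RestrictScalars.addEquiv ℂ U V).symm (P.map p) := by rw [hp]; rfl
    let W : Submodule ℂ Laurent :=
      { carrier := {q | ∃ h : q ∈ monoSpan S,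
          (RestrictScalars.addEquiv ℂ U V).symm (P.map ⟨q, h⟩) ∈ ⨆ μ, weightSpace V μ}
        add_mem' := by
          rintro q r ⟨hq, hq'⟩ ⟨hr, hr'⟩
          refine ⟨Submodule.add_mem _ hq hr, ?_⟩
          have : P.map ⟨q + r, Submodule.add_mem _ hq hr⟩ = P.map ⟨q, hq⟩ + P.map ⟨r, hr⟩ :=
            map_add P.map ⟨q, hq⟩ ⟨r, hr⟩
          rw [this, map_add]
          exact Submodule.add_mem _ hq' hr'
        zero_mem' := ⟨Submodule.zero_mem _, by
          have : P.map ⟨0, Submodule.zero_mem _⟩ = 0 := map_zero P.map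
          rw [this, map_zero]
          exact Submodule.zero_mem _⟩
        smul_mem' := by
          rintro r q ⟨hq, hq'⟩
          refine ⟨Submodule.smul_mem _ r hq, ?_⟩
          have : P.map ⟨r • q, Submodule.smul_mem _ r hq⟩ = algebraMap ℂ U r • P.map ⟨q, hq⟩ :=
            P.map_smul r ⟨q, hq⟩
          rw [this]
          exact Submodule.smul_mem _ r hq' }
    have hW : monoSpan S ≤ W := monoSpan_le fun a ha => ⟨mono_mem_monoSpan.mpr ha,
      Submodule.mem_iSup_of_mem (monoWeight lam a) (P.hasWeight_map_mono hc hJ hκ ha)⟩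
    exact (hW p.2).2

theorem mem_support_iff {μ : Module.Dual ℂ cartan} :
    μ ∈ support V ↔ ∃ a ∈ S, a ∉ S' ∧ monoWeight lam a = μ := by
  rw [support, Set.mem_ofPred_eq, Submodule.ne_bot_iff]
  constructor
  · rintro ⟨v, hv, hne⟩
    obtain ⟨p, hp⟩ := P.surjective (RestrictScalars.addEquiv ℂ U V v)
    obtain rfl : v = (RestrictScalars.addEquiv ℂ U V).symm (P.map p) := by rw [hp]; rfl
    obtain ⟨a, ha, ha'⟩ := P.map_ne_zero (p := p) (fun h0 => hne (by rw [h0, map_zero]))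
    exact ⟨a, p.2 a ha, ha', P.monoWeight_eq hc hJ hκ hv ha ha'⟩
  · rintro ⟨a, ha, ha', rfl⟩
    exact ⟨_, P.hasWeight_map_mono hc hJ hκ ha, P.map_mono_ne_zero ha ha'⟩

theorem not_finite_weightSpace {μ : Module.Dual ℂ cartan} {a : ℕ → Expo}
    (hinj : Function.Injective a) (ha : ∀ n, a n ∈ S) (ha' : ∀ n, a n ∉ S')
    (hμ : ∀ n, monoWeight lam (a n) = μ) : ¬ Module.Finite ℂ (weightSpace V μ) := by
  intro hfin
  let v : ℕ → weightSpace V μ := fun n =>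
    ⟨(RestrictScalars.addEquiv ℂ U V).symm (P.map ⟨mono (a n), mono_mem_monoSpan.mpr (ha n)⟩),
      hμ n ▸ P.hasWeight_map_mono hc hJ hκ (ha n)⟩
  refine Module.Finite.not_linearIndependent_of_infinite (R := ℂ) v ?_
  have h : ∀ n (l : ℕ →₀ ℂ), P.coord (ha' n) (Finsupp.linearCombination ℂ v l).1 = l n := by
    intro n l
    induction l using Finsupp.induction_linear with
    | zero => rw [map_zero]; exact map_zero (P.coord (ha' n))
    | add l l' hl hl' =>
      rw [map_add (Finsupp.linearCombination ℂ v), Finsupp.add_apply, ← hl, ← hl',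
        ← map_add (P.coord (ha' n))]
      rfl
    | single m r =>
      have h1 : P.coord (ha' n) (v m).1 = (mono (a m)).coeff (a n) := P.coord_map _ _
      rw [Finsupp.linearCombination_single, Submodule.coe_smul, LinearMap.map_smul, h1, smul_eq_mul]
      rcases eq_or_ne m n with rfl | hmn
      · rw [coeff_mono_self, mul_one, Finsupp.single_eq_same]
      · rw [coeff_mono_of_ne (hinj.ne hmn), mul_zero, Finsupp.single_eq_of_ne hmn.symm]
  intro l l' hll
  ext n
  rw [← h, ← h, hll]

end Weight

theorem actsInjectively_iff (hS : IsAdmissible S) (x : AffineSl2) :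
    ActsInjectively V x ↔
      ∀ p ∈ monoSpan S, p ∉ monoSpan S' → fockRep J κ (ι x) p ∉ monoSpan S' := by
  have hmem := fockRep_mem (κ := κ) (hS.isStable J) (fun _ => dop_mem κ) (ι x)
  constructor
  · intro h p hp hp' hx
    have h1 := P.smul_map (ι x) ⟨p, hp⟩ ⟨_, hmem p hp⟩ rfl
    rw [(P.map_eq_zero_iff ⟨_, hmem p hp⟩).mpr hx] at h1
    exact hp' ((P.map_eq_zero_iff ⟨p, hp⟩).mp (h (h1.trans (smul_zero _).symm)))
  · intro h v w hvw
    obtain ⟨p, hp⟩ := P.surjective (v - w)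
    have h1 : ι x • P.map p = 0 := by rw [hp, smul_sub, sub_eq_zero]; exact hvw
    rw [P.smul_map (ι x) p ⟨_, hmem p p.2⟩ rfl, P.map_eq_zero_iff] at h1
    have h2 : p.1 ∈ monoSpan S' := by
      by_contra hne
      exact h p p.2 hne h1
    rw [← sub_eq_zero, ← hp, P.map_eq_zero_iff]
    exact h2

/-- Submodules pull back along the presentation to stable subspaces of `monoSpan S`, and nonzero
ones contain a vector outside `monoSpan S'`. -/
theorem isSimpleModule (hS : IsAdmissible S) (hne : ∃ a ∈ S, a ∉ S')
    (h : ∀ W : Submodule ℂ Laurent, IsStable J W → W ≤ monoSpan S →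
      ∀ p ∈ W, p ∉ monoSpan S' → monoSpan S ≤ W) : IsSimpleModule U V := by
  have hmem := fun u => fockRep_mem (κ := κ) (hS.isStable J) (fun _ => dop_mem κ) u
  have hnt : Nontrivial V := by
    obtain ⟨a, ha, ha'⟩ := hne
    exact ⟨_, 0, P.map_mono_ne_zero ha ha'⟩
  rw [isSimpleModule_iff]
  refine { eq_bot_or_eq_top := fun N => ?_ }
  rw [or_iff_not_imp_left]
  intro hN
  obtain ⟨v, hv, hv0⟩ := N.ne_bot_iff.mp hN
  let W : Submodule ℂ Laurent :=
    { carrier := {q | ∃ h : q ∈ monoSpan S, P.map ⟨q, h⟩ ∈ N}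
      add_mem' := by
        rintro q r ⟨hq, hq'⟩ ⟨hr, hr'⟩
        refine ⟨Submodule.add_mem _ hq hr, ?_⟩
        have : P.map ⟨q + r, Submodule.add_mem _ hq hr⟩ = P.map ⟨q, hq⟩ + P.map ⟨r, hr⟩ :=
          map_add P.map ⟨q, hq⟩ ⟨r, hr⟩
        rw [this]
        exact N.add_mem hq' hr'
      zero_mem' := ⟨Submodule.zero_mem _, by
        have : P.map ⟨0, Submodule.zero_mem _⟩ = 0 := map_zero P.map
        rw [this]
        exact N.zero_mem⟩
      smul_mem' := by
        rintro r q ⟨hq, hq'⟩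
        refine ⟨Submodule.smul_mem _ r hq, ?_⟩
        have : P.map ⟨r • q, Submodule.smul_mem _ r hq⟩ = algebraMap ℂ U r • P.map ⟨q, hq⟩ :=
          P.map_smul r ⟨q, hq⟩
        rw [this]
        exact N.smul_mem _ hq' }
  have hWs : ∀ (u : U), ∀ q ∈ W, fockRep J κ u q ∈ W := by
    rintro u q ⟨hq, hq'⟩
    refine ⟨hmem u q hq, ?_⟩
    rw [← P.smul_map u ⟨q, hq⟩ ⟨_, hmem u q hq⟩ rfl]
    exact N.smul_mem u hq'
  have hWst : IsStable J W := by
    refine ⟨fun m q hq => ?_, fun m q hq => ?_, fun m q hq => ?_⟩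
    · rw [← fockRep_e J κ]; exact hWs _ q hq
    · rw [← fockRep_f J κ]; exact hWs _ q hq
    · rw [← fockRep_h J κ]; exact hWs _ q hq
  obtain ⟨p, rfl⟩ := P.surjective v
  have hle := h W hWst (fun q hq => hq.1) p ⟨p.2, hv⟩ fun hp => hv0 ((P.map_eq_zero_iff p).mpr hp)
  rw [eq_top_iff]
  rintro w -
  obtain ⟨q, rfl⟩ := P.surjective w
  exact (hle q.2).2

end Presentation

/-! ### Nilpotent vectors -/

theorem e_sq : (e.1 * e.1 : Matrix (Fin 2) (Fin 2) ℂ) = 0 := by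
  simp [e]

theorem lie_e_lie_e_lie_e (a : Sl2) : ⁅e, ⁅e, ⁅e, a⁆⁆⁆ = 0 := by
  apply Subtype.ext
  simp only [LieAlgebra.SpecialLinear.sl_bracket]
  have h1 : ∀ x : Matrix (Fin 2) (Fin 2) ℂ, e.1 * (e.1 * x) = 0 := fun x => by
    rw [← mul_assoc, e_sq, zero_mul]
  simp only [mul_sub, sub_mul, mul_assoc, h1, e_sq, mul_zero]
  simp

theorem lie_e_pow_four (i : ℤ) (x : AffineSl2) : ⁅eₙ i, ⁅eₙ i, ⁅eₙ i, ⁅eₙ i, x⁆⁆⁆⁆ = 0 := by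
  have key : ∀ l : Loop, ⁅monomial i e, ⁅monomial i e, ⁅monomial i e, l⁆⁆⁆ = 0 := by
    intro l
    induction l using loop_induction with
    | zero => simp
    | add x y hx hy => simp only [lie_add, hx, hy, add_zero]
    | tmul m a =>
      rw [monomial_lie, monomial_lie, monomial_lie, lie_e_lie_e_lie_e, ← coeff_symm_single]
      simp
  have h3 : ⁅eₙ i, ⁅eₙ i, ⁅eₙ i, x⁆⁆⁆.loop = 0 := by
    have := key x.loop
    simp [eₙ, degree_monomial, this]
  ext1
  · rw [lie_loop, h3]; simp [eₙ]
  · rw [lie_cCoeff, h3]; simp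
  · simp

theorem isLocallyAdNilpotent_e (i : ℤ) : IsLocallyAdNilpotent (ι (eₙ i)) := by
  let T : Subalgebra ℂ U :=
    { carrier := {u | ∃ n : ℕ, (adMap (ι (eₙ i)) ^ n) u = 0}
      mul_mem' := by
        rintro u v ⟨a, ha⟩ ⟨b, hb⟩
        exact ⟨a + b, adMap_pow_mul_eq_zero _ _ u v a b le_rfl ha hb⟩
      add_mem' := by
        rintro u v ⟨a, ha⟩ ⟨b, hb⟩
        exact ⟨a + b, by rw [map_add, adMap_pow_eq_zero ha (by omega),
          adMap_pow_eq_zero hb (by omega), add_zero]⟩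
      algebraMap_mem' := fun r => ⟨1, by
        rw [pow_one, adMap_apply, Algebra.commutes, sub_self]⟩ }
  refine fun u => mem_of_ι_mem T (fun x => ⟨4, ?_⟩) u
  have had : ∀ x : AffineSl2, adMap (ι (eₙ i)) (ι x) = ι ⁅eₙ i, x⁆ := fun x => by
    rw [ι_lie, adMap_apply]
  simp only [pow_succ, pow_zero, one_mul, Module.End.mul_apply, had]
  rw [lie_e_pow_four, map_zero]

/-- The vectors annihilated by a power of an ad-nilpotent element form a submodule. -/
def nilpotentSubmodule {g : U} (hg : IsLocallyAdNilpotent g) (V : Type*) [AddCommGroup V]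
    [Module U V] : Submodule U V where
  carrier := {v | ∃ n : ℕ, ∀ m, n ≤ m → g ^ m • v = 0}
  add_mem' := by
    rintro v w ⟨a, ha⟩ ⟨b, hb⟩
    exact ⟨a + b, fun m hm => by rw [smul_add, ha m (by omega), hb m (by omega), add_zero]⟩
  zero_mem' := ⟨0, fun m _ => smul_zero _⟩
  smul_mem' := by
    rintro u v ⟨a, ha⟩
    obtain ⟨N, hN⟩ := hg u
    refine ⟨N + a, fun m hm => ?_⟩
    rw [← mul_smul, pow_mul_eq_sum, Finset.sum_smul]
    refine Finset.sum_eq_zero fun j _ => ?_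
    rcases le_total N j with hj | hj
    · rw [adMap_pow_eq_zero hN hj, zero_mul, smul_zero, zero_smul]
    · rw [Algebra.smul_def, mul_smul, mul_smul, ha (m - j) (by omega), smul_zero, smul_zero]

/-- The submodule of vectors on which eₙ is nilpotent contains x and misses y, so it is proper and
nonzero. -/
theorem not_isSimpleModule_of_nilpotent {V : Type*} [AddCommGroup V] [Module U V] {n : ℤ} {x y : V}
    (hx : x ≠ 0) (hx' : ι (eₙ n) • x = 0) (hy : ∀ k : ℕ, ι (eₙ n) ^ k • y ≠ 0) :
    ¬ IsSimpleModule U V := by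
  intro hV
  rcases eq_bot_or_eq_top (nilpotentSubmodule (isLocallyAdNilpotent_e n) V) with h | h
  · refine hx ((Submodule.mem_bot U).mp (h ▸ ?_))
    refine ⟨1, fun m hm => ?_⟩
    obtain ⟨k, rfl⟩ := Nat.exists_eq_add_of_le' hm
    rw [pow_succ, mul_smul, hx', smul_zero]
  · obtain ⟨k, hk⟩ : y ∈ nilpotentSubmodule (isLocallyAdNilpotent_e n) V := h ▸ Submodule.mem_top
    exact hy k (hk k le_rfl)

namespace Presentation

variable {J κ : ℂ} {S S' : Set Expo} {V : Type*} [AddCommGroup V] [Module U V]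

theorem not_isSimpleModule (P : Presentation J κ S S' V) (hS : IsAdmissible S) {n : ℤ}
    {p q : Laurent} (hp : p ∈ monoSpan S) (hp' : p ∉ monoSpan S') (hpe : eop J n p = 0)
    (hq : q ∈ monoSpan S) (hqe : ∀ k : ℕ, (eop J n ^ k) q ∉ monoSpan S') :
    ¬ IsSimpleModule U V := by
  have hmem := fun u => fockRep_mem (κ := κ) (hS.isStable J) (fun _ => dop_mem κ) u
  refine not_isSimpleModule_of_nilpotent (n := n) (x := P.map ⟨p, hp⟩) (y := P.map ⟨q, hq⟩)
    (fun h => hp' ((P.map_eq_zero_iff _).mp h)) ?_ fun k h => ?_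
  · rw [P.smul_map _ _ 0 (by rw [fockRep_e, hpe]; rfl), map_zero]
  · rw [P.smul_map _ _ ⟨_, hmem _ q hq⟩ rfl, P.map_eq_zero_iff] at h
    refine hqe k ?_
    rwa [← fockRep_e J κ, ← map_pow]

end Presentation

end AffineSl2

namespace AffineSl2

/-! ### Degrees and moments of exponents -/

theorem exists_int_expoMoment {a : Expo} (h : a ∈ polyExpo) : ∃ j : ℤ, expoMoment a = j := by
  rw [expoMoment, Finsupp.linearCombination_apply, Finsupp.sum]
  refine Finset.sum_induction _ (fun r : ℂ => ∃ j : ℤ, r = j) ?_ ⟨0, by simp⟩ fun n _ => ?_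
  · rintro _ _ ⟨j, rfl⟩ ⟨k, rfl⟩
    exact ⟨j + k, by push_cast; rfl⟩
  · obtain ⟨k, hk⟩ := h n
    exact ⟨k * n, by rw [hk, smul_eq_mul]; push_cast; rfl⟩

theorem exists_int_of_mem_twistExpo {i : ℤ} {z : ℂ} {a : Expo} (ha : a ∈ twistExpo i z) :
    ∃ p q : ℤ, expoDeg a = z + p ∧ expoMoment a = z * i + q := by
  obtain ⟨k, hk⟩ := ha.2
  have he := erase_mem_polyExpo ha.1
  obtain ⟨j, hj⟩ := exists_nat_expoDeg he
  obtain ⟨l, hl⟩ := exists_int_expoMoment he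
  refine ⟨k + j, k * i + l, ?_, ?_⟩
  · rw [← Finsupp.single_add_erase i a, map_add, expoDeg_single, hj, hk]
    push_cast; ring
  · rw [← Finsupp.single_add_erase i a, map_add, expoMoment_single, hl, hk]
    push_cast; ring

/-- Exponents with given degree and moment. -/
theorem exists_expo_family (i p q : ℤ) (z : ℂ) : ∃ a : ℕ → Expo, Function.Injective a ∧
    ∀ n, a n ∈ twistExpo i z ∧ (∃ k : ℕ, a n i = z - (k + 1)) ∧ expoDeg (a n) = z + p ∧
      expoMoment (a n) = z * i + q := by
  obtain ⟨N, hN⟩ : ∃ N : ℕ, p ≤ N := ⟨p.natAbs, by omega⟩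
  -- The exponent z + p - 2 - N at i, N at i + 1 and two further variables with indices summing to C
  -- give degree z + p; this C is what the moment requires. Taking N ≥ p makes the xᵢ-exponent z
  -- minus a positive integer.
  set C : ℤ := q - i * (p - 2) - N with hC
  -- The indices x n > i + 1 and C - x n < i keep the four variables distinct for each n.
  set x : ℕ → ℤ := fun n => C.natAbs + i.natAbs + 2 + n with hx
  have hxi : ∀ n, i + 1 < x n := fun n => by simp only [hx]; omega
  have hyi : ∀ n, C - x n < i := fun n => by simp only [hx]; omega
  let a : ℕ → Expo := fun n => Finsupp.single i (z + p - 2 - N) +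
    Finsupp.single (i + 1) (N : ℂ) + Finsupp.single (x n) 1 + Finsupp.single (C - x n) 1
  have hai : ∀ n, a n i = z + p - 2 - N := by
    intro n
    have h1 := hxi n
    have h2 := hyi n
    simp only [a, Finsupp.add_apply, Finsupp.single_eq_same]
    rw [Finsupp.single_eq_of_ne (by omega), Finsupp.single_eq_of_ne (by omega),
      Finsupp.single_eq_of_ne (by omega)]
    ring
  have hav : ∀ n m, m ≠ i → a n m = ((if i + 1 = m then N else 0) +
      (if x n = m then 1 else 0) + (if C - x n = m then 1 else 0) : ℕ) := by
    intro n m hm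
    simp only [a, Finsupp.add_apply, Finsupp.single_apply, if_neg hm.symm]
    push_cast
    ring
  refine ⟨a, fun n m hnm => ?_, fun n => ⟨⟨fun m hm => ⟨_, hav n m hm⟩, ?_⟩, ?_, ?_, ?_⟩⟩
  · by_contra hne
    -- The variable with index C - x n lies below i and determines n: it occurs in the n-th monomial
    -- and in no other.
    have h1 := DFunLike.congr_fun hnm (C - x n)
    rw [hav _ _ (hyi n).ne, hav _ _ (hyi n).ne] at h1
    have h2 := Nat.cast_injective h1
    have h3 := hxi n
    have h4 := hxi m
    have h5 := hyi n
    have h6 : x n ≠ x m := by simp only [hx]; omega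
    rw [if_neg (by omega), if_neg (by omega), if_pos rfl, if_neg (by omega),
      if_neg (by omega)] at h2
    omega
  · exact ⟨p - 2 - N, by rw [hai]; push_cast; ring⟩
  · refine ⟨(N - p + 1).toNat, ?_⟩
    have h1 : (((N - p + 1).toNat : ℤ) : ℂ) = ((N - p + 1 : ℤ) : ℂ) := by
      rw [Int.toNat_of_nonneg (by omega)]
    rw [Int.cast_natCast] at h1
    rw [hai, h1]
    push_cast; ring
  · simp only [a, map_add, expoDeg_single]
    ring
  · simp only [a, map_add, expoMoment_single, hC]
    push_cast; ring

section

variable {lam : Module.Dual ℂ cartan} {J κ : ℂ} {S' : Set Expo} {i : ℤ} {z : ℂ}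
  {V : Type*} [AddCommGroup V] [Module U V] (P : Presentation J κ (twistExpo i z) S' V)
  (hc : lam cartanC = 0) (hJ : lam cartanH = J) (hκ : lam cartanD = κ)
include P hc hJ hκ

/-- The assumption on `S'` covers both the empty set and the polynomial exponents: the monomials of
`exists_expo_family` survive in either quotient, and their weights fill the coset. -/
theorem Presentation.isDense
    (hS' : ∀ a : Expo, (∃ k : ℕ, a i = z - (k + 1)) → a ∉ S') : IsDense V := by
  refine ⟨P.isWeightModule hc hJ hκ, monoWeight lam (Finsupp.single i z), ?_⟩
  have hsub : ∀ a : Expo, ∀ p q : ℤ, expoDeg a = z + p → expoMoment a = z * i + q →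
      monoWeight lam a - monoWeight lam (Finsupp.single i z) = (-p) • β + q • δ := by
    intro a p q h1 h2
    rw [monoWeight, monoWeight, h1, h2, expoDeg_single, expoMoment_single,
      ← Int.cast_smul_eq_zsmul ℂ, ← Int.cast_smul_eq_zsmul ℂ q, Int.cast_neg]
    module
  ext ν
  rw [P.mem_support_iff hc hJ hκ, Set.mem_ofPred_eq, rootLattice, AddSubgroup.mem_closure_pair]
  constructor
  · rintro ⟨a, ha, -, rfl⟩
    obtain ⟨p, q, h1, h2⟩ := exists_int_of_mem_twistExpo ha
    exact ⟨-p, q, (hsub a p q h1 h2).symm⟩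
  · rintro ⟨p, q, h⟩
    obtain ⟨a, -, ha⟩ := exists_expo_family i (-p) q z
    obtain ⟨h1, h2, h3, h4⟩ := ha 0
    refine ⟨a 0, h1, hS' _ h2, ?_⟩
    rw [← sub_left_inj (a := monoWeight lam (Finsupp.single i z)), hsub _ _ _ h3 h4, neg_neg, h]

theorem Presentation.hasInfiniteMultiplicities
    (hS' : ∀ a : Expo, (∃ k : ℕ, a i = z - (k + 1)) → a ∉ S') : HasInfiniteMultiplicities V := by
  intro μ hμ
  obtain ⟨a, ha, -, rfl⟩ := (P.mem_support_iff hc hJ hκ).mp hμ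
  obtain ⟨p, q, h1, h2⟩ := exists_int_of_mem_twistExpo ha
  obtain ⟨b, hb, hb'⟩ := exists_expo_family i p q z
  exact P.not_finite_weightSpace hc hJ hκ hb (fun n => (hb' n).1) (fun n => hS' _ (hb' n).2.1)
    fun n => monoWeight_eq_iff.mpr ⟨(hb' n).2.2.1.trans h1.symm, (hb' n).2.2.2.trans h2.symm⟩

end

/-- Modules with the same image in the generalized Laurent polynomials are isomorphic. -/
theorem nonempty_equiv_of_range_eq {J κ : ℂ} {S : Set Expo} {V V' : Type*} [AddCommGroup V]
    [Module U V] [AddCommGroup V'] [Module U V'] {ψ : V →+ Laurent} {ψ' : V' →+ Laurent}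
    (h : ∀ (u : U) (v : V), ψ (u • v) = fockRep J κ u (ψ v))
    (h' : ∀ (u : U) (v : V'), ψ' (u • v) = fockRep J κ u (ψ' v))
    (hinj : Function.Injective ψ) (hinj' : Function.Injective ψ')
    (hr : ∀ p, (∃ v, ψ v = p) ↔ p ∈ monoSpan S) (hr' : ∀ p, (∃ v, ψ' v = p) ↔ p ∈ monoSpan S) :
    Nonempty (V ≃ₗ[U] V') := by
  have hex : ∀ v, ∃ w, ψ' w = ψ v := fun v => (hr' _).mpr ((hr _).mp ⟨v, rfl⟩)
  choose g hg using hex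
  let G : V →ₗ[U] V' :=
    { toFun := g
      map_add' := fun v w => hinj' (by rw [hg, map_add, map_add, hg, hg])
      map_smul' := fun u v => hinj' (by rw [hg, h, RingHom.id_apply, h', hg]) }
  refine ⟨LinearEquiv.ofBijective G ⟨fun v w hvw => hinj ?_, fun w => ?_⟩⟩
  · rw [← hg, ← hg]
    exact congrArg ψ' hvw
  · obtain ⟨v, hv⟩ := (hr _).mpr ((hr' _).mp ⟨w, rfl⟩)
    exact ⟨v, hinj' ((hg v).trans hv)⟩

theorem monoSpan_empty : monoSpan ∅ = ⊥ := by
  rw [eq_bot_iff]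
  exact fun p hp => AddMonoidAlgebra.ext (Finsupp.ext fun a => by
    by_contra h
    exact hp a h)

theorem isAdmissible_empty : IsAdmissible ∅ := ⟨fun _ h => h.elim, fun _ h => h.elim⟩

theorem ne_zero_of_not_isInteger {z : ℂ} (hz : ¬ IsInteger z) (k : ℤ) : z + k ≠ 0 := fun h =>
  hz ⟨-k, by push_cast; linear_combination h⟩

/-! ### Twisted localizations with nonintegral parameter -/

section Generic

variable {J κ : ℂ} {i : ℤ} {z : ℂ} {V : Type*} [AddCommGroup V] [Module U V]
  (P : Presentation J κ (twistExpo i z) ∅ V)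
include P

theorem Presentation.isTorsionFree (hz : ¬ IsInteger z) (hzJ : ¬ IsInteger (z - J)) :
    IsTorsionFree V := by
  intro n
  rw [P.actsInjectively_iff (isAdmissible_twistExpo i z),
    P.actsInjectively_iff (isAdmissible_twistExpo i z), fockRep_e, fockRep_f]
  refine ⟨fun p hp hp' => eop_not_mem (i := i) n isAdmissible_empty hp' fun a ha _ => ?_,
    fun p hp hp' => fop_not_mem (i := i) (z := z) (fun a _ h => h.elim) hp hp'⟩
  obtain ⟨k, hk⟩ := (hp a ha).2
  obtain ⟨l, -, hl, -⟩ := exists_int_of_mem_twistExpo (hp a ha)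
  -- With aᵢ = z + k and degree z + l, a zero of the factor J + 1 + aᵢ - 2 deg a would give z - J =
  -- 1 + k - 2l.
  refine ⟨fun _ h => hzJ ⟨1 + k - 2 * l, ?_⟩, ?_, ?_, fun b _ hb => hb.elim⟩
  · rw [hk, hl] at h
    push_cast
    linear_combination -h
  · rw [hk]
    exact ne_zero_of_not_isInteger hz k
  · rw [hk]
    intro h
    refine ne_zero_of_not_isInteger hz (k - 1) ?_
    push_cast
    linear_combination h

/-- If z - J is an integer, both xᵢ ^ (J + 1) and xᵢ ^ J belong to the module. The first is killed
by e₋ᵢ. Starting from the second, the coefficients (J - m)(m + 1) never vanish, so e₋ᵢ is not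
nilpotent on it. -/
theorem Presentation.isSimpleModule_generic_iff (hJ : J ≠ 0) (hz : ¬ IsInteger z) :
    IsSimpleModule U V ↔ ¬ IsInteger (z - J) := by
  constructor
  · rintro hV ⟨k, hk⟩
    have hJz : J = z + (-k : ℤ) := by push_cast; linear_combination -hk
    have hmem : ∀ l : ℤ, xpow i (z + l) ∈ monoSpan (twistExpo i z) := fun l =>
      mono_mem_monoSpan.mpr ⟨fun n hn => ⟨0, by simp [hn]⟩, ⟨l, by simp⟩⟩
    refine P.not_isSimpleModule (isAdmissible_twistExpo i z) (n := -i) (p := xpow i (J + 1))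
      (q := xpow i J) ?_ ?_ ?_ ?_ ?_ hV
    · have := hmem (-k + 1)
      rwa [Int.cast_add, Int.cast_one, ← add_assoc, ← hJz] at this
    · rw [monoSpan_empty]
      exact mono_ne_zero _
    · rw [eop_neg_xpow, sub_self, mul_zero, zero_smul]
    · rw [hJz]
      exact hmem (-k)
    · intro n
      obtain ⟨s, hs, h⟩ := eop_neg_pow_xpow (J := J) (i := i) (r := J) (fun m => by
        refine mul_ne_zero ?_ ?_
        · have := ne_zero_of_not_isInteger hz (-k - m)
          intro h
          refine this ?_
          push_cast
          rw [hJz] at h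
          push_cast at h
          linear_combination h
        · rw [show J + 1 - J + (m : ℂ) = (m : ℂ) + 1 by ring]
          exact Nat.cast_add_one_ne_zero m) n
      rw [h, monoSpan_empty, Submodule.mem_bot]
      exact smul_ne_zero hs (mono_ne_zero _)
  · intro hzJ
    refine P.isSimpleModule (isAdmissible_twistExpo i z) ⟨Finsupp.single i z,
      ⟨fun n hn => ⟨0, by simp [hn]⟩, ⟨0, by simp⟩⟩, fun h => h⟩ fun W hW hle p hp hp' => ?_
    rw [monoSpan_empty, Submodule.mem_bot] at hp'
    exact monoSpan_twistExpo_le_of_generic hJ hz hzJ hW hle hp hp'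

end Generic

/-! ### The quotient of the localization as a module -/

section Quotient

variable {J κ : ℂ} {i : ℤ} {V : Type*} [AddCommGroup V] [Module U V]
  (P : Presentation J κ (twistExpo i 0) polyExpo V)
include P

theorem Presentation.isSimpleModule_quotient_iff : IsSimpleModule U V ↔ ¬ IsInteger J := by
  constructor
  · rintro hV ⟨j, rfl⟩
    obtain ⟨v, hv, hv', hve⟩ := exists_eop_neg_eq_zero j i
    -- N ≥ -j makes s = -(N + 2) negative and j + 1 - s positive, so repeated application of e₋ᵢ to
    -- xᵢ ^ s never meets a zero coefficient and only makes the exponent more negative.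
    obtain ⟨N, hN⟩ : ∃ N : ℕ, -j ≤ N := ⟨j.natAbs, by omega⟩
    set s : ℂ := ((-(N + 2) : ℤ) : ℂ) with hs
    refine P.not_isSimpleModule (isAdmissible_twistExpo i 0) hv hv' hve (q := xpow i s) ?_ ?_ hV
    · exact mono_mem_monoSpan.mpr ⟨fun n hn => ⟨0, by simp [hn]⟩, ⟨_, by
        rw [Finsupp.single_eq_same, hs, zero_add]⟩⟩
    · intro n
      obtain ⟨r, hr, h⟩ := eop_neg_pow_xpow (J := j) (i := i) (r := s) (fun m => by
        rw [hs]
        have : ((((-(N + 2)) - m) * (j + 1 - (-(N + 2)) + m) : ℤ) : ℂ) ≠ 0 := by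
          rw [Int.cast_ne_zero]
          exact mul_ne_zero (by omega) (by omega)
        push_cast at this ⊢
        exact this) n
      rw [h]
      intro hmem
      have h2 : xpow i (s - n) ∈ monoSpan polyExpo := by
        have := Submodule.smul_mem _ r⁻¹ hmem
        rwa [smul_smul, inv_mul_cancel₀ hr, one_smul] at this
      refine not_mem_polyExpo_of_neg (i := i) (k := N + 1 + n) ?_ (mono_mem_monoSpan.mp h2)
      rw [Finsupp.single_eq_same, hs]
      push_cast
      ring
  · intro hJ
    refine P.isSimpleModule (isAdmissible_twistExpo i 0) ⟨Finsupp.single i (-1),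
      ⟨fun n hn => ⟨0, by simp [hn]⟩, ⟨-1, by simp⟩⟩,
      not_mem_polyExpo_of_neg (i := i) (k := 0) (by simp)⟩ fun W hW hle p hp hp' => ?_
    exact monoSpan_twistExpo_le_of_lt hJ hW hp (hle hp) hp'

/-- A power of fᵢ clears the denominators, so it is nilpotent modulo polynomials. The other fₙ leave
the xᵢ-exponent untouched, and the eₙ are injective by leading terms, for n = -i thanks to the
nonintegrality of J. -/
theorem Presentation.memW {lam : Module.Dual ℂ cartan} (hc : lam cartanC = 0)
    (hJ' : lam cartanH = J) (hκ : lam cartanD = κ) (hJ : ¬ IsInteger J) :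
    MemW V {-β + i • δ} := by
  have hadm := isAdmissible_twistExpo i 0
  refine ⟨P.isWeightModule hc hJ' hκ, fun n => ⟨fun h => ?_, fun _ => ?_, fun h => ?_, fun h => ?_⟩⟩
  · exfalso
    have h1 := congrArg (fun μ => μ cartanH) (Set.mem_singleton_iff.mp h)
    simp only [LinearMap.add_apply, LinearMap.neg_apply, LinearMap.smul_apply, β_cartanH, δ_cartanH,
      smul_zero, add_zero] at h1
    norm_num at h1
  · rw [P.actsInjectively_iff hadm, fockRep_e]
    exact fun p hp hp' => eop_not_mem_poly n (fun _ => hJ) hp hp'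
  · have hn : n = i := by
      have h1 := congrArg (fun μ => μ cartanD) (Set.mem_singleton_iff.mp h)
      simpa [β_cartanD, δ_cartanD] using h1
    subst hn
    intro v
    obtain ⟨p, rfl⟩ := P.surjective v
    obtain ⟨N, hN⟩ := exists_xpow_mul_mem_poly p.2
    refine ⟨N, ?_⟩
    rw [P.smul_map _ _ ⟨_, fockRep_mem (κ := κ) (hadm.isStable J) (fun _ => dop_mem κ)
      (ι (fₙ n) ^ N) p p.2⟩ rfl, P.map_eq_zero_iff]
    change fockRep J κ (ι (fₙ n) ^ N) p ∈ _
    rw [fockRep_f_pow]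
    exact hN N le_rfl
  · rw [P.actsInjectively_iff hadm, fockRep_f]
    refine fun p hp hp' => fop_not_mem (i := i) (z := 0) (S' := polyExpo)
      (fun a ha (ha' : a + Finsupp.single n 1 ∈ polyExpo) (m : ℤ) => ?_) hp hp'
    have hn : n ≠ i := fun hn => h (by rw [hn]; rfl)
    by_cases hm : m = i
    · obtain ⟨k, hk⟩ := ha' m
      refine ⟨k, ?_⟩
      rwa [hm, Finsupp.add_apply, Finsupp.single_eq_of_ne hn.symm, add_zero, ← hm] at hk
    · exact ha.1 m hm

end Quotient

/-! ### Isomorphisms -/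

/-- Total degrees can be read off weights and lie in z + ℤ, respectively z' + ℤ. The index is
detected by divisibility: fᵢ is onto on the first module, but for i ≠ i' the monomial xᵢ' ^ z' is
not divisible by xᵢ in the second. -/
theorem eq_and_isInteger_of_equiv {lam : Module.Dual ℂ cartan} {J κ : ℂ} (hc : lam cartanC = 0)
    (hJ : lam cartanH = J) (hκ : lam cartanD = κ) {i i' : ℤ} {z z' : ℂ} {V V' : Type*}
    [AddCommGroup V] [Module U V] [AddCommGroup V'] [Module U V']
    (P : Presentation J κ (twistExpo i z) ∅ V) (P' : Presentation J κ (twistExpo i' z') ∅ V')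
    (φ : V ≃ₗ[U] V') : IsInteger (z - z') ∧ i = i' := by
  have hsingle : ∀ (i : ℤ) (z : ℂ), Finsupp.single i z ∈ twistExpo i z := fun i z =>
    ⟨fun n hn => ⟨0, by simp [hn]⟩, ⟨0, by simp⟩⟩
  constructor
  · have hw := (P.hasWeight_map_mono hc hJ hκ (hsingle i z)).map φ.toLinearMap
    have hne : φ (P.map ⟨_, mono_mem_monoSpan.mpr (hsingle i z)⟩) ≠ 0 :=
      φ.map_ne_zero_iff.mpr (P.map_mono_ne_zero (hsingle i z) fun h => h)
    obtain ⟨b, hb, -, h⟩ := (P'.mem_support_iff hc hJ hκ).mp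
      ((Submodule.ne_bot_iff _).mpr ⟨_, hw, hne⟩ : monoWeight lam _ ∈ support V')
    obtain ⟨k, -, hk, -⟩ := exists_int_of_mem_twistExpo hb
    have h1 := (monoWeight_eq_iff.mp h).1
    rw [hk, expoDeg_single] at h1
    exact ⟨k, by linear_combination -h1⟩
  · by_contra hne
    have hmem' := mono_mem_monoSpan.mpr (hsingle i' z')
    obtain ⟨q, hq⟩ : ∃ q, φ (P.map q) = P'.map ⟨_, hmem'⟩ := by
      obtain ⟨v, hv⟩ := φ.surjective (P'.map ⟨_, hmem'⟩)
      obtain ⟨q, rfl⟩ := P.surjective v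
      exact ⟨q, hv⟩
    have hr : xpow i (-1) * q.1 ∈ monoSpan (twistExpo i z) := by
      have h1 := xpow_mul_mem q.2 (-1)
      have h2 := twistExpo_add_int i z (-1)
      push_cast at h2
      rwa [h2] at h1
    have h1 := P.smul_map (ι (fₙ i)) ⟨_, hr⟩ q (by
      rw [fockRep_f, fop_apply, xpow_mul_xpow_neg_mul])
    obtain ⟨w, hw⟩ := P'.surjective (φ (P.map ⟨_, hr⟩))
    have hadm := isAdmissible_twistExpo i' z'
    have h2 := P'.smul_map (ι (fₙ i)) w ⟨_, fockRep_mem (κ := κ) (hadm.isStable J)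
      (fun _ => dop_mem κ) (ι (fₙ i)) w w.2⟩ rfl
    rw [hw, ← map_smul, h1, hq] at h2
    have h3 := P'.coeff_eq_of_map_eq h2 (a := Finsupp.single i' z') (fun h => h)
    rw [coeff_mono_self] at h3
    change 1 = (fockRep J κ (ι (fₙ i)) w).coeff _ at h3
    rw [fockRep_f] at h3
    have h4 := coeffAt_mono_mul (Finsupp.single i' z' + Finsupp.single i (-1))
      (Finsupp.single i 1) w.1
    have h5 : Finsupp.single i (1 : ℂ) + (Finsupp.single i' z' + Finsupp.single i (-1)) =
        Finsupp.single i' z' := by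
      rw [add_left_comm, ← Finsupp.single_add, add_neg_cancel, Finsupp.single_zero, add_zero]
    rw [h5] at h4
    -- A preimage of xᵢ' ^ z' under fᵢ would contain a monomial with exponent -1 at i, where only
    -- natural exponents are allowed.
    have h6 : w.1.coeff (Finsupp.single i' z' + Finsupp.single i (-1)) ≠ 0 := by
      intro h0
      rw [coeffAt_apply, coeffAt_apply, h0] at h4
      exact one_ne_zero (h3.trans h4)
    obtain ⟨k, hk⟩ := (w.2 _ h6).1 i hne
    rw [Finsupp.add_apply, Finsupp.single_eq_same, Finsupp.single_eq_of_ne hne, zero_add] at hk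
    have h7 : ((k + 1 : ℕ) : ℂ) = (0 : ℕ) := by push_cast; linear_combination -hk
    exact absurd (Nat.cast_injective h7) (by omega)

end AffineSl2

/-! ### Presentations of the localizations of `M'(λ)` and the theorem -/

namespace AffineSl2

section

variable {lam : Module.Dual ℂ cartan} {J κ : ℂ} (hc : lam cartanC = 0) (hJ : lam cartanH = J)
  (hκ : lam cartanD = κ)

theorem locLift_verma_smul (i : ℤ) (u : U) (v : Loc i (VermaQuotient lam)) :
    locLift i (vermaHom_smul hc hJ hκ) (u • v) =
      fockRep J κ u (locLift i (vermaHom_smul hc hJ hκ) v) := by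
  rw [← OreLocalization.oreDiv_one_smul, locLift_smul]
  exact LinearMap.congr_fun (locRep_numerator J κ i u) _

/-- The presentation of the twisted localization of `M'(λ)`. -/
noncomputable def twistedLocPresentation (i : ℤ) (z : ℂ) :
    Presentation J κ (twistExpo i z) ∅ (TwistedLoc i z (VermaQuotient lam)) :=
  Presentation.ofEmbedding (twistLift i (vermaHom_smul hc hJ hκ) z) (twistLift_smul i _ z)
    (twistLift_injective i _ z (vermaHom_injective hc hJ hκ))
    (range_twistLift i _ z (range_vermaHom hc hJ hκ)) LinearMap.id Function.surjective_id
    fun v => by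
      rw [monoSpan_empty, Submodule.mem_bot, LinearMap.id_apply,
        map_eq_zero_iff _ (twistLift_injective i _ z (vermaHom_injective hc hJ hκ))]

/-- The presentation of the quotient of the localization of `M'(λ)` by `M'(λ)`. -/
noncomputable def locQuotientPresentation (i : ℤ) :
    Presentation J κ (twistExpo i 0) polyExpo (LocQuotient i (VermaQuotient lam)) :=
  Presentation.ofEmbedding (locLift i (vermaHom_smul hc hJ hκ)) (locLift_verma_smul hc hJ hκ i)
    (locLift_injective i _ (vermaHom_injective hc hJ hκ))
    (range_locLift i _ (range_vermaHom hc hJ hκ)) (Submodule.mkQ _) (Submodule.mkQ_surjective _)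
    fun v => by
      rw [Submodule.mkQ_apply, Submodule.Quotient.mk_eq_zero, ← range_vermaHom hc hJ hκ]
      refine exists_congr fun w => ?_
      rw [← locLift_toLoc i (vermaHom_smul hc hJ hκ) w]
      exact (locLift_injective i _ (vermaHom_injective hc hJ hκ)).eq_iff.symm

end

end AffineSl2

/-- `J ≠ 0` says that `M'(λ)` is irreducible; it is needed only for the irreducibility criterion in
the non-integral case. -/
theorem mainTheorem3 (lam : Module.Dual ℂ AffineSl2.cartan) (J : ℂ)
    (hc : lam AffineSl2.cartanC = 0) (hJ : lam AffineSl2.cartanH = J) :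
    (∀ (i : ℤ) (z : ℂ), AffineSl2.IsInteger z →
      Nonempty (AffineSl2.TwistedLoc i z (AffineSl2.VermaQuotient lam) ≃ₗ[AffineSl2.U]
        AffineSl2.Loc i (AffineSl2.VermaQuotient lam))) ∧
    (∀ i : ℤ,
      (IsSimpleModule AffineSl2.U (AffineSl2.LocQuotient i (AffineSl2.VermaQuotient lam)) ↔
        ¬ AffineSl2.IsInteger J) ∧
      (¬ AffineSl2.IsInteger J →
        AffineSl2.IsDense (AffineSl2.LocQuotient i (AffineSl2.VermaQuotient lam)) ∧
        AffineSl2.MemW (AffineSl2.LocQuotient i (AffineSl2.VermaQuotient lam))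
          {-AffineSl2.β + i • AffineSl2.δ} ∧
        AffineSl2.HasInfiniteMultiplicities
          (AffineSl2.LocQuotient i (AffineSl2.VermaQuotient lam)))) ∧
    (∀ (i : ℤ) (z : ℂ), ¬ AffineSl2.IsInteger z →
      (J ≠ 0 →
        (IsSimpleModule AffineSl2.U (AffineSl2.TwistedLoc i z (AffineSl2.VermaQuotient lam)) ↔
          ¬ AffineSl2.IsInteger (z - J))) ∧
      (¬ AffineSl2.IsInteger (z - J) →
        AffineSl2.IsDense (AffineSl2.TwistedLoc i z (AffineSl2.VermaQuotient lam)) ∧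
        AffineSl2.IsTorsionFree (AffineSl2.TwistedLoc i z (AffineSl2.VermaQuotient lam)) ∧
        AffineSl2.HasInfiniteMultiplicities
          (AffineSl2.TwistedLoc i z (AffineSl2.VermaQuotient lam)))) ∧
    (∀ (i₁ i₂ : ℤ) (z₁ z₂ : ℂ),
      Nonempty (AffineSl2.TwistedLoc i₁ z₁ (AffineSl2.VermaQuotient lam) ≃ₗ[AffineSl2.U]
        AffineSl2.TwistedLoc i₂ z₂ (AffineSl2.VermaQuotient lam)) ↔
      AffineSl2.IsInteger (z₁ - z₂) ∧ i₁ = i₂) := by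
  set κ := lam AffineSl2.cartanD with hκ
  have hz0 : ∀ (i : ℤ) (z z' : ℂ), AffineSl2.IsInteger (z - z') →
      AffineSl2.twistExpo i z = AffineSl2.twistExpo i z' := by
    rintro i z z' ⟨k, hk⟩
    rw [← AffineSl2.twistExpo_add_int i z' k, ← hk, add_sub_cancel]
  have hsm := AffineSl2.vermaHom_smul hc hJ hκ.symm
  have hinj := AffineSl2.vermaHom_injective hc hJ hκ.symm
  have hr := AffineSl2.range_vermaHom hc hJ hκ.symm
  refine ⟨fun i z hz => ?_, fun i => ?_, fun i z hz => ?_, fun i₁ i₂ z₁ z₂ => ⟨?_, ?_⟩⟩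
  · refine AffineSl2.nonempty_equiv_of_range_eq (AffineSl2.twistLift_smul i hsm z)
      (AffineSl2.locLift_verma_smul hc hJ hκ.symm i) (AffineSl2.twistLift_injective i hsm z hinj)
      (AffineSl2.locLift_injective i hsm hinj) (AffineSl2.range_twistLift i hsm z hr) fun p => ?_
    rw [hz0 i z 0 (by rwa [sub_zero])]
    exact AffineSl2.range_locLift i hsm hr p
  · have P := AffineSl2.locQuotientPresentation hc hJ hκ.symm i
    -- Exponents with xᵢ-entry a negative integer are not polynomial, so the family of monomials
    -- used for density and multiplicities survives in the quotient.
    have hneg : ∀ a : AffineSl2.Expo, (∃ k : ℕ, a i = 0 - (k + 1)) → a ∉ AffineSl2.polyExpo := by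
      rintro a ⟨k, hk⟩
      exact AffineSl2.not_mem_polyExpo_of_neg (hk.trans (zero_sub _))
    exact ⟨P.isSimpleModule_quotient_iff, fun hJi => ⟨P.isDense hc hJ hκ.symm hneg,
      P.memW hc hJ hκ.symm hJi, P.hasInfiniteMultiplicities hc hJ hκ.symm hneg⟩⟩
  · have P := AffineSl2.twistedLocPresentation hc hJ hκ.symm i z
    exact ⟨fun hJ0 => P.isSimpleModule_generic_iff hJ0 hz, fun hzJ =>
      ⟨P.isDense hc hJ hκ.symm fun _ _ h => h, P.isTorsionFree hz hzJ,
        P.hasInfiniteMultiplicities hc hJ hκ.symm fun _ _ h => h⟩⟩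
  · rintro ⟨φ⟩
    exact AffineSl2.eq_and_isInteger_of_equiv hc hJ hκ.symm
      (AffineSl2.twistedLocPresentation hc hJ hκ.symm i₁ z₁)
      (AffineSl2.twistedLocPresentation hc hJ hκ.symm i₂ z₂) φ
  · rintro ⟨hz, rfl⟩
    refine AffineSl2.nonempty_equiv_of_range_eq (AffineSl2.twistLift_smul i₁ hsm z₁)
      (AffineSl2.twistLift_smul i₁ hsm z₂) (AffineSl2.twistLift_injective i₁ hsm z₁ hinj)
      (AffineSl2.twistLift_injective i₁ hsm z₂ hinj) (AffineSl2.range_twistLift i₁ hsm z₁ hr)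
      fun p => ?_
    rw [hz0 i₁ z₁ z₂ hz]
    exact AffineSl2.range_twistLift i₁ hsm z₂ hr p
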